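/- Let $V$ be a finite-dimensional real vector space with a lattice $\Lambda$, let $V^*$ be its dual and $V^*_{\mathbb C}=V^*\otimes\mathbb C=\mathrm{Hom}_{\mathbb R}(V,\mathbb C)$. Let $\mathfrak c\subset V$ be a pointed rational polyhedral cone with vertex $0$ (a finite intersection of closed half-spaces bounded by linear hyperplanes that are rational with respect to $\Lambda$, with $\mathfrak c\cap(-\mathfrak c)=\{0\}$), and let $\ell$ be its dimension. The generating function $S(\mathfrak c)(\zeta)=\sum_{x\in\mathfrak c\cap\Lambda}e^{\langle\zeta,x\rangle}$ converges absolutely for all $\zeta\in V^*_{\mathbb C}$ such that $\mathrm{Re}\langle\zeta,x\rangle<0$ for all $x\in\mathfrak c\setminus\{0\}$, and it extends to a meromorphic function on $V^*_{\mathbb C}$. It has homogeneous components $S(\mathfrak c)_{[m]}$, $m\ge-\ell$: these are rational functions on $V^*_{\mathbb C}$, homogeneous of degree $m$, whose denominators are products of linear forms $\langle\zeta,v\rangle$ with $v\in(\mathfrak c\cap\Lambda)\setminus\{0\}$, such that $S(\mathfrak c)(z\zeta)=\sum_{m\ge-\ell}S(\mathfrak c)_{[m]}(\zeta)z^m$ for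 $z\ne0$ near $0$ whenever $\zeta$ lies outside of the hyperplanes defined by these linear forms. For $t>0$ the Riemann sum $$\langle R_t(\mathfrak c),h\rangle=\frac1{t^\ell}\sum_{x\in\mathfrak c\cap\Lambda}h\Bigl(\frac xt\Bigr)$$ is a tempered distribution on $V$. The Fourier transform of a tempered distribution $T$ on $V$ is the tempered generalized function on $V^*$ given on test densities $\psi(\xi)\,d\xi$ by $\langle\mathcal F(T),\psi\,d\xi\rangle=\langle T,\int_{V^*}e^{-i\langle\xi,\cdot\rangle}\psi(\xi)\,d\xi\rangle$. For a function $G$ on $V^*_{\mathbb C}$ and $\lambda\in V^*$, the boundary value $\lim_\lambda G(\xi)$ is the limit of $G(\xi+i\epsilon\lambda)$ as $\epsilon\to0$, $\epsilon>0$, in the sense of tempered generalized functions on $V^*$. An asymptotic expansion $T_t\sim\sum_{k\ge0}t^{-k}A_k$ of tempered distributions (or generalized functions), as $t\to+\infty$ with $t$ real, means that $\langle T_t,h\rangle=\sum_{k=0}^{n}t^{-k}\langle A_k,h\rangle+O(t^{-(n+1)})$ for every Schwartz test function (or density) $h$ and every $n\ge0$. Then there are tempered distributions $F_k$ on $V$,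 $k\ge0$, such that $$R_t(\mathfrak c)\sim\sum_{k=0}^\infty\frac1{t^k}F_k\qquad(t\to+\infty),$$ and, for every $\lambda\in V^*$ such that $-\lambda$ lies in the interior of the dual cone of $\mathfrak c$ (that is, $\langle\lambda,x\rangle<0$ for all $x\in\mathfrak c\setminus\{0\}$), the boundary values below exist, $\mathcal F(F_k)=\lim_\lambda S(\mathfrak c)_{[k-\ell]}(-i\xi)$ for all $k\ge0$, and $$\mathcal F(R_t(\mathfrak c))=t^{-\ell}\lim_\lambda S(\mathfrak c)\Bigl(-i\frac\xi t\Bigr)\sim\sum_{k=0}^\infty\frac1{t^k}\lim_\lambda S(\mathfrak c)_{[k-\ell]}(-i\xi)\qquad(t\to+\infty),$$ where the first equality holds for every $t>0$. -/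

import Mathlib

open Filter Topology MeasureTheory
open scoped SchwartzMap FourierTransform

/-! ### Cones, lattice points -/

/-- A rational polyhedral cone with vertex `0`, with respect to the lattice `Λ`: an intersection of
finitely many closed half-spaces `{f ≥ 0}` whose bounding hyperplanes are rational, that is, given
by linear forms which are integral on `Λ`. -/
def IsRationalCone {V : Type*} [NormedAddCommGroup V] [NormedSpace ℝ V]
    (Λ : Submodule ℤ V) (c : PointedCone ℝ V) : Prop :=
  ∃ s : Finset (V →L[ℝ] ℝ), (∀ f ∈ s, ∀ v ∈ Λ, ∃ n : ℤ, f v = n) ∧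
    ∀ x : V, x ∈ c ↔ ∀ f ∈ s, 0 ≤ f x

/-- The lineality space `{y | y ∈ c and -y ∈ c}` of the cone `c` is `{0}`. -/
def HasTrivialLineality {V : Type*} [NormedAddCommGroup V] [NormedSpace ℝ V]
    (c : PointedCone ℝ V) : Prop :=
  ∀ y : V, y ∈ c → -y ∈ c → y = 0

/-- The dimension of a cone is the dimension of its linear span. -/
noncomputable def coneDim {V : Type*} [NormedAddCommGroup V] [NormedSpace ℝ V]
    (c : PointedCone ℝ V) : ℕ :=
  Module.finrank ℝ (Submodule.span ℝ (c : Set V))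

/-- The lattice points of a cone. -/
def latticePoints {V : Type*} [NormedAddCommGroup V] [NormedSpace ℝ V]
    (Λ : Submodule ℤ V) (c : PointedCone ℝ V) : Set V :=
  {x | x ∈ c ∧ x ∈ Λ}

/-! ### The generating function of a cone and its homogeneous components

The complexified dual space `V*_ℂ = V* ⊗ ℂ` is `V →L[ℝ] ℂ`, the real linear maps from `V` to `ℂ`. -/

/-- The element `ξ + i ε lam` of the complexified dual space, for `ξ`, `lam` in `V*` and `ε` real. -/
noncomputable def complexPoint {V : Type*} [NormedAddCommGroup V] [NormedSpace ℝ V]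
    (ξ lam : V →L[ℝ] ℝ) (ε : ℝ) : V →L[ℝ] ℂ :=
  Complex.ofRealCLM.comp ξ + (Complex.I * (ε : ℂ)) • Complex.ofRealCLM.comp lam

/-- `S` is a meromorphic function on the whole of `V*_ℂ`: locally a quotient of two holomorphic
functions, the denominator being not locally zero. (No value is prescribed where the denominator
vanishes.) -/
def IsMeromorphicOnDual {V : Type*} [NormedAddCommGroup V] [NormedSpace ℝ V]
    (S : (V →L[ℝ] ℂ) → ℂ) : Prop :=
  ∀ ζ₀ : V →L[ℝ] ℂ, ∃ p q : (V →L[ℝ] ℂ) → ℂ, AnalyticAt ℂ p ζ₀ ∧ AnalyticAt ℂ q ζ₀ ∧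
    (¬ ∀ᶠ ζ in 𝓝 ζ₀, q ζ = 0) ∧ ∀ᶠ ζ in 𝓝 ζ₀, q ζ ≠ 0 → S ζ = p ζ / q ζ

/-- `S` is the generating function `S(c)` of the pointed cone `c`: on the tube domain of those `ζ`
with `Re ⟨ζ, x⟩ < 0` for all nonzero `x ∈ c` it is the sum of the absolutely convergent series
`∑_{x ∈ c ∩ Λ} exp ⟨ζ, x⟩`, and it is meromorphic on the whole of `V*_ℂ`. -/
def IsGeneratingFunction {V : Type*} [NormedAddCommGroup V] [NormedSpace ℝ V]
    (Λ : Submodule ℤ V) (c : PointedCone ℝ V) (S : (V →L[ℝ] ℂ) → ℂ) : Prop :=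
  (∀ ζ : V →L[ℝ] ℂ, (∀ x ∈ c, x ≠ 0 → (ζ x).re < 0) →
    HasSum (fun x : latticePoints Λ c => Complex.exp (ζ (x : V))) (S ζ)) ∧
  IsMeromorphicOnDual S

/-- `σ m` is, for every integer `m`, the homogeneous component of degree `m` of `S` (`S` being the
generating function of a cone `c` of dimension `ℓ`).
For a finite set `v` of nonzero lattice vectors of `c`, every `σ m` is a rational function
`P_m(ζ) / ∏_{x ∈ v} ⟨ζ, x⟩`, with `P_m` a homogeneous polynomial on `V*_ℂ` of degree `m + |v|`
(a polynomial in the linear forms `⟨ζ, x⟩`, `x ∈ V`), it vanishes for `m < -ℓ`, and for each `ζ`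
outside of the hyperplanes `⟨ζ, x⟩ = 0`, `x ∈ v`, the Laurent series of `z ↦ S(zζ)` at `z = 0` is
`S(zζ) = ∑_{m ≥ -ℓ} σ_m(ζ) z^m`. -/
def IsHomogeneousExpansion {V : Type*} [NormedAddCommGroup V] [NormedSpace ℝ V]
    (Λ : Submodule ℤ V) (c : PointedCone ℝ V) (S : (V →L[ℝ] ℂ) → ℂ)
    (σ : ℤ → (V →L[ℝ] ℂ) → ℂ) : Prop :=
  ∃ v : Finset V, (∀ x ∈ v, x ∈ latticePoints Λ c ∧ x ≠ 0) ∧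
    (∀ m : ℤ, -(coneDim c : ℤ) ≤ m → ∃ (n : ℕ) (P : MvPolynomial V ℂ),
      (n : ℤ) = m + v.card ∧ P.IsHomogeneous n ∧
      ∀ ζ : V →L[ℝ] ℂ, σ m ζ = MvPolynomial.eval (fun x => ζ x) P / ∏ x ∈ v, ζ x) ∧
    (∀ m : ℤ, m < -(coneDim c : ℤ) → ∀ ζ : V →L[ℝ] ℂ, σ m ζ = 0) ∧
    ∀ ζ : V →L[ℝ] ℂ, (∀ x ∈ v, ζ x ≠ 0) → ∀ᶠ z in 𝓝[≠] (0 : ℂ),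
      HasSum (fun k : ℕ => σ ((k : ℤ) - coneDim c) ζ * z ^ ((k : ℤ) - coneDim c)) (S (z • ζ))

/-! ### Fourier transform of tempered distributions on `V`

The Fourier transform of a tempered distribution `T` on `V` is the tempered generalized function on
`V*` whose value on a test density `ψ(ξ) dξ` is `T` applied to
`x ↦ ∫ exp(-i ⟨ξ, x⟩) ψ(ξ) dξ`. Here `dξ` is a Haar measure `ν` on `V*`. -/

/-- For a Schwartz function `ψ` on `V*`, the function `x ↦ ∫ exp(-i ⟨ξ, x⟩) ψ(ξ) dν(ξ)` is a
Schwartz function on `V` which depends linearly and continuously on `ψ`. -/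
theorem exists_fourierTest {V : Type*} [NormedAddCommGroup V] [NormedSpace ℝ V]
    [FiniteDimensional ℝ V] (ν : Measure (V →L[ℝ] ℝ)) [ν.IsAddHaarMeasure] :
    ∃ L : 𝓢(V →L[ℝ] ℝ, ℂ) →L[ℂ] 𝓢(V, ℂ), ∀ (ψ : 𝓢(V →L[ℝ] ℝ, ℂ)) (x : V),
      L ψ x = ∫ ξ, Complex.exp (-(Complex.I * (ξ x : ℂ))) * ψ ξ ∂ν := by
  let E := EuclideanSpace ℝ (Fin (Module.finrank ℝ V))
  let e : V ≃L[ℝ] E := toEuclidean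
  let e' : E ≃L[ℝ] (V →L[ℝ] ℝ) :=
    (InnerProductSpace.toDual ℝ E).toContinuousLinearEquiv.trans
      (e.symm.arrowCongr (ContinuousLinearEquiv.refl ℝ ℝ))
  have he' : ∀ (y : E) (x : V), e' y x = inner ℝ y (e x) := fun y x => by
    simp [e', ContinuousLinearEquiv.arrowCongr_apply]
  let r : V ≃L[ℝ] E := e.trans
    (ContinuousLinearEquiv.smulLeft (Units.mk0 ((2 * Real.pi)⁻¹ : ℝ) (by positivity)))
  have hr : ∀ x, r x = (2 * Real.pi)⁻¹ • e x := fun x => rfl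
  let μ : Measure E := ν.map e'.symm
  have hμ : μ.IsAddHaarMeasure := e'.symm.isAddHaarMeasure_map ν
  obtain ⟨κ, hκ⟩ : ∃ κ : NNReal, μ = κ • (volume : Measure E) :=
    ⟨_, Measure.isAddLeftInvariant_eq_smul μ volume⟩
  refine ⟨((κ : ℝ) : ℂ) • (SchwartzMap.compCLMOfContinuousLinearEquiv ℂ r).comp
    ((FourierTransform.fourierCLM ℂ 𝓢(E, ℂ)).comp
      (SchwartzMap.compCLMOfContinuousLinearEquiv ℂ e')), fun ψ x => ?_⟩
  have h1 : ∫ ξ, Complex.exp (-(Complex.I * (ξ x : ℂ))) * ψ ξ ∂ν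
      = ∫ y, Complex.exp (-(Complex.I * (e' y x : ℂ))) * ψ (e' y) ∂μ := by
    rw [show μ = ν.map e'.symm.toHomeomorph.toMeasurableEquiv from rfl, integral_map_equiv]
    simp
  rw [h1, hκ, integral_smul_nnreal_measure]
  have h2 : (((κ : ℝ) : ℂ) • (SchwartzMap.compCLMOfContinuousLinearEquiv ℂ r).comp
    ((FourierTransform.fourierCLM ℂ 𝓢(E, ℂ)).comp
      (SchwartzMap.compCLMOfContinuousLinearEquiv ℂ e'))) ψ x
      = ((κ : ℝ) : ℂ) * 𝓕 (fun y => ψ (e' y)) (r x) := rfl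
  rw [h2, Real.fourier_eq']
  rw [NNReal.smul_def, Complex.real_smul]
  congr 2
  ext y
  rw [smul_eq_mul, he', hr, inner_smul_right]
  congr 2
  push_cast
  have : (Real.pi : ℂ) ≠ 0 := by exact_mod_cast Real.pi_ne_zero
  field_simp

/-- The Fourier transform `ψ(ξ) dν(ξ) ↦ (x ↦ ∫ exp(-i ⟨ξ, x⟩) ψ(ξ) dν(ξ))` from test densities on
`V*` to test functions on `V`. -/
noncomputable def fourierTest {V : Type*} [NormedAddCommGroup V] [NormedSpace ℝ V]
    [FiniteDimensional ℝ V] (ν : Measure (V →L[ℝ] ℝ)) [ν.IsAddHaarMeasure] :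
    𝓢(V →L[ℝ] ℝ, ℂ) →L[ℂ] 𝓢(V, ℂ) :=
  (exists_fourierTest ν).choose

theorem fourierTest_apply {V : Type*} [NormedAddCommGroup V] [NormedSpace ℝ V]
    [FiniteDimensional ℝ V] (ν : Measure (V →L[ℝ] ℝ)) [ν.IsAddHaarMeasure]
    (ψ : 𝓢(V →L[ℝ] ℝ, ℂ)) (x : V) :
    fourierTest ν ψ x = ∫ ξ, Complex.exp (-(Complex.I * (ξ x : ℂ))) * ψ ξ ∂ν :=
  (exists_fourierTest ν).choose_spec ψ x

/-- The Fourier transform of a tempered distribution on `V`, a tempered generalized function on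
`V*`: its value at `ψ` is the value of the generalized function on the test density `ψ dν`. -/
noncomputable def fourierDistribution {V : Type*} [NormedAddCommGroup V] [NormedSpace ℝ V]
    [FiniteDimensional ℝ V] (ν : Measure (V →L[ℝ] ℝ)) [ν.IsAddHaarMeasure]
    (T : 𝓢'(V, ℂ)) : 𝓢'(V →L[ℝ] ℝ, ℂ) :=
  PointwiseConvergenceCLM.precomp ℂ (fourierTest ν) T

theorem fourierDistribution_apply {V : Type*} [NormedAddCommGroup V] [NormedSpace ℝ V]
    [FiniteDimensional ℝ V] (ν : Measure (V →L[ℝ] ℝ)) [ν.IsAddHaarMeasure]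
    (T : 𝓢'(V, ℂ)) (ψ : 𝓢(V →L[ℝ] ℝ, ℂ)) :
    fourierDistribution ν T ψ = T (fourierTest ν ψ) := rfl

/-! ### Boundary values, Riemann sums, asymptotic expansions -/

/-- The tempered generalized function `B` on `V*` is the boundary value
`lim_lam G = lim_{ε → 0, ε > 0} G(ξ + i ε lam)` of the function `G` on `V*_ℂ`; the limit is taken in
the sense of tempered generalized functions. -/
def IsBoundaryValue {V : Type*} [NormedAddCommGroup V] [NormedSpace ℝ V]
    (ν : Measure (V →L[ℝ] ℝ)) (lam : V →L[ℝ] ℝ) (G : (V →L[ℝ] ℂ) → ℂ)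
    (B : 𝓢'(V →L[ℝ] ℝ, ℂ)) : Prop :=
  ∀ ψ : 𝓢(V →L[ℝ] ℝ, ℂ),
    (∀ ε : ℝ, 0 < ε → Integrable (fun ξ => G (complexPoint ξ lam ε) * ψ ξ) ν) ∧
    Tendsto (fun ε : ℝ => ∫ ξ, G (complexPoint ξ lam ε) * ψ ξ ∂ν) (𝓝[>] 0) (𝓝 (B ψ))

/-- The tempered distribution `R` is the Riemann sum distribution `R_t(c)`:
`⟨R_t(c), h⟩ = t^{-ℓ} ∑_{x ∈ c ∩ Λ} h(x / t)` for all test functions `h`, with `ℓ = dim c`; the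
series converges absolutely. -/
def IsRiemannSum {V : Type*} [NormedAddCommGroup V] [NormedSpace ℝ V]
    (Λ : Submodule ℤ V) (c : PointedCone ℝ V) (t : ℝ) (R : 𝓢'(V, ℂ)) : Prop :=
  ∀ h : 𝓢(V, ℂ),
    HasSum (fun x : latticePoints Λ c => ((t : ℂ) ^ coneDim c)⁻¹ * h (t⁻¹ • (x : V))) (R h)

/-- `T_t ∼ ∑_{k ≥ 0} t^{-k} A_k` for `t → +∞`, `t` real, in the sense of tempered distributions:
for every test function `h` and every `n`,
`⟨T_t, h⟩ = ∑_{k = 0}^n t^{-k} ⟨A_k, h⟩ + O(t^{-(n+1)})`. -/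
def HasAsymptoticExpansion {W : Type*} [NormedAddCommGroup W] [NormedSpace ℝ W]
    (T : ℝ → 𝓢'(W, ℂ)) (A : ℕ → 𝓢'(W, ℂ)) : Prop :=
  ∀ (h : 𝓢(W, ℂ)) (n : ℕ),
    (fun t : ℝ => T t h - ∑ k ∈ Finset.range (n + 1), ((t : ℂ) ^ k)⁻¹ * A k h)
      =O[atTop] fun t : ℝ => (t ^ (n + 1))⁻¹

/-!
A pointed rational cone is treated through the measures which its lattice points carry, so that
neither triangulations nor residues are needed.

**Decomposition.** By Gordan's lemma (`exists_generators`) the lattice points of the cone `c` are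
the combinations `∑ nᵢ gᵢ` of finitely many generators. The lexicographically minimal exponents
`n` form a lower set of `ℕ^N` in bijection with `c ∩ Λ`, and a lower set of `ℕ^N` is a finite
disjoint union of translated orthants `b + ℕ^J` (`exists_orthant_decomposition`). On each of them
`n ↦ ∑ nᵢ gᵢ` is injective, so that the `gᵢ`, `i ∈ J`, are linearly independent and
`|J| ≤ ℓ = dim c`. Thus (`exists_piece_decomposition`) the Riemann sum of `c` is the sum, over
finitely many pairs of a vector `b` and a list `L` of linearly independent lattice vectors, of the
measures `pieceMeasure`: a power of `t⁻¹` times the convolution of a point mass at `b / t` and of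
the measures `t⁻¹ ∑ₙ δ_{n v / t}`, `v ∈ L`.

**Asymptotics.** For a single ray the Euler-Maclaurin formula reads
`t⁻¹ ∑ₙ h(n v / t) ∼ ∑ₖ t⁻ᵏ ∫ (qₖ ∂ᵥᵏ h)(s v) ds` over `s > 0`, with `∑ qₖ zᵏ = z / (exp z - 1)`;
for a point mass at `b / t` the expansion is Taylor's formula. When the remainders are estimated
uniformly, with rapid decay, under translations by elements of the cone, such expansions are
multiplicative under convolution of measures (`HasEulerMaclaurin.conv`). Hence a piece has an
expansion `∑ₖ t⁻ᵏ ρ ∘ D(Qₖ)`, where `ρ` is the Lebesgue measure of the simplicial cone spanned by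
`L`, and the polynomials `Qₖ`, acting as differential operators, are the coefficients of
`pieceSymbol`. This gives the distributions `Fₖ`.

**Fourier transforms.** The Fourier transform of a measure of polynomial growth on `c` is the
boundary value of its Laplace transform (`isBoundaryValue_of_hasLaplace`, by Fubini and dominated
convergence), and composition of the measure with `D(P)` multiplies the Laplace transform by `P`
(`IsBoundaryValue.mul_eval`). The Laplace transform of a piece at `t = 1` is
`exp ⟨ζ, b⟩ ∏ (1 - exp ⟨ζ, v⟩)⁻¹`, and the sum over the pieces is the generating function; that of
`ρ` is `∏ (-⟨ζ, v⟩)⁻¹`. It remains to see that `∏ (-⟨ζ, v⟩)⁻¹ Qₖ(ζ)`, summed over the pieces, is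
the homogeneous component of degree `k - ℓ` of the generating function (`hasSum_coneComponent`).
This holds because the same power series `∑ Qₖ zᵏ` governs both expansions: evaluated at `ζ` it
converges to `z^(ℓ - |L|) exp (z ⟨ζ, b⟩) ∏ z ⟨ζ, v⟩ (exp (z ⟨ζ, v⟩) - 1)⁻¹`.
-/

open scoped LineDeriv Nat

set_option linter.unusedSectionVars false

/-! ### Constant coefficient differential operators on Schwartz functions -/

section DiffOp

variable {V : Type*} [NormedAddCommGroup V] [NormedSpace ℝ V]

theorem lineDerivOpCLM_comm (v w : V) :
    LineDeriv.lineDerivOpCLM ℂ 𝓢(V, ℂ) v * LineDeriv.lineDerivOpCLM ℂ 𝓢(V, ℂ) w =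
      LineDeriv.lineDerivOpCLM ℂ 𝓢(V, ℂ) w * LineDeriv.lineDerivOpCLM ℂ 𝓢(V, ℂ) v := by
  have key : ∀ (h : 𝓢(V, ℂ)) (x v w : V),
      (∂_{v} (∂_{w} h) : 𝓢(V, ℂ)) x = fderiv ℝ (fderiv ℝ h) x v w := fun h x v w => by
    rw [SchwartzMap.lineDerivOp_apply_eq_fderiv]
    have h1 : DifferentiableAt ℝ (fderiv ℝ h) x :=
      (SchwartzMap.fderivCLM ℝ V ℂ h).differentiableAt
    have h2 : (⇑(∂_{w} h : 𝓢(V, ℂ)) : V → ℂ) = fun y => fderiv ℝ h y w := rfl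
    rw [h2, fderiv_clm_apply h1 (differentiableAt_const w)]
    simp
  ext h x
  simp only [mul_apply_eq_comp, LineDeriv.lineDerivOpCLM_apply, key]
  exact ((h.smooth 2).contDiffAt.isSymmSndFDerivAt (by simp)).eq v w

open scoped IsMulCommutative in
/-- The action of polynomials on Schwartz functions by differential operators with constant
coefficients: the indeterminate with index `v` acts as the directional derivative along `v`. -/
noncomputable def diffOp : MvPolynomial V ℂ →ₐ[ℂ] (𝓢(V, ℂ) →L[ℂ] 𝓢(V, ℂ)) :=
  haveI : IsMulCommutative
      (Algebra.adjoin ℂ (Set.range fun v : V => LineDeriv.lineDerivOpCLM ℂ 𝓢(V, ℂ) v)) :=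
    Algebra.isMulCommutative_adjoin ℂ (by
      rintro _ ⟨v, rfl⟩ _ ⟨w, rfl⟩
      exact lineDerivOpCLM_comm v w)
  (Algebra.adjoin ℂ (Set.range fun v : V => LineDeriv.lineDerivOpCLM ℂ 𝓢(V, ℂ) v)).val.comp
    (MvPolynomial.aeval fun v => ⟨LineDeriv.lineDerivOpCLM ℂ 𝓢(V, ℂ) v,
      Algebra.subset_adjoin ⟨v, rfl⟩⟩)

theorem diffOp_X (v : V) : diffOp (MvPolynomial.X v) = LineDeriv.lineDerivOpCLM ℂ 𝓢(V, ℂ) v := by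
  simp [diffOp]

theorem diffOp_C (a : ℂ) (h : 𝓢(V, ℂ)) : diffOp (MvPolynomial.C a) h = a • h := by
  rw [← MvPolynomial.algebraMap_eq, AlgHom.commutes, Algebra.algebraMap_eq_smul_one]
  rfl

theorem diffOp_mul (P Q : MvPolynomial V ℂ) (h : 𝓢(V, ℂ)) :
    diffOp (P * Q) h = diffOp P (diffOp Q h) := by
  rw [map_mul]
  rfl

theorem diffOp_add (P Q : MvPolynomial V ℂ) (h : 𝓢(V, ℂ)) :
    diffOp (P + Q) h = diffOp P h + diffOp Q h := by
  rw [map_add]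
  rfl

theorem diffOp_sum {ι : Type*} (s : Finset ι) (P : ι → MvPolynomial V ℂ) (h : 𝓢(V, ℂ)) (x : V) :
    diffOp (∑ i ∈ s, P i) h x = ∑ i ∈ s, diffOp (P i) h x := by
  classical
  induction s using Finset.induction_on with
  | empty => simp
  | insert i s hi ih => rw [Finset.sum_insert hi, Finset.sum_insert hi, diffOp_add]; simp

theorem hasDerivAt_schwartz_ray (h : 𝓢(V, ℂ)) (x v : V) (s : ℝ) :
    HasDerivAt (fun s : ℝ => h (x + s • v)) (diffOp (MvPolynomial.X v) h (x + s • v)) s := by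
  rw [diffOp_X]
  have h1 : HasDerivAt (fun s : ℝ => x + s • v) v s := by
    simpa using ((hasDerivAt_id s).smul_const v).const_add x
  exact (h.hasFDerivAt (x + s • v)).comp_hasDerivAt s h1

end DiffOp

/-! ### Weights on a cone and Taylor expansion along a ray -/

section Weight

variable {V : Type*} [NormedAddCommGroup V] [NormedSpace ℝ V]

/-- The weight `(1 + u x)⁻ᴹ`, which measures decay along a cone on which the linear form `u` is
nonnegative. -/
noncomputable def coneWeight (u : V →L[ℝ] ℝ) (M : ℕ) (x : V) : ℝ := ((1 + u x) ^ M)⁻¹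

variable {c : PointedCone ℝ V} {u : V →L[ℝ] ℝ}

theorem coneWeight_nonneg (hu : ∀ x ∈ c, 0 ≤ u x) (M : ℕ) {x : V} (hx : x ∈ c) :
    0 ≤ coneWeight u M x := by
  have := hu x hx
  unfold coneWeight
  positivity

theorem coneWeight_le_one (hu : ∀ x ∈ c, 0 ≤ u x) (M : ℕ) {x : V} (hx : x ∈ c) :
    coneWeight u M x ≤ 1 :=
  inv_le_one_of_one_le₀ (one_le_pow₀ (by linarith [hu x hx]))

theorem coneWeight_anti (hu : ∀ x ∈ c, 0 ≤ u x) {M N : ℕ} (hMN : M ≤ N) {x : V} (hx : x ∈ c) :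
    coneWeight u N x ≤ coneWeight u M x := by
  have := hu x hx
  unfold coneWeight
  gcongr
  linarith

theorem coneWeight_add_le_left (hu : ∀ x ∈ c, 0 ≤ u x) (M : ℕ) {x y : V} (hx : x ∈ c)
    (hy : y ∈ c) : coneWeight u M (x + y) ≤ coneWeight u M x := by
  have h1 := hu x hx
  have h2 := hu y hy
  unfold coneWeight
  rw [map_add]
  gcongr
  linarith

/-- Decay on the cone can be shared between the two summands. -/
theorem coneWeight_add_le (hu : ∀ x ∈ c, 0 ≤ u x) (M N : ℕ) {x y : V} (hx : x ∈ c)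
    (hy : y ∈ c) : coneWeight u (M + N) (x + y) ≤ coneWeight u M x * coneWeight u N y := by
  have h1 := hu x hx
  have h2 := hu y hy
  unfold coneWeight
  rw [map_add, pow_add, mul_inv]
  gcongr <;> linarith

theorem continuous_one_add_pow (u : V →L[ℝ] ℝ) (M : ℕ) : Continuous fun x => (1 + u x) ^ M := by
  fun_prop

theorem measurable_coneWeight [MeasurableSpace V] [BorelSpace V] (u : V →L[ℝ] ℝ) (M : ℕ) :
    Measurable (coneWeight u M) :=
  (continuous_one_add_pow u M).measurable.inv

/-- Since `u` is bounded by a multiple of the norm, Schwartz functions decay on the cone faster than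
every power of `1 + u`. -/
theorem exists_schwartz_le_coneWeight (hu : ∀ x ∈ c, 0 ≤ u x) (h : 𝓢(V, ℂ)) (M : ℕ) :
    ∃ C, 0 ≤ C ∧ ∀ x ∈ c, ‖h x‖ ≤ C * coneWeight u M x := by
  set B := 2 ^ M * ((Finset.Iic (M, 0)).sup fun m => SchwartzMap.seminorm ℂ m.1 m.2) h
  have hB : ∀ x, (1 + ‖x‖) ^ M * ‖h x‖ ≤ B := fun x => by
    simpa using SchwartzMap.one_add_le_sup_seminorm_apply (𝕜 := ℂ) (m := (M, 0)) le_rfl le_rfl h x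
  have hB0 : 0 ≤ B := le_trans (by positivity) (hB 0)
  refine ⟨(1 + ‖u‖) ^ M * B, by positivity, fun x hx => ?_⟩
  have h0 := hu x hx
  have h1 : 1 + u x ≤ (1 + ‖u‖) * (1 + ‖x‖) := by
    have := (le_abs_self (u x)).trans (u.le_opNorm x)
    nlinarith [norm_nonneg u, norm_nonneg x]
  rw [coneWeight, ← div_eq_mul_inv, le_div_iff₀ (by positivity)]
  calc ‖h x‖ * (1 + u x) ^ M ≤ ‖h x‖ * ((1 + ‖u‖) * (1 + ‖x‖)) ^ M := by gcongr
    _ = (1 + ‖u‖) ^ M * ((1 + ‖x‖) ^ M * ‖h x‖) := by rw [mul_pow]; ring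
    _ ≤ _ := by gcongr; exact hB x

theorem continuous_schwartz_ray (h : 𝓢(V, ℂ)) (x v : V) : Continuous fun s : ℝ => h (x + s • v) :=
  h.continuous.comp (by fun_prop)

/-- Taylor expansion along a ray of the cone, with a remainder decaying on the cone. -/
theorem taylor_ray (hu : ∀ x ∈ c, 0 ≤ u x) {v : V} (hv : v ∈ c) (N M : ℕ) :
    ∀ h : 𝓢(V, ℂ), ∃ C, 0 ≤ C ∧ ∀ x ∈ c, ∀ s : ℝ, 0 ≤ s →
      ‖h (x + s • v) - ∑ j ∈ Finset.range N,
        (s : ℂ) ^ j * ((j ! : ℂ)⁻¹ * diffOp (MvPolynomial.X v ^ j) h x)‖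
      ≤ C * s ^ N * coneWeight u M x := by
  induction N with
  | zero =>
    intro h
    obtain ⟨C, hC0, hC⟩ := exists_schwartz_le_coneWeight hu h M
    refine ⟨C, hC0, fun x hx s hs => ?_⟩
    have hsv := c.smul_mem hs hv
    simp only [Finset.range_zero, Finset.sum_empty, sub_zero, pow_zero, mul_one]
    exact (hC _ (c.add_mem hx hsv)).trans
      (mul_le_mul_of_nonneg_left (coneWeight_add_le_left hu M hx hsv) hC0)
  | succ N ih =>
    intro h
    obtain ⟨C, hC0, hC⟩ := ih (diffOp (MvPolynomial.X v) h)
    refine ⟨C, hC0, fun x hx s hs => ?_⟩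
    set w := coneWeight u M x
    have hw : 0 ≤ w := coneWeight_nonneg hu M hx
    -- The derivative of the remainder of order `N + 1` is the remainder of order `N` of `∂_v h`.
    have hder : ∀ r : ℝ, HasDerivAt (fun r : ℝ => h (x + r • v) - ∑ j ∈ Finset.range (N + 1),
        (r : ℂ) ^ j * ((j ! : ℂ)⁻¹ * diffOp (MvPolynomial.X v ^ j) h x))
        (diffOp (MvPolynomial.X v) h (x + r • v) - ∑ j ∈ Finset.range N,
          (r : ℂ) ^ j * ((j ! : ℂ)⁻¹ *
            diffOp (MvPolynomial.X v ^ j) (diffOp (MvPolynomial.X v) h) x)) r := by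
      intro r
      refine (hasDerivAt_schwartz_ray h x v r).sub ?_
      have : ∀ j ∈ Finset.range (N + 1), HasDerivAt (fun r : ℝ =>
          (r : ℂ) ^ j * ((j ! : ℂ)⁻¹ * diffOp (MvPolynomial.X v ^ j) h x))
          (((j : ℂ) * (r : ℂ) ^ (j - 1) * 1) *
            ((j ! : ℂ)⁻¹ * diffOp (MvPolynomial.X v ^ j) h x)) r := fun j _ =>
        (((hasDerivAt_id (r : ℂ)).comp_ofReal.pow j)).mul_const _
      convert! HasDerivAt.fun_sum this using 1
      rw [Finset.sum_range_succ']
      simp only [Nat.cast_zero, zero_mul, add_zero]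
      refine Finset.sum_congr rfl fun j _ => ?_
      rw [← diffOp_mul, ← pow_succ, Nat.factorial_succ]
      have h1 : ((j : ℂ) + 1) ≠ 0 := by exact_mod_cast Nat.succ_ne_zero j
      have h2 : (j ! : ℂ) ≠ 0 := by exact_mod_cast Nat.factorial_ne_zero j
      push_cast
      field_simp
    have hbound := image_norm_le_of_norm_deriv_right_le_deriv_boundary
      (a := 0) (b := s) (fun r _ => (hder r).continuousAt.continuousWithinAt)
      (fun r _ => (hder r).hasDerivWithinAt)
      (B := fun r => C * w * (r ^ (N + 1) / (N + 1)))
      (B' := fun r => C * w * r ^ N) ?_ ?_ ?_ (Set.right_mem_Icc.2 hs)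
    · refine hbound.trans ?_
      have : s ^ (N + 1) / ((N : ℝ) + 1) ≤ s ^ (N + 1) :=
        div_le_self (by positivity) (by linarith [(Nat.cast_nonneg N : (0 : ℝ) ≤ N)])
      calc C * w * (s ^ (N + 1) / (N + 1)) ≤ C * w * s ^ (N + 1) := by gcongr
        _ = _ := by ring
    · rw [Finset.sum_range_succ']
      simp
    · intro r
      have := ((hasDerivAt_pow (N + 1) r).div_const ((N : ℝ) + 1)).const_mul (C * w)
      convert! this using 1
      have h1 : ((N : ℝ) + 1) ≠ 0 := by exact_mod_cast Nat.succ_ne_zero N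
      rw [Nat.add_sub_cancel]
      push_cast
      field_simp
    · intro r hr
      exact (hC x hx r hr.1).trans (by rw [mul_right_comm])

end Weight

/-! ### Temperate measures on a cone -/

section TemperateMeasure

variable {V : Type*} [NormedAddCommGroup V] [NormedSpace ℝ V] [FiniteDimensional ℝ V]
  [MeasurableSpace V] [BorelSpace V]

/-- The measure `μ` lives on the cone `c`, and integrates the weight `(1 + u)⁻ᴹ` to at most `K`. -/
structure TemperateOn (c : PointedCone ℝ V) (u : V →L[ℝ] ℝ) (M : ℕ) (K : ℝ) (μ : Measure V) :
    Prop where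
  sFinite : SFinite μ
  ae_mem : ∀ᵐ x ∂μ, x ∈ c
  integrable : Integrable (coneWeight u M) μ
  integral_le : ∫ x, coneWeight u M x ∂μ ≤ K

variable {c : PointedCone ℝ V} {u : V →L[ℝ] ℝ} {M : ℕ} {K : ℝ} {μ : Measure V}

theorem TemperateOn.integrable_of_le (hμ : TemperateOn c u M K μ)
    {f : V → ℂ} (hf : AEStronglyMeasurable f μ) {C : ℝ}
    (hC : ∀ x ∈ c, ‖f x‖ ≤ C * coneWeight u M x) : Integrable f μ :=
  (hμ.integrable.const_mul C).mono' hf (hμ.ae_mem.mono hC)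

theorem TemperateOn.norm_integral_le (hμ : TemperateOn c u M K μ) {f : V → ℂ} {C : ℝ}
    (hC0 : 0 ≤ C) (hC : ∀ x ∈ c, ‖f x‖ ≤ C * coneWeight u M x) : ‖∫ x, f x ∂μ‖ ≤ C * K := by
  refine (norm_integral_le_of_norm_le (hμ.integrable.const_mul C) (hμ.ae_mem.mono hC)).trans ?_
  rw [integral_const_mul]
  exact mul_le_mul_of_nonneg_left hμ.integral_le hC0

theorem TemperateOn.nonneg (hu : ∀ x ∈ c, 0 ≤ u x) (hμ : TemperateOn c u M K μ) : 0 ≤ K :=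
  (integral_nonneg_of_ae (hμ.ae_mem.mono fun _ hx => coneWeight_nonneg hu M hx)).trans
    hμ.integral_le

theorem TemperateOn.mono (hu : ∀ x ∈ c, 0 ≤ u x) (hμ : TemperateOn c u M K μ) {M' : ℕ}
    (hM : M ≤ M') {K' : ℝ} (hK : K ≤ K') : TemperateOn c u M' K' μ := by
  have h1 : ∀ᵐ x ∂μ, ‖coneWeight u M' x‖ ≤ coneWeight u M x := hμ.ae_mem.mono fun x hx => by
    rw [Real.norm_of_nonneg (coneWeight_nonneg hu M' hx)]
    exact coneWeight_anti hu hM hx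
  have h2 := hμ.integrable.mono' (measurable_coneWeight u M').aestronglyMeasurable h1
  refine ⟨hμ.sFinite, hμ.ae_mem, h2, le_trans ?_ (hμ.integral_le.trans hK)⟩
  exact integral_mono_ae h2 hμ.integrable (hμ.ae_mem.mono fun x hx => coneWeight_anti hu hM hx)

theorem TemperateOn.add {μ' : Measure V} {K' : ℝ} (hμ : TemperateOn c u M K μ)
    (hμ' : TemperateOn c u M K' μ') : TemperateOn c u M (K + K') (μ + μ') := by
  have := hμ.sFinite
  have := hμ'.sFinite
  refine ⟨inferInstance, ae_add_measure_iff.2 ⟨hμ.ae_mem, hμ'.ae_mem⟩,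
    hμ.integrable.add_measure hμ'.integrable, ?_⟩
  rw [integral_add_measure hμ.integrable hμ'.integrable]
  exact add_le_add hμ.integral_le hμ'.integral_le

theorem TemperateOn.conv (hc : IsClosed (c : Set V)) (hu : ∀ x ∈ c, 0 ≤ u x)
    {μ' : Measure V} {M' : ℕ} {K' : ℝ} (hμ : TemperateOn c u M K μ)
    (hμ' : TemperateOn c u M' K' μ') :
    TemperateOn c u (M + M') (K * K') (μ ∗ μ') := by
  have := hμ.sFinite
  have := hμ'.sFinite
  have hae : ∀ᵐ p ∂(μ.prod μ'), p.1 ∈ c ∧ p.2 ∈ c := by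
    have h1 : ∀ᵐ p ∂(μ.prod μ'), p.1 ∈ c := Measure.quasiMeasurePreserving_fst.ae hμ.ae_mem
    have h2 : ∀ᵐ p ∂(μ.prod μ'), p.2 ∈ c := Measure.quasiMeasurePreserving_snd.ae hμ'.ae_mem
    exact h1.and h2
  have hmeas : Measurable fun p : V × V => p.1 + p.2 := measurable_add
  have hprod := hμ.integrable.mul_prod hμ'.integrable
  have hle : ∀ᵐ p ∂(μ.prod μ'), coneWeight u (M + M') (p.1 + p.2) ≤
      coneWeight u M p.1 * coneWeight u M' p.2 :=
    hae.mono fun p hp => coneWeight_add_le hu M M' hp.1 hp.2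
  have hint : Integrable (fun p : V × V => coneWeight u (M + M') (p.1 + p.2)) (μ.prod μ') := by
    refine hprod.mono' ((measurable_coneWeight u _).comp hmeas).aestronglyMeasurable ?_
    filter_upwards [hle, hae] with p h1 h2
    rwa [Real.norm_of_nonneg (coneWeight_nonneg hu _ (c.add_mem h2.1 h2.2))]
  have hmw := (measurable_coneWeight u (M + M')).aestronglyMeasurable (μ := μ ∗ μ')
  refine ⟨inferInstance, ?_, ?_, ?_⟩
  · refine (ae_map_iff hmeas.aemeasurable hc.measurableSet).2
      (hae.mono fun p hp => c.add_mem hp.1 hp.2)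
  · exact (integrable_map_measure hmw hmeas.aemeasurable).2 hint
  · rw [Measure.conv, integral_map hmeas.aemeasurable hmw]
    refine (integral_mono_ae hint hprod hle).trans ?_
    rw [integral_prod_mul]
    have h0 : 0 ≤ ∫ x, coneWeight u M' x ∂μ' :=
      integral_nonneg_of_ae (hμ'.ae_mem.mono fun _ hx => coneWeight_nonneg hu M' hx)
    exact mul_le_mul hμ.integral_le hμ'.integral_le h0 (hμ.nonneg hu)

theorem temperateOn_dirac (hu : ∀ x ∈ c, 0 ≤ u x) {a : V} (ha : a ∈ c) :
    TemperateOn c u 0 1 (Measure.dirac a) := by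
  refine ⟨inferInstance, ?_, ?_, ?_⟩
  · rw [ae_dirac_eq]; exact ha
  · exact integrable_dirac (by simp)
  · rw [integral_dirac]; exact coneWeight_le_one hu 0 ha

theorem TemperateOn.smul (hμ : TemperateOn c u M K μ) {a : ℝ} (ha : 0 ≤ a) :
    TemperateOn c u M (a * K) (ENNReal.ofReal a • μ) := by
  have := hμ.sFinite
  refine ⟨inferInstance, Measure.ae_smul_measure hμ.ae_mem _,
    hμ.integrable.smul_measure ENNReal.ofReal_ne_top, ?_⟩
  rw [integral_smul_measure, ENNReal.toReal_ofReal ha, smul_eq_mul]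
  exact mul_le_mul_of_nonneg_left hμ.integral_le ha

theorem TemperateOn.integrable_schwartz (hu : ∀ x ∈ c, 0 ≤ u x) (hμ : TemperateOn c u M K μ)
    (h : 𝓢(V, ℂ)) {y : V} (hy : y ∈ c) : Integrable (fun x => h (y + x)) μ := by
  obtain ⟨C, hC0, hC⟩ := exists_schwartz_le_coneWeight hu h M
  refine hμ.integrable_of_le (C := C)
    (h.continuous.comp (continuous_const.add continuous_id)).aestronglyMeasurable fun x hx => ?_
  refine (hC _ (c.add_mem hy hx)).trans (mul_le_mul_of_nonneg_left ?_ hC0)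
  rw [add_comm]
  exact coneWeight_add_le_left hu M hx hy

/-- A temperate measure on a cone has temperate growth, hence is a tempered distribution. -/
theorem TemperateOn.hasTemperateGrowth (hu : ∀ x ∈ c, 0 ≤ u x) (hμ : TemperateOn c u M K μ) :
    μ.HasTemperateGrowth := by
  refine ⟨M, (hμ.integrable.const_mul ((1 + ‖u‖) ^ M)).mono' ?_ (hμ.ae_mem.mono fun x hx => ?_)⟩
  · exact (by fun_prop : Measurable fun x : V => (1 + ‖x‖) ^ (-(M : ℝ))).aestronglyMeasurable
  · have h0 := hu x hx
    have h1 : 1 + u x ≤ (1 + ‖u‖) * (1 + ‖x‖) := by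
      have := (le_abs_self (u x)).trans (u.le_opNorm x)
      nlinarith [norm_nonneg u, norm_nonneg x]
    rw [Real.norm_of_nonneg (by positivity), Real.rpow_neg (by positivity), Real.rpow_natCast,
      coneWeight, ← div_eq_mul_inv, inv_eq_one_div, div_le_div_iff₀ (by positivity) (by positivity),
      one_mul, ← mul_pow]
    gcongr

end TemperateMeasure

/-! ### Generalised Euler–Maclaurin expansions -/

section EulerMaclaurin

variable {V : Type*} [NormedAddCommGroup V] [NormedSpace ℝ V] [FiniteDimensional ℝ V]
  [MeasurableSpace V] [BorelSpace V]

/-- The measures `α t` have, for `t → +∞`, the asymptotic expansion `∑ₖ t⁻ᵏ ρ ∘ D(Qₖ)`, where the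
polynomials `Qₖ` act as differential operators; the remainders are required to be uniform, and to
decay rapidly, under translations of the test function by elements of the cone. -/
def HasEulerMaclaurin (c : PointedCone ℝ V) (u : V →L[ℝ] ℝ) (α : ℝ → Measure V) (ρ : Measure V)
    (Q : PowerSeries (MvPolynomial V ℂ)) : Prop :=
  ∀ (h : 𝓢(V, ℂ)) (N M : ℕ), ∃ C, 0 ≤ C ∧ ∀ t : ℝ, 1 ≤ t → ∀ y ∈ c,
    ‖∫ x, h (y + x) ∂(α t) - ∑ k ∈ Finset.range N,
      ((t : ℂ) ^ k)⁻¹ * ∫ x, diffOp (PowerSeries.coeff k Q) h (y + x) ∂ρ‖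
      ≤ C * (t ^ N)⁻¹ * coneWeight u M y

variable {c : PointedCone ℝ V} {u : V →L[ℝ] ℝ}

/-- An expansion persists, uniformly, after convolution with measures obeying a common bound. -/
theorem HasEulerMaclaurin.conv_left (hc : IsClosed (c : Set V))
    (hu : ∀ x ∈ c, 0 ≤ u x) {α : ℝ → Measure V} {ρ : Measure V}
    {Q : PowerSeries (MvPolynomial V ℂ)} (hE : HasEulerMaclaurin c u α ρ Q)
    {Mα Mρ Mμ : ℕ} {Kα Kρ Kμ : ℝ} (hα : ∀ t, 1 ≤ t → TemperateOn c u Mα Kα (α t))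
    (hρ : TemperateOn c u Mρ Kρ ρ) (hK : 0 ≤ Kμ) (h : 𝓢(V, ℂ)) (N M : ℕ) :
    ∃ C, 0 ≤ C ∧ ∀ t : ℝ, 1 ≤ t → ∀ μ : Measure V, TemperateOn c u Mμ Kμ μ → ∀ y ∈ c,
      ‖∫ x, h (y + x) ∂(μ ∗ α t) - ∑ k ∈ Finset.range N,
        ((t : ℂ) ^ k)⁻¹ * ∫ x, diffOp (PowerSeries.coeff k Q) h (y + x) ∂(μ ∗ ρ)‖
        ≤ C * (t ^ N)⁻¹ * coneWeight u M y := by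
  obtain ⟨C, hC0, hC⟩ := hE h N (M + Mμ)
  refine ⟨C * Kμ, by positivity, fun t ht μ hμ y hy => ?_⟩
  have := (hα t ht).sFinite
  have := hρ.sFinite
  have := hμ.sFinite
  have hw := coneWeight_nonneg hu M hy
  have ht0 : 0 < t := by linarith
  -- Convolution integrals as iterated integrals.
  have key : ∀ (g : 𝓢(V, ℂ)) (ν : Measure V) (Mν : ℕ) (Kν : ℝ), TemperateOn c u Mν Kν ν →
      Integrable (fun z => ∫ x, g (y + z + x) ∂ν) μ ∧
      ∫ x, g (y + x) ∂(μ ∗ ν) = ∫ z, ∫ x, g (y + z + x) ∂ν ∂μ := by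
    intro g ν Mν Kν hν
    have := hν.sFinite
    have hi := (hμ.conv hc hu hν).integrable_schwartz hu g hy
    have hi2 : Integrable (fun p : V × V => g (y + (p.1 + p.2))) (μ.prod ν) :=
      (integrable_map_measure hi.aestronglyMeasurable measurable_add.aemeasurable).1 hi
    constructor
    · simpa only [add_assoc] using hi2.integral_prod_left
    · rw [integral_conv hi]
      simp only [add_assoc]
  rw [(key h (α t) _ _ (hα t ht)).2]
  simp_rw [(key _ ρ _ _ hρ).2]
  have hmul : ∀ k : ℕ, ((t : ℂ) ^ k)⁻¹ *
      ∫ z, ∫ x, diffOp (PowerSeries.coeff k Q) h (y + z + x) ∂ρ ∂μ =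
      ∫ z, ((t : ℂ) ^ k)⁻¹ * ∫ x, diffOp (PowerSeries.coeff k Q) h (y + z + x) ∂ρ ∂μ :=
    fun k => (integral_const_mul _ _).symm
  simp_rw [hmul]
  rw [← integral_finsetSum _ fun k _ => ((key _ ρ _ _ hρ).1.const_mul _),
    ← integral_sub (key h (α t) _ _ (hα t ht)).1
      (integrable_finsetSum _ fun k _ => ((key _ ρ _ _ hρ).1.const_mul _))]
  refine (hμ.norm_integral_le (C := C * (t ^ N)⁻¹ * coneWeight u M y) (by positivity)
    fun z hz => ?_).trans (le_of_eq (by ring))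
  refine (hC t ht (y + z) (c.add_mem hy hz)).trans ?_
  rw [mul_assoc _ (coneWeight u M y)]
  exact mul_le_mul_of_nonneg_left (coneWeight_add_le hu M Mμ hy hz) (by positivity)

/-- Expansions are multiplicative: convolution of measures corresponds to the product of the
symbols. -/
theorem HasEulerMaclaurin.conv (hc : IsClosed (c : Set V)) (hu : ∀ x ∈ c, 0 ≤ u x)
    {α α' : ℝ → Measure V} {ρ ρ' : Measure V}
    {Q Q' : PowerSeries (MvPolynomial V ℂ)} (hE : HasEulerMaclaurin c u α ρ Q)
    (hE' : HasEulerMaclaurin c u α' ρ' Q')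
    {Mα Mα' Mρ Mρ' : ℕ} {Kα Kα' Kρ Kρ' : ℝ} (hα : ∀ t, 1 ≤ t → TemperateOn c u Mα Kα (α t))
    (hα' : ∀ t, 1 ≤ t → TemperateOn c u Mα' Kα' (α' t))
    (hρ : TemperateOn c u Mρ Kρ ρ) (hρ' : TemperateOn c u Mρ' Kρ' ρ') :
    HasEulerMaclaurin c u (fun t => α t ∗ α' t) (ρ ∗ ρ') (Q * Q') := by
  intro h N M
  have hKα : 0 ≤ Kα := (hα 1 le_rfl).nonneg hu
  have := hρ.sFinite
  have := hρ'.sFinite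
  obtain ⟨C, hC0, hC⟩ := hE'.conv_left hc hu hα' hρ' (Mμ := Mα) hKα h N M
  have h2 := fun k : ℕ => hE.conv_left hc hu hα hρ (Mμ := Mρ') (hρ'.nonneg hu)
    (diffOp (PowerSeries.coeff k Q') h) (N - k) M
  choose C' hC'0 hC' using h2
  refine ⟨C + ∑ k ∈ Finset.range N, C' k,
    add_nonneg hC0 (Finset.sum_nonneg fun k _ => hC'0 k), fun t ht y hy => ?_⟩
  have ht0 : 0 < t := by linarith
  have htc : (t : ℂ) ≠ 0 := by exact_mod_cast ht0.ne'
  have hw := coneWeight_nonneg hu M hy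
  have := (hα t ht).sFinite
  set A := ∫ x, h (y + x) ∂(α t ∗ α' t)
  set B : ℕ → ℂ := fun k => ∫ x, diffOp (PowerSeries.coeff k Q') h (y + x) ∂(α t ∗ ρ')
  set J : ℕ → ℕ → ℂ := fun k j => ∫ x, diffOp (PowerSeries.coeff j Q)
    (diffOp (PowerSeries.coeff k Q') h) (y + x) ∂(ρ ∗ ρ')
  have h1 : ‖A - ∑ k ∈ Finset.range N, ((t : ℂ) ^ k)⁻¹ * B k‖
      ≤ C * (t ^ N)⁻¹ * coneWeight u M y := hC t ht (α t) (hα t ht) y hy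
  have h2 : ∀ k ∈ Finset.range N, ‖((t : ℂ) ^ k)⁻¹ * B k - ((t : ℂ) ^ k)⁻¹ *
      ∑ j ∈ Finset.range (N - k), ((t : ℂ) ^ j)⁻¹ * J k j‖
      ≤ C' k * (t ^ N)⁻¹ * coneWeight u M y := fun k hk => by
    have := hC' k t ht ρ' hρ' y hy
    rw [Measure.conv_comm ρ' (α t), Measure.conv_comm ρ' ρ] at this
    rw [← mul_sub, norm_mul, norm_inv, norm_pow, Complex.norm_real, Real.norm_of_nonneg ht0.le]
    calc (t ^ k)⁻¹ * _ ≤ (t ^ k)⁻¹ * (C' k * (t ^ (N - k))⁻¹ * coneWeight u M y) := by gcongr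
      _ = C' k * (t ^ k * t ^ (N - k))⁻¹ * coneWeight u M y := by rw [mul_inv]; ring
      _ = _ := by rw [← pow_add, Nat.add_sub_cancel' (Finset.mem_range.1 hk).le]
  have h3 : ∑ m ∈ Finset.range N, ((t : ℂ) ^ m)⁻¹ *
      ∫ x, diffOp (PowerSeries.coeff m (Q * Q')) h (y + x) ∂(ρ ∗ ρ') =
      ∑ k ∈ Finset.range N, ((t : ℂ) ^ k)⁻¹ *
      ∑ j ∈ Finset.range (N - k), ((t : ℂ) ^ j)⁻¹ * J k j := by
    simp_rw [Finset.mul_sum]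
    rw [← Finset.sum_range_diag_flip N
      fun k j => ((t : ℂ) ^ k)⁻¹ * (((t : ℂ) ^ j)⁻¹ * J k j)]
    refine Finset.sum_congr rfl fun m _ => ?_
    rw [mul_comm Q, PowerSeries.coeff_mul, Finset.Nat.sum_antidiagonal_eq_sum_range_succ_mk]
    simp_rw [diffOp_sum]
    rw [integral_finsetSum _ fun k _ => (hρ.conv hc hu hρ').integrable_schwartz hu _ hy,
      Finset.mul_sum]
    refine Finset.sum_congr rfl fun k hk => ?_
    rw [← mul_assoc, ← mul_inv, ← pow_add,
      Nat.add_sub_cancel' (Nat.lt_succ_iff.1 (Finset.mem_range.1 hk)),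
      mul_comm (PowerSeries.coeff k Q')]
    simp_rw [diffOp_mul]
    rfl
  rw [h3]
  calc _ = ‖(A - ∑ k ∈ Finset.range N, ((t : ℂ) ^ k)⁻¹ * B k) +
        ∑ k ∈ Finset.range N, (((t : ℂ) ^ k)⁻¹ * B k - ((t : ℂ) ^ k)⁻¹ *
          ∑ j ∈ Finset.range (N - k), ((t : ℂ) ^ j)⁻¹ * J k j)‖ := by
        rw [Finset.sum_sub_distrib]
        congr 1
        ring
    _ ≤ C * (t ^ N)⁻¹ * coneWeight u M y +
        ∑ k ∈ Finset.range N, C' k * (t ^ N)⁻¹ * coneWeight u M y :=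
        (norm_add_le _ _).trans (add_le_add h1 ((norm_sum_le _ _).trans (Finset.sum_le_sum h2)))
    _ = _ := by rw [add_mul, add_mul, Finset.sum_mul, Finset.sum_mul]

end EulerMaclaurin

/-! ### Expansions for translations, scalars and one-dimensional lattice rays -/

section Symbols

variable {V : Type*}

/-- The symbol `q(X_v T)` obtained from a power series `q` in one variable and a vector `v`. -/
noncomputable def raySymbol (q : PowerSeries ℂ) (v : V) : PowerSeries (MvPolynomial V ℂ) :=
  PowerSeries.mk fun k => MvPolynomial.C (PowerSeries.coeff k q) * MvPolynomial.X v ^ k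

theorem coeff_raySymbol (q : PowerSeries ℂ) (v : V) (k : ℕ) :
    PowerSeries.coeff k (raySymbol q v) =
      MvPolynomial.C (PowerSeries.coeff k q) * MvPolynomial.X v ^ k :=
  PowerSeries.coeff_mk k _

/-- The power series of `(exp z - 1) / z`. -/
noncomputable def expDivSeries : PowerSeries ℂ := PowerSeries.mk fun n => ((n + 1)! : ℂ)⁻¹

/-- The power series of `z / (exp z - 1)`, whose coefficients are the `Bₙ / n!` with `Bₙ` the
Bernoulli numbers. -/
noncomputable def toddSeries : PowerSeries ℂ := expDivSeries⁻¹

theorem constantCoeff_expDivSeries : PowerSeries.constantCoeff expDivSeries = 1 := by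
  rw [← PowerSeries.coeff_zero_eq_constantCoeff_apply]
  simp [expDivSeries]

theorem toddSeries_mul : toddSeries * expDivSeries = 1 :=
  PowerSeries.inv_mul_cancel _ (by rw [constantCoeff_expDivSeries]; exact one_ne_zero)

theorem sum_toddSeries (m : ℕ) : ∑ k ∈ Finset.range (m + 1),
    PowerSeries.coeff k toddSeries * ((m - k + 1)! : ℂ)⁻¹ = if m = 0 then 1 else 0 := by
  have h := congrArg (PowerSeries.coeff m) toddSeries_mul
  rw [PowerSeries.coeff_mul, Finset.Nat.sum_antidiagonal_eq_sum_range_succ_mk,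
    PowerSeries.coeff_one] at h
  simpa [expDivSeries] using h

end Symbols

section BaseExpansions

variable {V : Type*} [NormedAddCommGroup V] [NormedSpace ℝ V] [FiniteDimensional ℝ V]
  [MeasurableSpace V] [BorelSpace V] {c : PointedCone ℝ V} {u : V →L[ℝ] ℝ}

theorem diffOp_C_mul (a : ℂ) (P : MvPolynomial V ℂ) (h : 𝓢(V, ℂ)) (x : V) :
    diffOp (MvPolynomial.C a * P) h x = a * diffOp P h x := by
  rw [diffOp_mul, diffOp_C]
  rfl

/-- Translation by `a / t` has the expansion `exp (∂_a / t)`. -/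
theorem hasEulerMaclaurin_dirac (hu : ∀ x ∈ c, 0 ≤ u x) {a : V} (ha : a ∈ c) :
    HasEulerMaclaurin c u (fun t => Measure.dirac (t⁻¹ • a)) (Measure.dirac 0)
      (raySymbol (PowerSeries.exp ℂ) a) := by
  intro h N M
  obtain ⟨C, hC0, hC⟩ := taylor_ray hu ha N M h
  refine ⟨C, hC0, fun t ht y hy => ?_⟩
  have ht0 : 0 < t := by linarith
  have h1 := hC y hy t⁻¹ (by positivity)
  rw [integral_dirac, ← inv_pow]
  refine le_trans (le_of_eq ?_) h1
  congr 2
  refine Finset.sum_congr rfl fun k _ => ?_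
  rw [integral_dirac, coeff_raySymbol, diffOp_C_mul, PowerSeries.coeff_exp, add_zero]
  simp

theorem hasEulerMaclaurin_smul_dirac (hu : ∀ x ∈ c, 0 ≤ u x) (e : ℕ) :
    HasEulerMaclaurin c u (fun t => ENNReal.ofReal ((t ^ e)⁻¹) • Measure.dirac (0 : V))
      (Measure.dirac 0) (PowerSeries.X ^ e) := by
  intro h N M
  obtain ⟨C, hC0, hC⟩ := exists_schwartz_le_coneWeight hu h M
  refine ⟨C, hC0, fun t ht y hy => ?_⟩
  have ht0 : 0 < t := by linarith
  have hw := coneWeight_nonneg hu M hy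
  have hsum : ∑ k ∈ Finset.range N, ((t : ℂ) ^ k)⁻¹ *
      ∫ x, diffOp (PowerSeries.coeff k (PowerSeries.X ^ e : PowerSeries (MvPolynomial V ℂ)))
        h (y + x) ∂(Measure.dirac 0)
      = if e < N then ((t : ℂ) ^ e)⁻¹ * h y else 0 := by
    simp only [← Finset.mem_range (n := N)]
    rw [← Finset.sum_ite_eq' (Finset.range N) e fun k => ((t : ℂ) ^ k)⁻¹ * h y]
    refine Finset.sum_congr rfl fun k _ => ?_
    rw [integral_dirac, PowerSeries.coeff_X_pow, add_zero]
    split_ifs <;> simp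
  rw [hsum, integral_smul_measure, integral_dirac, ENNReal.toReal_ofReal (by positivity), add_zero,
    Complex.real_smul]
  push_cast
  split_ifs with he
  · rw [sub_self, norm_zero]
    positivity
  · rw [sub_zero, norm_mul, norm_inv, norm_pow, Complex.norm_real, Real.norm_of_nonneg ht0.le]
    calc (t ^ e)⁻¹ * ‖h y‖ ≤ (t ^ N)⁻¹ * (C * coneWeight u M y) := by
          gcongr
          · omega
          · exact hC y hy
      _ = _ := by ring

/-- The lattice ray measure `t⁻¹ ∑ₙ δ_{n v / t}`. -/
noncomputable def latticeRay (v : V) (t : ℝ) : Measure V :=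
  ENNReal.ofReal t⁻¹ • Measure.sum fun n : ℕ => Measure.dirac (((n : ℝ) * t⁻¹) • v)

/-- The image of Lebesgue measure on the half-line under `s ↦ s v`. -/
noncomputable def lebesgueRay (v : V) : Measure V :=
  (volume.restrict (Set.Ioi (0 : ℝ))).map fun s => s • v

theorem sum_ray_weight_le {δ : ℝ} (hδ : 0 < δ) (K : ℕ) :
    ∑ n ∈ Finset.range K, δ * ((1 + n * δ) ^ 2)⁻¹ ≤ δ + 1 := by
  have key : ∀ K : ℕ, ∑ n ∈ Finset.range (K + 1), δ * ((1 + n * δ) ^ 2)⁻¹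
      ≤ δ + 1 - (1 + K * δ)⁻¹ := by
    intro K
    induction K with
    | zero => simp
    | succ K ih =>
      rw [Finset.sum_range_succ]
      have hK : (0 : ℝ) ≤ K * δ := by positivity
      -- The sum is dominated by a telescoping one.
      have h1 : δ * ((1 + (K + 1 : ℕ) * δ) ^ 2)⁻¹
          ≤ (1 + K * δ)⁻¹ - (1 + (K + 1 : ℕ) * δ)⁻¹ := by
        push_cast
        rw [inv_sub_inv (by positivity) (by positivity), ← div_eq_mul_inv,
          div_le_div_iff₀ (by positivity) (by positivity)]
        nlinarith [mul_nonneg hδ.le (mul_nonneg hδ.le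
          (by positivity : 0 ≤ 1 + ((K : ℝ) + 1) * δ))]
      linarith
  refine le_trans (Finset.sum_le_sum_of_subset_of_nonneg (Finset.range_mono (Nat.le_succ K))
    fun n _ _ => by positivity) ((key K).trans ?_)
  have : 0 ≤ (1 + K * δ)⁻¹ := by positivity
  linarith

theorem temperateOn_latticeRay (hu : ∀ x ∈ c, 0 ≤ u x) {v : V}
    (hv : v ∈ c) (huv : 1 ≤ u v) {t : ℝ} (ht : 0 < t) :
    TemperateOn c u 2 (t⁻¹ + 1) (latticeRay v t) := by
  have hδ : 0 < t⁻¹ := by positivity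
  have hmem : ∀ n : ℕ, ((n : ℝ) * t⁻¹) • v ∈ c := fun n => c.smul_mem (by positivity) hv
  have hle : ∀ n : ℕ, t⁻¹ * coneWeight u 2 (((n : ℝ) * t⁻¹) • v)
      ≤ t⁻¹ * ((1 + n * t⁻¹) ^ 2)⁻¹ := fun n => by
    have : (n : ℝ) * t⁻¹ ≤ n * t⁻¹ * u v := le_mul_of_one_le_right (by positivity) huv
    rw [coneWeight, map_smul, smul_eq_mul]
    gcongr
  have hsum : Summable fun n : ℕ => t⁻¹ * coneWeight u 2 (((n : ℝ) * t⁻¹) • v) :=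
    Summable.of_nonneg_of_le
      (fun n => mul_nonneg hδ.le (coneWeight_nonneg hu 2 (hmem n))) hle
      (summable_of_sum_range_le (fun n => by positivity) (sum_ray_weight_le hδ))
  have hsum' : Summable fun n : ℕ => coneWeight u 2 (((n : ℝ) * t⁻¹) • v) :=
    (summable_mul_left_iff hδ.ne').1 hsum
  have hint : Integrable (coneWeight u 2)
      (Measure.sum fun n : ℕ => Measure.dirac (((n : ℝ) * t⁻¹) • v)) := by
    refine integrable_sum_measure (fun n => integrable_dirac (by simp)) ?_
    simp_rw [integral_dirac]
    exact hsum'.norm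
  refine ⟨by unfold latticeRay; infer_instance, ?_, hint.smul_measure ENNReal.ofReal_ne_top, ?_⟩
  · refine Measure.ae_smul_measure ((Measure.ae_sum_iff).2 fun n => ?_) _
    rw [ae_dirac_eq]
    exact hmem n
  · rw [latticeRay, integral_smul_measure, ENNReal.toReal_ofReal hδ.le,
      ← (hasSum_integral_measure hint).tsum_eq, smul_eq_mul, ← tsum_mul_left]
    simp_rw [integral_dirac]
    refine hsum.tsum_le_of_sum_range_le fun K => ?_
    exact (Finset.sum_le_sum fun n _ => hle n).trans (sum_ray_weight_le hδ K)

theorem temperateOn_lebesgueRay (hc : IsClosed (c : Set V)) (hu : ∀ x ∈ c, 0 ≤ u x) {v : V}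
    (hv : v ∈ c) (huv : 1 ≤ u v) :
    TemperateOn c u 2 (∫ x, coneWeight u 2 x ∂(lebesgueRay v)) (lebesgueRay v) := by
  have hm : Measurable fun s : ℝ => s • v := by fun_prop
  refine ⟨by unfold lebesgueRay; infer_instance, ?_, ?_, le_rfl⟩
  · refine (ae_map_iff hm.aemeasurable hc.measurableSet).2 ?_
    exact (ae_restrict_mem measurableSet_Ioi).mono fun s hs => c.smul_mem (le_of_lt hs) hv
  · refine (integrable_map_measure (measurable_coneWeight u 2).aestronglyMeasurable
      hm.aemeasurable).2 ?_
    have h1 : Integrable fun s : ℝ => (1 + ‖s‖) ^ (-(2 : ℝ)) :=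
      integrable_one_add_norm (by simp)
    refine (h1.integrableOn (s := Set.Ioi 0)).mono'
      ((measurable_coneWeight u 2).comp hm).aestronglyMeasurable ?_
    refine (ae_restrict_mem measurableSet_Ioi).mono fun s (hs : 0 < s) => ?_
    have h2 : s ≤ s * u v := le_mul_of_one_le_right hs.le huv
    rw [Function.comp_apply, Real.norm_of_nonneg (coneWeight_nonneg hu 2 (c.smul_mem hs.le hv)),
      Real.norm_of_nonneg hs.le, Real.rpow_neg (by positivity), coneWeight, map_smul, smul_eq_mul]
    have : (1 + s) ^ (2 : ℝ) = (1 + s) ^ 2 := by norm_cast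
    rw [this]
    gcongr

end BaseExpansions

section RayExpansion

variable {V : Type*} [NormedAddCommGroup V] [NormedSpace ℝ V] [FiniteDimensional ℝ V]
  [MeasurableSpace V] [BorelSpace V] {c : PointedCone ℝ V} {u : V →L[ℝ] ℝ}

/-- One step of the Euler–Maclaurin expansion: on a short segment, the truncated Todd operator
followed by integration reproduces the value of the function at the initial point, because
`z / (exp z - 1)` is inverse to `∫₀¹ exp (r z) dr`. -/
theorem todd_segment (hu : ∀ x ∈ c, 0 ≤ u x) {v : V} (hv : v ∈ c) (h : 𝓢(V, ℂ)) (N M : ℕ) :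
    ∃ C, 0 ≤ C ∧ ∀ x ∈ c, ∀ δ : ℝ, 0 ≤ δ →
      ‖(δ : ℂ) * h x - ∑ k ∈ Finset.range N, (δ : ℂ) ^ k *
        ∫ s in (0 : ℝ)..δ, diffOp (PowerSeries.coeff k (raySymbol toddSeries v)) h (x + s • v)‖
      ≤ C * δ ^ (N + 1) * coneWeight u M x := by
  rcases Nat.eq_zero_or_pos N with rfl | hN
  · obtain ⟨C, hC0, hC⟩ := exists_schwartz_le_coneWeight hu h M
    refine ⟨C, hC0, fun x hx δ hδ => ?_⟩
    rw [Finset.sum_range_zero, sub_zero, norm_mul, Complex.norm_real, Real.norm_of_nonneg hδ]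
    calc δ * ‖h x‖ ≤ δ * (C * coneWeight u M x) := by gcongr; exact hC x hx
      _ = _ := by ring
  set g : ℕ → 𝓢(V, ℂ) := fun k => diffOp (PowerSeries.coeff k (raySymbol toddSeries v)) h
  choose C hC0 hC using fun k => taylor_ray hu hv (N - k) M (g k)
  refine ⟨∑ k ∈ Finset.range N, C k, Finset.sum_nonneg fun k _ => hC0 k, fun x hx δ hδ => ?_⟩
  have hw := coneWeight_nonneg hu M hx
  -- The truncated Taylor polynomial of `g k` along the segment, and its integral.
  have hpoly : ∀ k, ∫ s in (0 : ℝ)..δ, ∑ j ∈ Finset.range (N - k),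
      (s : ℂ) ^ j * ((j ! : ℂ)⁻¹ * diffOp (MvPolynomial.X v ^ j) (g k) x) =
      ∑ j ∈ Finset.range (N - k), (δ : ℂ) ^ (j + 1) *
        (((j + 1)! : ℂ)⁻¹ * diffOp (MvPolynomial.X v ^ j) (g k) x) := fun k => by
    rw [intervalIntegral.integral_finsetSum fun j _ =>
      Continuous.intervalIntegrable (by fun_prop) _ _]
    refine Finset.sum_congr rfl fun j _ => ?_
    rw [intervalIntegral.integral_mul_const]
    have h1 : ∫ s in (0 : ℝ)..δ, (s : ℂ) ^ j = ((δ ^ (j + 1) / (j + 1) : ℝ) : ℂ) := by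
      simp_rw [← Complex.ofReal_pow]
      rw [intervalIntegral.integral_ofReal, integral_pow]
      simp
    rw [h1, Nat.factorial_succ]
    have h2 : ((j : ℂ) + 1) ≠ 0 := by exact_mod_cast Nat.succ_ne_zero j
    have h3 : (j ! : ℂ) ≠ 0 := by exact_mod_cast Nat.factorial_ne_zero j
    push_cast
    field_simp
  have herr : ∀ k ∈ Finset.range N, ‖(δ : ℂ) ^ k * ∑ j ∈ Finset.range (N - k),
      (δ : ℂ) ^ (j + 1) * (((j + 1)! : ℂ)⁻¹ * diffOp (MvPolynomial.X v ^ j) (g k) x) -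
      (δ : ℂ) ^ k * ∫ s in (0 : ℝ)..δ, g k (x + s • v)‖
      ≤ C k * δ ^ (N + 1) * coneWeight u M x := fun k hk => by
    rw [← hpoly, ← mul_sub, ← intervalIntegral.integral_sub
      (Continuous.intervalIntegrable (by fun_prop) _ _)
      ((continuous_schwartz_ray (g k) x v).intervalIntegrable _ _), norm_mul, norm_pow,
      Complex.norm_real, Real.norm_of_nonneg hδ]
    have h1 := intervalIntegral.norm_integral_le_of_norm_le_const (a := 0) (b := δ)
      (f := fun s : ℝ => (∑ j ∈ Finset.range (N - k),
        (s : ℂ) ^ j * ((j ! : ℂ)⁻¹ * diffOp (MvPolynomial.X v ^ j) (g k) x)) - g k (x + s • v))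
      (C := C k * δ ^ (N - k) * coneWeight u M x) fun s hs => by
        rw [Set.uIoc_of_le hδ] at hs
        rw [norm_sub_rev]
        have hs0 := hs.1.le
        have hsδ := hs.2
        have hCk := hC0 k
        refine (hC k x hx s hs0).trans ?_
        gcongr
    rw [sub_zero, abs_of_nonneg hδ] at h1
    calc δ ^ k * _ ≤ δ ^ k * (C k * δ ^ (N - k) * coneWeight u M x * δ) := by gcongr
      _ = C k * ((δ ^ k * δ ^ (N - k)) * δ) * coneWeight u M x := by ring
      _ = _ := by rw [← pow_add, Nat.add_sub_cancel' (Finset.mem_range.1 hk).le, pow_succ]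
  have hmain : ∑ k ∈ Finset.range N, (δ : ℂ) ^ k * ∑ j ∈ Finset.range (N - k),
      (δ : ℂ) ^ (j + 1) * (((j + 1)! : ℂ)⁻¹ * diffOp (MvPolynomial.X v ^ j) (g k) x) =
      (δ : ℂ) * h x := by
    simp_rw [Finset.mul_sum]
    rw [← Finset.sum_range_diag_flip N fun k j => (δ : ℂ) ^ k * ((δ : ℂ) ^ (j + 1) *
      (((j + 1)! : ℂ)⁻¹ * diffOp (MvPolynomial.X v ^ j) (g k) x))]
    have h1 : ∀ m ∈ Finset.range N, (∑ k ∈ Finset.range (m + 1), (δ : ℂ) ^ k *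
        ((δ : ℂ) ^ (m - k + 1) *
          (((m - k + 1)! : ℂ)⁻¹ * diffOp (MvPolynomial.X v ^ (m - k)) (g k) x))) =
        if m = 0 then (δ : ℂ) * h x else 0 := fun m _ => by
      have h2 : ∀ k ∈ Finset.range (m + 1), (δ : ℂ) ^ k * ((δ : ℂ) ^ (m - k + 1) *
          (((m - k + 1)! : ℂ)⁻¹ * diffOp (MvPolynomial.X v ^ (m - k)) (g k) x)) =
          (δ : ℂ) ^ (m + 1) * diffOp (MvPolynomial.X v ^ m) h x *
          (PowerSeries.coeff k toddSeries * ((m - k + 1)! : ℂ)⁻¹) := fun k hk => by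
        have hkm : k ≤ m := Nat.lt_succ_iff.1 (Finset.mem_range.1 hk)
        have h3 : diffOp (MvPolynomial.X v ^ (m - k)) (g k) x =
            PowerSeries.coeff k toddSeries * diffOp (MvPolynomial.X v ^ m) h x := by
          simp only [g]
          rw [← diffOp_mul, coeff_raySymbol, mul_left_comm, ← pow_add, Nat.sub_add_cancel hkm,
            diffOp_C_mul]
        have h4 : (δ : ℂ) ^ (m + 1) = (δ : ℂ) ^ k * (δ : ℂ) ^ (m - k + 1) := by
          rw [← pow_add]
          congr 1
          omega
        rw [h3, h4]
        ring
      rw [Finset.sum_congr rfl h2, ← Finset.mul_sum, sum_toddSeries]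
      split_ifs with hm
      · subst hm
        simp
      · simp
    rw [Finset.sum_congr rfl h1, Finset.sum_ite_eq' (Finset.range N) 0 fun _ => (δ : ℂ) * h x,
      if_pos (Finset.mem_range.2 hN)]
  rw [← hmain, ← Finset.sum_sub_distrib]
  refine (norm_sum_le _ _).trans ((Finset.sum_le_sum herr).trans (le_of_eq ?_))
  rw [Finset.sum_mul, Finset.sum_mul]

/-- The Euler–Maclaurin formula on a ray: Riemann sums along `v` have the expansion
`(∂_v / t) / (exp (∂_v / t) - 1)`. -/
theorem hasEulerMaclaurin_latticeRay (hc : IsClosed (c : Set V)) (hu : ∀ x ∈ c, 0 ≤ u x) {v : V}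
    (hv : v ∈ c) (huv : 1 ≤ u v) :
    HasEulerMaclaurin c u (latticeRay v) (lebesgueRay v) (raySymbol toddSeries v) := by
  intro h N M
  obtain ⟨C, hC0, hC⟩ := todd_segment hu hv h N (M + 2)
  refine ⟨C * 2, by positivity, fun t ht y hy => ?_⟩
  have ht0 : 0 < t := by linarith
  set δ := t⁻¹ with hδ_def
  have hδ : 0 < δ := by positivity
  have hδ1 : δ ≤ 1 := inv_le_one_of_one_le₀ ht
  set g : ℕ → 𝓢(V, ℂ) := fun k => diffOp (PowerSeries.coeff k (raySymbol toddSeries v)) h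
  have hw := coneWeight_nonneg hu M hy
  have hm : Measurable fun s : ℝ => s • v := by fun_prop
  -- Both sides are limits of partial sums over the first segments of length `δ`.
  have hlim1 : Tendsto (fun K : ℕ => ∑ n ∈ Finset.range K, (δ : ℂ) * h (y + (n * δ) • v)) atTop
      (𝓝 (∫ x, h (y + x) ∂(latticeRay v t))) := by
    have hi := (temperateOn_latticeRay hu hv huv ht0).integrable_schwartz hu h hy
    have hi' : Integrable (fun x => h (y + x))
        (Measure.sum fun n : ℕ => Measure.dirac (((n : ℝ) * t⁻¹) • v)) := by
      have h0 : ENNReal.ofReal t⁻¹ ≠ 0 := by simpa using ht0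
      exact (integrable_smul_measure h0 ENNReal.ofReal_ne_top).1 hi
    have h1 := ((hasSum_integral_measure hi').mul_left (δ : ℂ)).tendsto_sum_nat
    simp_rw [integral_dirac] at h1
    rwa [latticeRay, integral_smul_measure, ENNReal.toReal_ofReal hδ.le, Complex.real_smul]
  have hlim2 : ∀ k, Tendsto (fun K : ℕ => ∑ n ∈ Finset.range K,
      ∫ s in (0 : ℝ)..δ, g k (y + (n * δ) • v + s • v)) atTop
      (𝓝 (∫ x, g k (y + x) ∂(lebesgueRay v))) := fun k => by
    have hi := (temperateOn_lebesgueRay hc hu hv huv).integrable_schwartz hu (g k) hy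
    have hi' : IntegrableOn (fun s : ℝ => g k (y + s • v)) (Set.Ioi 0) :=
      (integrable_map_measure hi.aestronglyMeasurable hm.aemeasurable).1 hi
    have hK : Tendsto (fun K : ℕ => (K : ℝ) * δ) atTop atTop :=
      tendsto_natCast_atTop_atTop.atTop_mul_const hδ
    have h1 := intervalIntegral_tendsto_integral_Ioi 0 hi' hK
    rw [lebesgueRay, integral_map hm.aemeasurable hi.aestronglyMeasurable]
    refine h1.congr fun K => ?_
    have h2 := intervalIntegral.sum_integral_adjacent_intervals (n := K)
      (a := fun n : ℕ => (n : ℝ) * δ) (f := fun s : ℝ => g k (y + s • v)) (μ := volume)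
      fun n _ => (continuous_schwartz_ray (g k) y v).intervalIntegrable _ _
    simp only [Nat.cast_zero, zero_mul] at h2
    rw [← h2]
    refine Finset.sum_congr rfl fun n _ => ?_
    have h3 := intervalIntegral.integral_comp_add_left (a := 0) (b := δ)
      (fun s : ℝ => g k (y + s • v)) ((n : ℝ) * δ)
    have h4 : (n : ℝ) * δ + δ = ((n + 1 : ℕ) : ℝ) * δ := by push_cast; ring
    rw [add_zero, h4] at h3
    rw [← h3]
    simp only [add_smul, add_assoc]
  have hlim := (hlim1.sub (tendsto_finsetSum (Finset.range N)
    fun k _ => (hlim2 k).const_mul ((t : ℂ) ^ k)⁻¹)).norm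
  refine le_of_tendsto hlim (Eventually.of_forall fun K => ?_)
  have hrw : ∑ n ∈ Finset.range K, (δ : ℂ) * h (y + (n * δ) • v) -
      ∑ k ∈ Finset.range N, ((t : ℂ) ^ k)⁻¹ * ∑ n ∈ Finset.range K,
        ∫ s in (0 : ℝ)..δ, g k (y + (n * δ) • v + s • v) =
      ∑ n ∈ Finset.range K, ((δ : ℂ) * h (y + (n * δ) • v) - ∑ k ∈ Finset.range N, (δ : ℂ) ^ k *
        ∫ s in (0 : ℝ)..δ, g k (y + (n * δ) • v + s • v)) := by
    rw [Finset.sum_sub_distrib, Finset.sum_comm (s := Finset.range K)]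
    congr 1
    refine Finset.sum_congr rfl fun k _ => ?_
    rw [Finset.mul_sum, hδ_def, Complex.ofReal_inv, inv_pow]
  rw [hrw]
  have hmem : ∀ n : ℕ, ((n : ℝ) * δ) • v ∈ c := fun n => c.smul_mem (by positivity) hv
  have hterm : ∀ n ∈ Finset.range K, ‖(δ : ℂ) * h (y + (n * δ) • v) -
      ∑ k ∈ Finset.range N, (δ : ℂ) ^ k *
        ∫ s in (0 : ℝ)..δ, g k (y + (n * δ) • v + s • v)‖ ≤
      C * δ ^ N * coneWeight u M y * (δ * ((1 + n * δ) ^ 2)⁻¹) := fun n _ => by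
    refine (hC _ (c.add_mem hy (hmem n)) δ hδ.le).trans ?_
    have h1 := coneWeight_add_le hu M 2 hy (hmem n)
    have h2 : coneWeight u 2 (((n : ℝ) * δ) • v) ≤ ((1 + n * δ) ^ 2)⁻¹ := by
      have : (n : ℝ) * δ ≤ n * δ * u v := le_mul_of_one_le_right (by positivity) huv
      rw [coneWeight, map_smul, smul_eq_mul]
      gcongr
    calc C * δ ^ (N + 1) * coneWeight u (M + 2) (y + (n * δ) • v)
        ≤ C * δ ^ (N + 1) * (coneWeight u M y * ((1 + n * δ) ^ 2)⁻¹) := by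
          gcongr
          exact h1.trans (by gcongr)
      _ = _ := by ring
  refine (norm_sum_le _ _).trans ((Finset.sum_le_sum hterm).trans ?_)
  rw [← Finset.mul_sum]
  calc _ ≤ C * δ ^ N * coneWeight u M y * 2 := by
        gcongr
        exact (sum_ray_weight_le hδ K).trans (by linarith)
    _ = _ := by rw [hδ_def, inv_pow]; ring

end RayExpansion

/-! ### Laplace transforms of temperate measures on a cone -/

section Laplace

variable {V : Type*} [NormedAddCommGroup V] [NormedSpace ℝ V] [FiniteDimensional ℝ V]
  {c : PointedCone ℝ V} {u : V →L[ℝ] ℝ}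

/-- By compactness of the unit sphere, a linear form which is negative on `c ∖ {0}` is bounded above
by a negative multiple of the norm. -/
theorem exists_norm_le_neg (hc : IsClosed (c : Set V)) {lam : V →L[ℝ] ℝ}
    (hlam : ∀ x ∈ c, x ≠ 0 → lam x < 0) : ∃ κ, 0 < κ ∧ ∀ x ∈ c, κ * ‖x‖ ≤ -lam x := by
  have hK : IsCompact ((c : Set V) ∩ Metric.sphere 0 1) := (isCompact_sphere 0 1).inter_left hc
  have hscale : ∀ x ∈ c, x ≠ 0 → ‖x‖⁻¹ • x ∈ (c : Set V) ∩ Metric.sphere 0 1 := fun x hx hx0 => by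
    refine ⟨c.smul_mem (by positivity) hx, ?_⟩
    simpa using norm_smul_inv_norm (𝕜 := ℝ) hx0
  rcases ((c : Set V) ∩ Metric.sphere 0 1).eq_empty_or_nonempty with he | hne
  · refine ⟨1, one_pos, fun x hx => ?_⟩
    by_cases hx0 : x = 0
    · simp [hx0]
    · exact absurd (hscale x hx hx0) (by simp [he])
  · obtain ⟨x₀, hx₀, hmax⟩ := hK.exists_isMaxOn hne lam.continuous.continuousOn
    have hx₀0 : x₀ ≠ 0 := by
      rintro rfl
      simpa using hx₀.2
    refine ⟨-lam x₀, by linarith [hlam x₀ hx₀.1 hx₀0], fun x hx => ?_⟩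
    by_cases hx0 : x = 0
    · simp [hx0]
    · have h1 : lam (‖x‖⁻¹ • x) ≤ lam x₀ := hmax (hscale x hx hx0)
      have hn : 0 < ‖x‖ := norm_pos_iff.2 hx0
      rw [map_smul, smul_eq_mul, inv_mul_le_iff₀ hn] at h1
      linarith

theorem exists_exp_le_coneWeight (hc : IsClosed (c : Set V)) (hu : ∀ x ∈ c, 0 ≤ u x)
    {lam : V →L[ℝ] ℝ} (hlam : ∀ x ∈ c, x ≠ 0 → lam x < 0) (M : ℕ) :
    ∃ C, 0 ≤ C ∧ ∀ x ∈ c, Real.exp (lam x) ≤ C * coneWeight u M x := by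
  obtain ⟨κ, hκ, h⟩ := exists_norm_le_neg hc hlam
  set a := κ / (‖u‖ + 1)
  have ha : 0 < a := by positivity
  refine ⟨M ! * Real.exp a / a ^ M, by positivity, fun x hx => ?_⟩
  have h0 := hu x hx
  have h1 : a * u x ≤ -lam x := by
    refine le_trans ?_ (h x hx)
    rw [div_mul_eq_mul_div, div_le_iff₀ (by positivity), mul_assoc]
    gcongr
    have := (le_abs_self (u x)).trans (u.le_opNorm x)
    nlinarith [norm_nonneg x]
  have h2 := Real.pow_div_factorial_le_exp (a * (1 + u x)) (by positivity) M
  have h3 : Real.exp (lam x) ≤ (Real.exp (a * u x))⁻¹ := by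
    rw [← Real.exp_neg]
    exact Real.exp_le_exp.2 (by linarith)
  refine h3.trans ?_
  rw [coneWeight, ← div_eq_mul_inv, div_div, inv_eq_one_div,
    div_le_div_iff₀ (Real.exp_pos _) (by positivity), one_mul, ← mul_pow]
  rw [div_le_iff₀ (by positivity), mul_add, mul_one, Real.exp_add] at h2
  calc _ = (a + a * u x) ^ M := by ring
    _ ≤ _ := h2
    _ = _ := by ring

theorem neg_I_smul_complexPoint_apply (ξ lam : V →L[ℝ] ℝ) (ε : ℝ) (x : V) :
    (-Complex.I • complexPoint ξ lam ε) x = ε * lam x - Complex.I * ξ x := by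
  have : (-Complex.I • complexPoint ξ lam ε) x
      = -Complex.I * (ξ x + (Complex.I * ε) * lam x) := rfl
  rw [this]
  linear_combination (-(ε : ℂ) * lam x) * Complex.I_mul_I

/-- The tube domain of the `ζ` with `Re ⟨ζ, x⟩ < 0` for all nonzero `x` in the cone. -/
def tubeDomain (c : PointedCone ℝ V) : Set (V →L[ℝ] ℂ) :=
  {ζ | ∀ x ∈ c, x ≠ 0 → (ζ x).re < 0}

variable [MeasurableSpace V] [BorelSpace V] {M : ℕ} {K : ℝ} {μ : Measure V}

theorem exists_cexp_le_coneWeight (hc : IsClosed (c : Set V)) (hu : ∀ x ∈ c, 0 ≤ u x)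
    {ζ : V →L[ℝ] ℂ} (hζ : ζ ∈ tubeDomain c) (M : ℕ) :
    ∃ C, 0 ≤ C ∧ ∀ x ∈ c, ‖Complex.exp (ζ x)‖ ≤ C * coneWeight u M x := by
  simp_rw [Complex.norm_exp]
  exact exists_exp_le_coneWeight hc hu (lam := Complex.reCLM.comp ζ) hζ M

theorem TemperateOn.integrable_cexp (hc : IsClosed (c : Set V)) (hu : ∀ x ∈ c, 0 ≤ u x)
    (hμ : TemperateOn c u M K μ) {ζ : V →L[ℝ] ℂ} (hζ : ζ ∈ tubeDomain c) :
    Integrable (fun x => Complex.exp (ζ x)) μ := by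
  obtain ⟨C, -, hC⟩ := exists_cexp_le_coneWeight hc hu hζ M
  exact hμ.integrable_of_le (Continuous.aestronglyMeasurable (by fun_prop)) hC

/-- The function `G` is the Laplace transform of `μ` on the tube domain. -/
def HasLaplace (c : PointedCone ℝ V) (μ : Measure V) (G : (V →L[ℝ] ℂ) → ℂ) : Prop :=
  ∀ ζ ∈ tubeDomain c, ∫ x, Complex.exp (ζ x) ∂μ = G ζ

theorem hasLaplace_dirac (a : V) : HasLaplace c (Measure.dirac a) fun ζ => Complex.exp (ζ a) :=
  fun _ _ => integral_dirac _ _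

theorem HasLaplace.conv (hc : IsClosed (c : Set V)) (hu : ∀ x ∈ c, 0 ≤ u x) {μ' : Measure V}
    {M' : ℕ} {K' : ℝ} (hμ : TemperateOn c u M K μ) (hμ' : TemperateOn c u M' K' μ')
    {G G' : (V →L[ℝ] ℂ) → ℂ} (hG : HasLaplace c μ G) (hG' : HasLaplace c μ' G') :
    HasLaplace c (μ ∗ μ') fun ζ => G ζ * G' ζ := fun ζ hζ => by
  have := hμ.sFinite
  have := hμ'.sFinite
  rw [integral_conv ((hμ.conv hc hu hμ').integrable_cexp hc hu hζ)]
  simp_rw [map_add, Complex.exp_add, integral_const_mul, integral_mul_const]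
  rw [hG ζ hζ, hG' ζ hζ]

theorem hasLaplace_latticeRay (hc : IsClosed (c : Set V)) (hu : ∀ x ∈ c, 0 ≤ u x) {v : V}
    (hv : v ∈ c) (huv : 1 ≤ u v) :
    HasLaplace c (latticeRay v 1) fun ζ => (1 - Complex.exp (ζ v))⁻¹ := fun ζ hζ => by
  have hv0 : v ≠ 0 := by
    rintro rfl
    simp at huv
    linarith
  have hi := (temperateOn_latticeRay hu hv huv one_pos).integrable_cexp hc hu hζ
  rw [latticeRay, inv_one, ENNReal.ofReal_one, one_smul] at hi ⊢
  rw [← (hasSum_integral_measure hi).tsum_eq]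
  simp_rw [integral_dirac, mul_one, map_smul, Complex.real_smul, Complex.ofReal_natCast,
    Complex.exp_nat_mul]
  refine tsum_geometric_of_norm_lt_one ?_
  rw [Complex.norm_exp, Real.exp_lt_one_iff]
  exact hζ v hv hv0

theorem hasLaplace_lebesgueRay (hc : IsClosed (c : Set V)) (hu : ∀ x ∈ c, 0 ≤ u x) {v : V}
    (hv : v ∈ c) (huv : 1 ≤ u v) :
    HasLaplace c (lebesgueRay v) fun ζ => -(ζ v)⁻¹ := fun ζ hζ => by
  have hv0 : v ≠ 0 := by
    rintro rfl
    simp at huv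
    linarith
  have hi := (temperateOn_lebesgueRay hc hu hv huv).integrable_cexp hc hu hζ
  have hm : Measurable fun s : ℝ => s • v := by fun_prop
  rw [lebesgueRay, integral_map hm.aemeasurable hi.aestronglyMeasurable]
  simp_rw [map_smul, Complex.real_smul, mul_comm _ (ζ v)]
  rw [integral_exp_mul_complex_Ioi (hζ v hv hv0)]
  simp [neg_div]

/-! ### Boundary values -/

theorem neg_I_smul_complexPoint_mem {lam : V →L[ℝ] ℝ} (hlam : ∀ x ∈ c, x ≠ 0 → lam x < 0)
    (ξ : V →L[ℝ] ℝ) {ε : ℝ} (hε : 0 < ε) : -Complex.I • complexPoint ξ lam ε ∈ tubeDomain c := by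
  intro x hx hx0
  rw [neg_I_smul_complexPoint_apply]
  simpa using mul_neg_of_pos_of_neg hε (hlam x hx hx0)

/-- The Fourier transform of a temperate measure on the cone is the boundary value of its Laplace
transform. -/
theorem isBoundaryValue_of_hasLaplace (hc : IsClosed (c : Set V)) (hu : ∀ x ∈ c, 0 ≤ u x)
    (hμ : TemperateOn c u M K μ) {G : (V →L[ℝ] ℂ) → ℂ} (hG : HasLaplace c μ G) {T : 𝓢'(V, ℂ)}
    (hT : ∀ h, T h = ∫ x, h x ∂μ) {lam : V →L[ℝ] ℝ} (hlam : ∀ x ∈ c, x ≠ 0 → lam x < 0)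
    (ν : Measure (V →L[ℝ] ℝ)) [ν.IsAddHaarMeasure] :
    IsBoundaryValue ν lam (fun ζ => G (-Complex.I • ζ)) (fourierDistribution ν T) := by
  intro ψ
  have := hμ.sFinite
  have hscale : ∀ {ε : ℝ}, 0 < ε → ∀ x ∈ c, x ≠ 0 → (ε • lam) x < 0 := fun hε x hx hx0 => by
    simpa using mul_neg_of_pos_of_neg hε (hlam x hx hx0)
  -- The double integral, to which Fubini's theorem is applied.
  have hF : ∀ ε : ℝ, 0 < ε → Integrable (fun p : (V →L[ℝ] ℝ) × V =>
      Complex.exp (-(Complex.I * (p.1 p.2 : ℂ))) *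
        (ψ p.1 * ((Real.exp (ε * lam p.2) : ℝ) : ℂ))) (ν.prod μ) := fun ε hε => by
    obtain ⟨C, -, hC⟩ := exists_exp_le_coneWeight hc hu (hscale hε) M
    have h1 : Integrable (fun x => ((Real.exp (ε * lam x) : ℝ) : ℂ)) μ := by
      refine hμ.integrable_of_le (C := C)
        (by fun_prop : Continuous _).aestronglyMeasurable fun x hx => ?_
      rw [Complex.norm_real, Real.norm_of_nonneg (Real.exp_pos _).le]
      exact hC x hx
    refine (ψ.integrable.mul_prod h1).bdd_mul (c := 1) ?_ ?_
    · refine Continuous.aestronglyMeasurable ?_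
      have : Continuous fun p : (V →L[ℝ] ℝ) × V => p.1 p.2 :=
        continuous_fst.clm_apply continuous_snd
      fun_prop
    · refine Eventually.of_forall fun p => ?_
      rw [Complex.norm_exp]
      simp
  have hGF : ∀ ε : ℝ, 0 < ε → ∀ ξ : V →L[ℝ] ℝ,
      G (-Complex.I • complexPoint ξ lam ε) * ψ ξ =
      ∫ x, Complex.exp (-(Complex.I * (ξ x : ℂ))) *
        (ψ ξ * ((Real.exp (ε * lam x) : ℝ) : ℂ)) ∂μ := fun ε hε ξ => by
    rw [← hG _ (neg_I_smul_complexPoint_mem hlam ξ hε), ← integral_mul_const]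
    refine integral_congr_ae (Eventually.of_forall fun x => ?_)
    simp only
    rw [neg_I_smul_complexPoint_apply, sub_eq_add_neg, Complex.exp_add]
    push_cast
    ring
  constructor
  · intro ε hε
    exact (hF ε hε).integral_prod_left.congr (Eventually.of_forall fun ξ => (hGF ε hε ξ).symm)
  · have h1 : ∀ ε : ℝ, 0 < ε → ∫ ξ, G (-Complex.I • complexPoint ξ lam ε) * ψ ξ ∂ν =
        ∫ x, ((Real.exp (ε * lam x) : ℝ) : ℂ) * fourierTest ν ψ x ∂μ := fun ε hε => by
      simp_rw [hGF ε hε]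
      rw [integral_integral_swap (hF ε hε)]
      refine integral_congr_ae (Eventually.of_forall fun x => ?_)
      simp only
      rw [fourierTest_apply, ← integral_const_mul]
      refine integral_congr_ae (Eventually.of_forall fun ξ => ?_)
      simp only
      ring
    rw [fourierDistribution_apply, hT]
    refine Tendsto.congr' (eventually_nhdsWithin_of_forall fun ε hε => (h1 ε hε).symm) ?_
    obtain ⟨C, hC0, hC⟩ := exists_schwartz_le_coneWeight hu (fourierTest ν ψ) M
    refine tendsto_integral_filter_of_dominated_convergence (fun x => C * coneWeight u M x) ?_ ?_
      (hμ.integrable.const_mul C) ?_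
    · exact Eventually.of_forall fun ε => Continuous.aestronglyMeasurable (by fun_prop)
    · refine eventually_nhdsWithin_of_forall fun ε (hε : 0 < ε) => hμ.ae_mem.mono fun x hx => ?_
      have h2 : Real.exp (ε * lam x) ≤ 1 := by
        rw [Real.exp_le_one_iff]
        by_cases hx0 : x = 0
        · simp [hx0]
        · exact (hscale hε x hx hx0).le
      rw [norm_mul, Complex.norm_real, Real.norm_of_nonneg (Real.exp_pos _).le]
      exact (mul_le_of_le_one_left (norm_nonneg _) h2).trans (hC x hx)
    · refine Eventually.of_forall fun x => ?_
      have h3 : Tendsto (fun ε : ℝ => ((Real.exp (ε * lam x) : ℝ) : ℂ) * fourierTest ν ψ x) (𝓝 0)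
          (𝓝 (((Real.exp (0 * lam x) : ℝ) : ℂ) * fourierTest ν ψ x)) :=
        (by fun_prop : Continuous fun ε : ℝ =>
          ((Real.exp (ε * lam x) : ℝ) : ℂ) * fourierTest ν ψ x).tendsto 0
      simp only [zero_mul, Real.exp_zero, Complex.ofReal_one, one_mul] at h3
      exact h3.mono_left nhdsWithin_le_nhds

end Laplace

section BoundaryValueDerivative

variable {V : Type*} [NormedAddCommGroup V] [NormedSpace ℝ V] [FiniteDimensional ℝ V]

theorem hasTemperateGrowth_neg_I_mul (v : V) :
    (fun ξ : V →L[ℝ] ℝ => -(Complex.I * (ξ v : ℂ))).HasTemperateGrowth := by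
  have h : (fun ξ : V →L[ℝ] ℝ => -(Complex.I * (ξ v : ℂ))) =
      ⇑(-((ContinuousLinearMap.mul ℝ ℂ Complex.I).comp
        (Complex.ofRealCLM.comp (ContinuousLinearMap.apply ℝ ℝ v)))) := by
    ext ξ
    simp
  rw [h]
  exact ContinuousLinearMap.hasTemperateGrowth _

/-- Multiplication by `-i⟨ξ, v⟩` is carried by the Fourier transform to the derivative along `v`. -/
theorem fourierTest_smulLeft (ν : Measure (V →L[ℝ] ℝ)) [ν.IsAddHaarMeasure] (v : V)
    (ψ : 𝓢(V →L[ℝ] ℝ, ℂ)) :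
    fourierTest ν (SchwartzMap.smulLeftCLM ℂ (fun ξ => -(Complex.I * (ξ v : ℂ))) ψ) =
      diffOp (MvPolynomial.X v) (fourierTest ν ψ) := by
  ext x
  set ψ' := SchwartzMap.smulLeftCLM ℂ (fun ξ : V →L[ℝ] ℝ => -(Complex.I * (ξ v : ℂ))) ψ
  have hψ' : ∀ ξ, ψ' ξ = -(Complex.I * (ξ v : ℂ)) * ψ ξ := fun ξ =>
    SchwartzMap.smulLeftCLM_apply_apply (hasTemperateGrowth_neg_I_mul v) ψ ξ
  have h1 := hasDerivAt_schwartz_ray (fourierTest ν ψ) x v 0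
  rw [zero_smul, add_zero] at h1
  refine HasDerivAt.unique (f := fun s : ℝ => fourierTest ν ψ (x + s • v)) (x := 0) ?_ h1
  simp_rw [fourierTest_apply]
  have hcont : ∀ y : V, Continuous fun ξ : V →L[ℝ] ℝ => Complex.exp (-(Complex.I * (ξ y : ℂ))) :=
    fun y => by
      have : Continuous fun ξ : V →L[ℝ] ℝ => ξ y := continuous_id.clm_apply continuous_const
      fun_prop
  have hnorm : ∀ r : ℝ, ‖Complex.exp (-(Complex.I * (r : ℂ)))‖ = 1 := fun r => by
    rw [Complex.norm_exp]
    simp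
  have key := hasDerivAt_integral_of_dominated_loc_of_deriv_le (μ := ν) (x₀ := (0 : ℝ))
    (s := Set.univ)
    (F := fun s ξ => Complex.exp (-(Complex.I * (ξ (x + s • v) : ℂ))) * ψ ξ)
    (F' := fun s ξ => Complex.exp (-(Complex.I * (ξ (x + s • v) : ℂ))) * ψ' ξ)
    (bound := fun ξ => ‖ψ' ξ‖) univ_mem
    (Eventually.of_forall fun s => ((hcont _).mul ψ.continuous).aestronglyMeasurable)
    ?_ ((hcont _).mul ψ'.continuous).aestronglyMeasurable ?_ ψ'.integrable.norm ?_
  · have h2 := key.2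
    simp only [zero_smul, add_zero] at h2
    exact h2
  · refine ψ.integrable.norm.mono' ((hcont _).mul ψ.continuous).aestronglyMeasurable ?_
    exact Eventually.of_forall fun ξ => by rw [norm_mul, hnorm, one_mul]
  · exact Eventually.of_forall fun ξ s _ => by rw [norm_mul, hnorm, one_mul]
  · refine Eventually.of_forall fun ξ s _ => ?_
    rw [hψ', ← mul_assoc]
    refine HasDerivAt.mul_const ?_ _
    have h3 : HasDerivAt (fun s : ℝ => ξ (x + s • v)) (ξ v) s := by
      have : HasDerivAt (fun s : ℝ => x + s • v) v s := by
        simpa using ((hasDerivAt_id s).smul_const v).const_add x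
      exact ξ.hasFDerivAt.comp_hasDerivAt s this
    exact (h3.ofReal_comp.const_mul Complex.I).neg.cexp

/-- Boundary values are compatible with multiplication by the linear form `⟨ζ, v⟩`, which
corresponds to the (transposed) derivative along `v`. -/
theorem IsBoundaryValue.mul_apply {ν : Measure (V →L[ℝ] ℝ)} [ν.IsAddHaarMeasure]
    {lam : V →L[ℝ] ℝ} {G : (V →L[ℝ] ℂ) → ℂ} {T : 𝓢'(V, ℂ)}
    (h : IsBoundaryValue ν lam (fun ζ => G (-Complex.I • ζ)) (fourierDistribution ν T)) (v : V) :
    IsBoundaryValue ν lam (fun ζ => G (-Complex.I • ζ) * (-Complex.I • ζ) v)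
      (fourierDistribution ν
        (PointwiseConvergenceCLM.precomp ℂ (diffOp (MvPolynomial.X v)) T)) := by
  intro ψ
  set ψ' := SchwartzMap.smulLeftCLM ℂ (fun ξ : V →L[ℝ] ℝ => -(Complex.I * (ξ v : ℂ))) ψ
  have hψ' : ∀ ξ, ψ' ξ = -(Complex.I * (ξ v : ℂ)) * ψ ξ := fun ξ =>
    SchwartzMap.smulLeftCLM_apply_apply (hasTemperateGrowth_neg_I_mul v) ψ ξ
  obtain ⟨hi, hl⟩ := h ψ
  obtain ⟨hi', hl'⟩ := h ψ'
  have hsplit : ∀ (ε : ℝ) (ξ : V →L[ℝ] ℝ),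
      G (-Complex.I • complexPoint ξ lam ε) * (-Complex.I • complexPoint ξ lam ε) v * ψ ξ =
      (ε * lam v : ℂ) * (G (-Complex.I • complexPoint ξ lam ε) * ψ ξ) +
        G (-Complex.I • complexPoint ξ lam ε) * ψ' ξ := fun ε ξ => by
    rw [hψ', neg_I_smul_complexPoint_apply]
    ring
  simp_rw [hsplit]
  refine ⟨fun ε hε => ((hi ε hε).const_mul _).add (hi' ε hε), ?_⟩
  have hval : fourierDistribution ν (PointwiseConvergenceCLM.precomp ℂ
      (diffOp (MvPolynomial.X v)) T) ψ = 0 * fourierDistribution ν T ψ +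
        fourierDistribution ν T ψ' := by
    rw [zero_mul, zero_add]
    simp only [fourierDistribution_apply, ψ', fourierTest_smulLeft]
    rfl
  rw [hval]
  have hε : Tendsto (fun ε : ℝ => (ε * lam v : ℂ)) (𝓝[>] 0) (𝓝 0) := by
    have : Tendsto (fun ε : ℝ => (ε * lam v : ℂ)) (𝓝 0) (𝓝 ((0 : ℝ) * lam v)) :=
      (by fun_prop : Continuous fun ε : ℝ => (ε * lam v : ℂ)).tendsto 0
    simpa using this.mono_left nhdsWithin_le_nhds
  refine Tendsto.congr' (eventually_nhdsWithin_of_forall fun ε hε => ?_) ((hε.mul hl).add hl')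
  beta_reduce
  rw [integral_add ((hi ε hε).const_mul _) (hi' ε hε), integral_const_mul]

theorem IsBoundaryValue.add {ν : Measure (V →L[ℝ] ℝ)} {lam : V →L[ℝ] ℝ}
    {G G' : (V →L[ℝ] ℂ) → ℂ} {B B' : 𝓢'(V →L[ℝ] ℝ, ℂ)} (h : IsBoundaryValue ν lam G B)
    (h' : IsBoundaryValue ν lam G' B') : IsBoundaryValue ν lam (fun ζ => G ζ + G' ζ) (B + B') := by
  intro ψ
  simp_rw [add_mul]
  refine ⟨fun ε hε => ((h ψ).1 ε hε).add ((h' ψ).1 ε hε), ?_⟩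
  refine Tendsto.congr' (eventually_nhdsWithin_of_forall fun ε hε => ?_)
    ((h ψ).2.add (h' ψ).2)
  exact (integral_add ((h ψ).1 ε hε) ((h' ψ).1 ε hε)).symm

theorem isBoundaryValue_zero (ν : Measure (V →L[ℝ] ℝ)) (lam : V →L[ℝ] ℝ) :
    IsBoundaryValue ν lam (fun _ => 0) 0 := by
  intro ψ
  simp only [zero_mul, integral_zero]
  exact ⟨fun _ _ => integrable_zero _ _ _, tendsto_const_nhds⟩

theorem IsBoundaryValue.const_mul {ν : Measure (V →L[ℝ] ℝ)} {lam : V →L[ℝ] ℝ}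
    {G : (V →L[ℝ] ℂ) → ℂ} {B : 𝓢'(V →L[ℝ] ℝ, ℂ)} (h : IsBoundaryValue ν lam G B) (a : ℂ) :
    IsBoundaryValue ν lam (fun ζ => a * G ζ) (a • B) := by
  intro ψ
  simp_rw [mul_assoc]
  refine ⟨fun ε hε => ((h ψ).1 ε hε).const_mul a, ?_⟩
  simp_rw [integral_const_mul]
  exact (h ψ).2.const_mul a

/-- Boundary values are compatible with the multiplication by polynomials, which corresponds to the
composition with constant coefficient differential operators. -/
theorem IsBoundaryValue.mul_eval {ν : Measure (V →L[ℝ] ℝ)} [ν.IsAddHaarMeasure]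
    {lam : V →L[ℝ] ℝ} {G : (V →L[ℝ] ℂ) → ℂ} {T : 𝓢'(V, ℂ)}
    (h : IsBoundaryValue ν lam (fun ζ => G (-Complex.I • ζ)) (fourierDistribution ν T))
    (P : MvPolynomial V ℂ) :
    IsBoundaryValue ν lam
      (fun ζ => G (-Complex.I • ζ) * MvPolynomial.eval (fun x => (-Complex.I • ζ) x) P)
      (fourierDistribution ν (PointwiseConvergenceCLM.precomp ℂ (diffOp P) T)) := by
  induction P using MvPolynomial.induction_on with
  | C a =>
    convert h.const_mul a using 1
    · ext ζ
      rw [MvPolynomial.eval_C, mul_comm]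
    · ext ψ
      change T (diffOp (MvPolynomial.C a) (fourierTest ν ψ)) = a • T (fourierTest ν ψ)
      rw [diffOp_C, map_smul]
  | add P Q hP hQ =>
    convert hP.add hQ using 1
    · ext ζ
      rw [map_add, mul_add]
    · ext ψ
      change T (diffOp (P + Q) (fourierTest ν ψ)) =
        T (diffOp P (fourierTest ν ψ)) + T (diffOp Q (fourierTest ν ψ))
      rw [diffOp_add, map_add]
  | mul_X P v hP =>
    have h1 := IsBoundaryValue.mul_apply
      (G := fun ζ => G ζ * MvPolynomial.eval (fun x => ζ x) P) hP v
    convert h1 using 1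
    · ext ζ
      rw [map_mul, MvPolynomial.eval_X, mul_assoc]
    · ext ψ
      change T (diffOp (P * MvPolynomial.X v) (fourierTest ν ψ)) =
        T (diffOp P (diffOp (MvPolynomial.X v) (fourierTest ν ψ)))
      rw [diffOp_mul]

end BoundaryValueDerivative

/-! ### Evaluation of symbols -/

section SymbolSum

variable {V : Type*} [NormedAddCommGroup V] [NormedSpace ℝ V]

/-- The power series in `z` obtained by evaluating the symbol `Q` at `ζ` converges to `s`. -/
def HasSymbolSum (Q : PowerSeries (MvPolynomial V ℂ)) (ζ : V →L[ℝ] ℂ) (z s : ℂ) : Prop :=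
  HasSum (fun k : ℕ => MvPolynomial.eval (fun x => ζ x) (PowerSeries.coeff k Q) * z ^ k) s

variable {Q Q' : PowerSeries (MvPolynomial V ℂ)} {ζ : V →L[ℝ] ℂ} {z s s' : ℂ}

theorem HasSymbolSum.mul (h : HasSymbolSum Q ζ z s) (h' : HasSymbolSum Q' ζ z s') :
    HasSymbolSum (Q * Q') ζ z (s * s') := by
  have hn := h.summable.norm
  have hn' := h'.summable.norm
  have h1 := tsum_mul_tsum_eq_tsum_sum_antidiagonal_of_summable_norm hn hn'
  have h2 := (summable_norm_sum_mul_antidiagonal_of_summable_norm hn hn').of_norm.hasSum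
  rw [← h1, h.tsum_eq, h'.tsum_eq] at h2
  refine h2.congr_fun ?_
  intro k
  rw [PowerSeries.coeff_mul, map_sum, Finset.sum_mul]
  refine Finset.sum_congr rfl fun p hp => ?_
  rw [map_mul, ← Finset.HasAntidiagonal.mem_antidiagonal.1 hp, pow_add]
  ring

theorem hasSymbolSum_X_pow (e : ℕ) : HasSymbolSum (PowerSeries.X ^ e) ζ z (z ^ e) := by
  have h := hasSum_single (f := fun k : ℕ => MvPolynomial.eval (fun x => ζ x)
    (PowerSeries.coeff k (PowerSeries.X ^ e : PowerSeries (MvPolynomial V ℂ))) * z ^ k) e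
    fun k hk => by rw [PowerSeries.coeff_X_pow, if_neg hk, map_zero, zero_mul]
  rw [PowerSeries.coeff_X_pow, if_pos rfl, map_one, one_mul] at h
  exact h

theorem hasSymbolSum_exp (a : V) :
    HasSymbolSum (raySymbol (PowerSeries.exp ℂ) a) ζ z (Complex.exp (z * ζ a)) := by
  have h := NormedSpace.expSeries_div_hasSum_exp (𝔸 := ℂ) (z * ζ a)
  rw [← Complex.exp_eq_exp_ℂ] at h
  refine h.congr_fun fun k => ?_
  rw [coeff_raySymbol, PowerSeries.coeff_exp]
  simp
  ring

theorem two_pow_le_succ_factorial (n : ℕ) : 2 ^ n ≤ (n + 1)! := by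
  induction n with
  | zero => simp
  | succ n ih =>
    rw [Nat.factorial_succ, pow_succ, mul_comm]
    exact Nat.mul_le_mul (by omega) ih

theorem sum_half_pow_le (n : ℕ) : ∑ k ∈ Finset.range n, ((2 : ℝ) ^ (n - k))⁻¹ ≤ 1 := by
  induction n with
  | zero => simp
  | succ n ih =>
    have h : ∀ k ∈ Finset.range n, ((2 : ℝ) ^ (n + 1 - k))⁻¹ = 2⁻¹ * ((2 : ℝ) ^ (n - k))⁻¹ :=
      fun k hk => by
        rw [Nat.sub_add_comm (Finset.mem_range.1 hk).le, pow_succ, mul_inv, mul_comm]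
    rw [Finset.sum_range_succ, Finset.sum_congr rfl h, ← Finset.mul_sum, Nat.add_sub_cancel_left,
      pow_one]
    linarith

/-- A crude bound, which suffices for the convergence of the Todd series near the origin. -/
theorem norm_coeff_toddSeries_le (n : ℕ) : ‖PowerSeries.coeff n toddSeries‖ ≤ 1 := by
  induction n using Nat.strong_induction_on with
  | _ n ih =>
    rcases Nat.eq_zero_or_pos n with rfl | hn
    · have := sum_toddSeries 0
      simp at this
      simp [this]
    · have h := sum_toddSeries n
      rw [Finset.sum_range_succ, if_neg hn.ne', Nat.sub_self, zero_add, Nat.factorial_one,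
        Nat.cast_one, inv_one, mul_one] at h
      rw [eq_neg_of_add_eq_zero_right h, norm_neg]
      refine (norm_sum_le _ _).trans (le_trans (Finset.sum_le_sum fun k hk => ?_)
        (sum_half_pow_le n))
      rw [norm_mul, norm_inv, Complex.norm_natCast]
      have h1 := ih k (Finset.mem_range.1 hk)
      have h2 : ((2 : ℝ) ^ (n - k)) ≤ ((n - k + 1)! : ℝ) := by
        exact_mod_cast two_pow_le_succ_factorial (n - k)
      calc _ ≤ 1 * ((2 : ℝ) ^ (n - k))⁻¹ := by gcongr
        _ = _ := one_mul _

/-- The Todd series represents `w / (exp w - 1)` for small `w ≠ 0`. -/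
theorem hasSum_toddSeries {w : ℂ} (hw : ‖w‖ < 1) (hw0 : w ≠ 0) :
    HasSum (fun k : ℕ => PowerSeries.coeff k toddSeries * w ^ k) (w * (Complex.exp w - 1)⁻¹) := by
  have hs : Summable fun k : ℕ => ‖PowerSeries.coeff k toddSeries * w ^ k‖ := by
    refine Summable.of_nonneg_of_le (fun k => norm_nonneg _) (fun k => ?_)
      (summable_geometric_of_lt_one (norm_nonneg w) hw)
    rw [norm_mul, norm_pow]
    exact mul_le_of_le_one_left (by positivity) (norm_coeff_toddSeries_le k)
  have he := NormedSpace.expSeries_div_hasSum_exp (𝔸 := ℂ) w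
  rw [← Complex.exp_eq_exp_ℂ, ← hasSum_nat_add_iff' 1] at he
  have he' : HasSum (fun k : ℕ => PowerSeries.coeff k expDivSeries * w ^ k)
      (w⁻¹ * (Complex.exp w - 1)) := by
    have := he.mul_left w⁻¹
    simp only [Finset.range_one, Finset.sum_singleton, pow_zero, Nat.factorial_zero, Nat.cast_one,
      div_one] at this
    refine this.congr_fun fun k => ?_
    rw [expDivSeries, PowerSeries.coeff_mk, pow_succ]
    field_simp
  have h1 := tsum_mul_tsum_eq_tsum_sum_antidiagonal_of_summable_norm hs he'.summable.norm
  have h2 : ∀ n : ℕ, ∑ p ∈ Finset.HasAntidiagonal.antidiagonal n,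
      PowerSeries.coeff p.1 toddSeries * w ^ p.1 *
      (PowerSeries.coeff p.2 expDivSeries * w ^ p.2) = if n = 0 then 1 else 0 := fun n => by
    have h3 := congrArg (PowerSeries.coeff n) toddSeries_mul
    rw [PowerSeries.coeff_mul, PowerSeries.coeff_one] at h3
    have h4 : ∀ p ∈ Finset.HasAntidiagonal.antidiagonal n,
        PowerSeries.coeff p.1 toddSeries * w ^ p.1 *
        (PowerSeries.coeff p.2 expDivSeries * w ^ p.2) =
        PowerSeries.coeff p.1 toddSeries * PowerSeries.coeff p.2 expDivSeries * w ^ n :=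
      fun p hp => by
        rw [← Finset.HasAntidiagonal.mem_antidiagonal.1 hp, pow_add]
        ring
    rw [Finset.sum_congr rfl h4, ← Finset.sum_mul, h3]
    split_ifs with hn <;> simp [hn]
  simp_rw [h2] at h1
  rw [tsum_ite_eq, he'.tsum_eq] at h1
  have h5 : ∑' k : ℕ, PowerSeries.coeff k toddSeries * w ^ k = w * (Complex.exp w - 1)⁻¹ := by
    rw [eq_inv_of_mul_eq_one_left h1, mul_inv, inv_inv]
  rw [← h5]
  exact hs.of_norm.hasSum

theorem hasSymbolSum_todd {v : V} (h : ‖z * ζ v‖ < 1) (h0 : z * ζ v ≠ 0) :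
    HasSymbolSum (raySymbol toddSeries v) ζ z
      (z * ζ v * (Complex.exp (z * ζ v) - 1)⁻¹) := by
  refine (hasSum_toddSeries h h0).congr_fun fun k => ?_
  rw [coeff_raySymbol]
  simp
  ring

end SymbolSum

section Graded

variable {V : Type*}

/-- The coefficient of degree `k` of the symbol is a homogeneous polynomial of degree `k`. -/
def IsGradedSymbol (Q : PowerSeries (MvPolynomial V ℂ)) : Prop :=
  ∀ k, (PowerSeries.coeff k Q).IsHomogeneous k

theorem isGradedSymbol_raySymbol (q : PowerSeries ℂ) (v : V) : IsGradedSymbol (raySymbol q v) :=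
  fun k => by
    rw [coeff_raySymbol]
    exact (MvPolynomial.isHomogeneous_C_mul_X_pow _ v k)

theorem IsGradedSymbol.mul {Q Q' : PowerSeries (MvPolynomial V ℂ)} (h : IsGradedSymbol Q)
    (h' : IsGradedSymbol Q') : IsGradedSymbol (Q * Q') := fun k => by
  rw [PowerSeries.coeff_mul]
  refine MvPolynomial.IsHomogeneous.sum _ _ _ fun p hp => ?_
  rw [← Finset.HasAntidiagonal.mem_antidiagonal.1 hp]
  exact (h p.1).mul (h' p.2)

theorem isGradedSymbol_one : IsGradedSymbol (1 : PowerSeries (MvPolynomial V ℂ)) := fun k => by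
  rw [PowerSeries.coeff_one]
  split_ifs with hk
  · rw [hk]
    exact MvPolynomial.isHomogeneous_one V ℂ
  · exact MvPolynomial.isHomogeneous_zero V ℂ k

end Graded

/-! ### Simplicial cones -/

section SimplicialCone

variable {V : Type*} [NormedAddCommGroup V] [NormedSpace ℝ V] [FiniteDimensional ℝ V]
  [MeasurableSpace V] [BorelSpace V] {c : PointedCone ℝ V} {u : V →L[ℝ] ℝ}

/-- The sum of `δ_{x / t}` over the combinations `x` of the vectors of `L` with natural number
coefficients (counted with multiplicities), divided by `t` to the power the length of `L`. -/
noncomputable def latticeCone (L : List V) (t : ℝ) : Measure V :=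
  L.foldr (fun v μ => latticeRay v t ∗ μ) (Measure.dirac 0)

instance sFinite_latticeRay (v : V) (t : ℝ) : SFinite (latticeRay v t) := by
  unfold latticeRay
  infer_instance

instance sFinite_latticeCone (L : List V) (t : ℝ) : SFinite (latticeCone L t) := by
  induction L with
  | nil => exact inferInstanceAs (SFinite (Measure.dirac 0))
  | cons v L ih => exact inferInstanceAs (SFinite (latticeRay v t ∗ latticeCone L t))

/-- The image of Lebesgue measure on the positive orthant under `s ↦ ∑ sᵢ vᵢ`, where the `vᵢ` are
the vectors of `L`. -/
noncomputable def lebesgueCone (L : List V) : Measure V :=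
  L.foldr (fun v μ => lebesgueRay v ∗ μ) (Measure.dirac 0)

/-- The product of the Todd operators of the vectors of `L`. -/
noncomputable def toddSymbol {V : Type*} (L : List V) : PowerSeries (MvPolynomial V ℂ) :=
  (L.map (raySymbol toddSeries)).prod

variable (hc : IsClosed (c : Set V)) (hu : ∀ x ∈ c, 0 ≤ u x) {L : List V}
  (hL : ∀ v ∈ L, v ∈ c ∧ 1 ≤ u v)

include hc hu hL

theorem exists_temperateOn_latticeCone {t₀ : ℝ} (ht₀ : 0 < t₀) :
    ∃ M K, ∀ t, t₀ ≤ t → TemperateOn c u M K (latticeCone L t) := by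
  induction L with
  | nil => exact ⟨0, 1, fun _ _ => temperateOn_dirac hu c.zero_mem⟩
  | cons v L ih =>
    obtain ⟨M, K, h⟩ := ih fun w hw => hL w (List.mem_cons_of_mem v hw)
    obtain ⟨hv, huv⟩ := hL v List.mem_cons_self
    refine ⟨2 + M, (t₀⁻¹ + 1) * K, fun t ht => ?_⟩
    have ht0 : 0 < t := ht₀.trans_le ht
    refine TemperateOn.conv hc hu ((temperateOn_latticeRay hu hv huv ht0).mono hu le_rfl ?_)
      (h t ht)
    gcongr

theorem exists_temperateOn_lebesgueCone : ∃ M K, TemperateOn c u M K (lebesgueCone L) := by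
  induction L with
  | nil => exact ⟨0, 1, temperateOn_dirac hu c.zero_mem⟩
  | cons v L ih =>
    obtain ⟨M, K, h⟩ := ih fun w hw => hL w (List.mem_cons_of_mem v hw)
    obtain ⟨hv, huv⟩ := hL v List.mem_cons_self
    exact ⟨_, _, TemperateOn.conv hc hu (temperateOn_lebesgueRay hc hu hv huv) h⟩

theorem hasEulerMaclaurin_latticeCone :
    HasEulerMaclaurin c u (latticeCone L) (lebesgueCone L) (toddSymbol L) := by
  induction L with
  | nil =>
    have h := hasEulerMaclaurin_smul_dirac hu 0
    simp only [pow_zero, inv_one, ENNReal.ofReal_one, one_smul] at h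
    exact h
  | cons v L ih =>
    have hL' : ∀ w ∈ L, w ∈ c ∧ 1 ≤ u w := fun w hw => hL w (List.mem_cons_of_mem v hw)
    obtain ⟨hv, huv⟩ := hL v List.mem_cons_self
    obtain ⟨M, K, h⟩ := exists_temperateOn_latticeCone hc hu hL' one_pos
    obtain ⟨M', K', h'⟩ := exists_temperateOn_lebesgueCone hc hu hL'
    have h1 := HasEulerMaclaurin.conv hc hu (hasEulerMaclaurin_latticeRay hc hu hv huv) (ih hL')
      (Mα := 2) (Kα := 1 + 1) (fun t ht => (temperateOn_latticeRay hu hv huv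
        (one_pos.trans_le ht)).mono hu le_rfl (by gcongr; exact inv_le_one_of_one_le₀ ht))
      h (temperateOn_lebesgueRay hc hu hv huv) h'
    exact h1

theorem hasLaplace_latticeCone :
    HasLaplace c (latticeCone L 1) fun ζ => (L.map fun v => (1 - Complex.exp (ζ v))⁻¹).prod := by
  induction L with
  | nil => exact fun ζ _ => (integral_dirac _ _).trans (by simp)
  | cons v L ih =>
    have hL' : ∀ w ∈ L, w ∈ c ∧ 1 ≤ u w := fun w hw => hL w (List.mem_cons_of_mem v hw)
    obtain ⟨hv, huv⟩ := hL v List.mem_cons_self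
    obtain ⟨M, K, h⟩ := exists_temperateOn_latticeCone hc hu hL' one_pos
    exact HasLaplace.conv hc hu (temperateOn_latticeRay hu hv huv one_pos) (h 1 le_rfl)
      (hasLaplace_latticeRay hc hu hv huv) (ih hL')

theorem hasLaplace_lebesgueCone :
    HasLaplace c (lebesgueCone L) fun ζ => (L.map fun v => -(ζ v)⁻¹).prod := by
  induction L with
  | nil => exact fun ζ _ => (integral_dirac _ _).trans (by simp)
  | cons v L ih =>
    have hL' : ∀ w ∈ L, w ∈ c ∧ 1 ≤ u w := fun w hw => hL w (List.mem_cons_of_mem v hw)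
    obtain ⟨hv, huv⟩ := hL v List.mem_cons_self
    obtain ⟨M, K, h⟩ := exists_temperateOn_lebesgueCone hc hu hL'
    exact HasLaplace.conv hc hu (temperateOn_lebesgueRay hc hu hv huv) h
      (hasLaplace_lebesgueRay hc hu hv huv) (ih hL')

omit hc hu hL

theorem hasSymbolSum_toddSymbol {V : Type*} [NormedAddCommGroup V] [NormedSpace ℝ V] {L : List V}
    {ζ : V →L[ℝ] ℂ} {z : ℂ} (h : ∀ v ∈ L, ‖z * ζ v‖ < 1 ∧ z * ζ v ≠ 0) :
    HasSymbolSum (toddSymbol L) ζ z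
      (L.map fun v => z * ζ v * (Complex.exp (z * ζ v) - 1)⁻¹).prod := by
  induction L with
  | nil => simpa [toddSymbol] using hasSymbolSum_X_pow (V := V) (ζ := ζ) (z := z) 0
  | cons v L ih =>
    have hv := h v List.mem_cons_self
    have := (hasSymbolSum_todd hv.1 hv.2).mul (ih fun w hw => h w (List.mem_cons_of_mem v hw))
    simpa [toddSymbol] using this

theorem isGradedSymbol_toddSymbol {V : Type*} (L : List V) : IsGradedSymbol (toddSymbol L) := by
  induction L with
  | nil => simpa [toddSymbol] using isGradedSymbol_one
  | cons v L ih => simpa [toddSymbol] using (isGradedSymbol_raySymbol toddSeries v).mul ih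

/-- The symbol of the translate by `b` of the simplicial cone spanned by `L`, multiplied by the
power `e` of the expansion variable. -/
noncomputable def pieceSymbol {V : Type*} (e : ℕ) (b : V) (L : List V) :
    PowerSeries (MvPolynomial V ℂ) :=
  PowerSeries.X ^ e * (raySymbol (PowerSeries.exp ℂ) b * toddSymbol L)

/-- The sum of `δ_{x / t}` over `x` in `b` plus the combinations of the vectors of `L` with natural
number coefficients, divided by `t` to the power `e` plus the length of `L`. -/
noncomputable def pieceMeasure (e : ℕ) (b : V) (L : List V) (t : ℝ) : Measure V :=
  ENNReal.ofReal (t ^ e)⁻¹ • (Measure.dirac (t⁻¹ • b) ∗ latticeCone L t)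

include hc hu hL

theorem exists_temperateOn_pieceMeasure (e : ℕ) {b : V} (hb : b ∈ c) {t₀ : ℝ} (ht₀ : 0 < t₀) :
    ∃ M K, ∀ t, t₀ ≤ t → TemperateOn c u M K (pieceMeasure e b L t) := by
  obtain ⟨M, K, h⟩ := exists_temperateOn_latticeCone hc hu hL ht₀
  refine ⟨0 + M, (t₀ ^ e)⁻¹ * (1 * K), fun t ht => ?_⟩
  have ht0 : 0 < t := ht₀.trans_le ht
  have hK := (h t ht).nonneg hu
  refine (TemperateOn.smul (TemperateOn.conv hc hu
    (temperateOn_dirac hu (c.smul_mem (inv_nonneg.2 ht0.le) hb)) (h t ht))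
    (by positivity : 0 ≤ (t ^ e)⁻¹)).mono hu le_rfl ?_
  gcongr

theorem hasEulerMaclaurin_pieceMeasure (e : ℕ) {b : V} (hb : b ∈ c) :
    HasEulerMaclaurin c u (pieceMeasure e b L) (lebesgueCone L) (pieceSymbol e b L) := by
  obtain ⟨M, K, h⟩ := exists_temperateOn_latticeCone hc hu hL one_pos
  obtain ⟨M', K', h'⟩ := exists_temperateOn_lebesgueCone hc hu hL
  have := h'.sFinite
  have hd0 : TemperateOn c u 0 1 (Measure.dirac (0 : V)) := temperateOn_dirac hu c.zero_mem
  have hdb : ∀ t : ℝ, 1 ≤ t → TemperateOn c u 0 1 (Measure.dirac (t⁻¹ • b)) := fun t ht =>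
    temperateOn_dirac hu (c.smul_mem (inv_nonneg.2 (one_pos.trans_le ht).le) hb)
  have h1 := HasEulerMaclaurin.conv hc hu (hasEulerMaclaurin_dirac hu hb)
    (hasEulerMaclaurin_latticeCone hc hu hL) hdb h hd0 h'
  rw [Measure.dirac_zero_conv] at h1
  have h2 := HasEulerMaclaurin.conv hc hu (hasEulerMaclaurin_smul_dirac hu e) h1
    (Mα := 0) (Kα := 1 * 1)
    (fun t ht => (hd0.smul (by positivity : 0 ≤ (t ^ e)⁻¹)).mono hu le_rfl
      (by gcongr; exact inv_le_one_of_one_le₀ (one_le_pow₀ ht)))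
    (fun t ht => (hdb t ht).conv hc hu (h t ht)) hd0 h'
  rw [Measure.dirac_zero_conv] at h2
  intro g N M
  obtain ⟨C, hC0, hC⟩ := h2 g N M
  refine ⟨C, hC0, fun t ht y hy => ?_⟩
  have h3 := hC t ht y hy
  beta_reduce at h3
  rwa [Measure.conv_smul_left, Measure.dirac_zero_conv] at h3

theorem hasLaplace_pieceMeasure (e : ℕ) {b : V} (hb : b ∈ c) :
    HasLaplace c (pieceMeasure e b L 1) fun ζ =>
      Complex.exp (ζ b) * (L.map fun v => (1 - Complex.exp (ζ v))⁻¹).prod := by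
  obtain ⟨M, K, h⟩ := exists_temperateOn_latticeCone hc hu hL one_pos
  have h1 := HasLaplace.conv hc hu (temperateOn_dirac hu hb) (h 1 le_rfl) (hasLaplace_dirac b)
    (hasLaplace_latticeCone hc hu hL)
  rw [pieceMeasure]
  simpa using h1

end SimplicialCone

/-! ### Decomposition of lower sets of `ℕ^N` into translated orthants -/

section Stanley

variable {ι : Type*} [DecidableEq ι]

/-- The translate by `b` of the coordinate orthant `ℕ^J`. -/
def orthantPiece (b : ι → ℕ) (J : Finset ι) : Set (ι → ℕ) :=
  {x | b ≤ x ∧ ∀ i ∉ J, x i = b i}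

theorem mem_orthantPiece_self (b : ι → ℕ) (J : Finset ι) : b ∈ orthantPiece b J :=
  ⟨le_rfl, fun _ _ => rfl⟩

theorem mem_orthantPiece_insert {b : ι → ℕ} {J : Finset ι} {i : ι} (hi : i ∉ J) {x : ι → ℕ} :
    x ∈ orthantPiece b (insert i J) ↔
      b i ≤ x i ∧ Function.update x i (b i) ∈ orthantPiece b J := by
  constructor
  · intro h
    refine ⟨h.1 i, fun j => ?_, fun j hj => ?_⟩
    · by_cases hji : j = i
      · subst hji; simp
      · simpa [hji] using h.1 j
    · by_cases hji : j = i
      · subst hji; simp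
      · simpa [hji] using h.2 j (by simp [hji, hj])
  · intro h
    refine ⟨fun j => ?_, fun j hj => ?_⟩
    · by_cases hji : j = i
      · subst hji; exact h.1
      · simpa [hji] using h.2.1 j
    · have hji : j ≠ i := fun hji => hj (by simp [hji])
      simpa [hji] using h.2.2 j fun hjJ => hj (Finset.mem_insert_of_mem hjJ)

/-- The ascending chain condition for upper sets, a consequence of Dickson's lemma. -/
theorem exists_stable_upperSet {α : Type*} [Preorder α] [WellQuasiOrderedLE α] (U : ℕ → Set α)
    (hmono : Monotone U) (hU : ∀ n, IsUpperSet (U n)) : ∃ n₀, ∀ n, n₀ ≤ n → U n = U n₀ := by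
  by_contra! h
  have h' : ∀ n₀, ∃ n, n₀ ≤ n ∧ ∃ m, m ∈ U n ∧ m ∉ U n₀ := fun n₀ => by
    obtain ⟨n, hn, hne⟩ := h n₀
    refine ⟨n, hn, ?_⟩
    by_contra! hall
    exact hne (Set.Subset.antisymm (fun m hm => hall m hm) (hmono hn))
  choose f hf m hm hm' using h'
  have ha : Monotone fun k => f^[k] 0 := monotone_nat_of_le_succ fun k => by
    rw [Function.iterate_succ_apply']
    exact hf _
  obtain ⟨i, j, hij, hle⟩ := wellQuasiOrdered_le fun k => m (f^[k] 0)
  refine hm' (f^[j] 0) (hU _ hle (hmono (ha (Nat.succ_le_of_lt hij)) ?_))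
  simpa only [Function.iterate_succ_apply'] using hm (f^[i] 0)

/-- The part of a lower set of `ℕ^ι` contained in a translated orthant is a finite disjoint union of
translated orthants; disjointness is expressed by the sum of the indicator functions. -/
theorem exists_orthant_decomposition [Finite ι] {D : Set (ι → ℕ)} (hD : IsLowerSet D)
    (J₀ : Finset ι) : ∀ b₀ : ι → ℕ,
    ∃ (κ : Type) (_ : Fintype κ) (b : κ → ι → ℕ) (J : κ → Finset ι),
      (∀ k, b k ∈ orthantPiece b₀ J₀ ∧ J k ⊆ J₀) ∧
      ∀ x, ∑ k, (orthantPiece (b k) (J k)).indicator (1 : (ι → ℕ) → ENNReal) x =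
        (D ∩ orthantPiece b₀ J₀).indicator 1 x := by
  induction J₀ using Finset.induction_on with
  | empty =>
    intro b₀
    have hx : ∀ x, x ∈ orthantPiece b₀ ∅ ↔ x = b₀ := fun x =>
      ⟨fun h => funext fun i => h.2 i (by simp), fun h => h ▸ mem_orthantPiece_self _ _⟩
    by_cases hb : b₀ ∈ D
    · refine ⟨Unit, inferInstance, fun _ => b₀, fun _ => ∅,
        fun _ => ⟨mem_orthantPiece_self _ _, subset_rfl⟩, fun x => ?_⟩
      have : D ∩ orthantPiece b₀ ∅ = orthantPiece b₀ ∅ :=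
        Set.inter_eq_right.2 fun x h => ((hx x).1 h) ▸ hb
      simp [this]
    · refine ⟨Empty, inferInstance, Empty.elim, Empty.elim, fun k => k.elim, fun x => ?_⟩
      have : D ∩ orthantPiece b₀ ∅ = ∅ := Set.eq_empty_of_forall_notMem fun x h =>
        hb ((hx x).1 h.2 ▸ h.1)
      simp [this]
  | insert i J₀ hi ih =>
    intro b₀
    -- The slices of `D` orthogonal to the direction `i` decrease, hence stabilise.
    obtain ⟨n₀, hn₀⟩ := exists_stable_upperSet
      (fun n : ℕ => {m : ι → ℕ | Function.update m i (b₀ i + n) ∉ D})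
      (fun n n' hnn' m hm hm' => hm (hD (update_le_update_iff.2
        ⟨by omega, fun _ _ => le_rfl⟩) hm'))
      (fun n m m' hmm' hm hm' => hm (hD (update_le_update_iff.2
        ⟨le_rfl, fun j _ => Pi.le_def.1 hmm' j⟩) hm'))
    have hstable : ∀ n, n₀ ≤ n → ∀ m : ι → ℕ,
        Function.update m i (b₀ i + n) ∈ D ↔ Function.update m i (b₀ i + n₀) ∈ D := fun n hn m =>
      not_iff_not.1 (Set.ext_iff.1 (hn₀ n hn) m)
    choose κ hκ b J hbJ hsum using fun n : ℕ => ih (Function.update b₀ i (b₀ i + n))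
    -- A slice consists of the points of the big orthant with a given coordinate `i`.
    have hslice : ∀ n x, x ∈ orthantPiece (Function.update b₀ i (b₀ i + n)) J₀ ↔
        x i = b₀ i + n ∧ x ∈ orthantPiece b₀ (insert i J₀) := fun n x => by
      constructor
      · intro h
        have hxi : x i = b₀ i + n := by simpa using h.2 i hi
        refine ⟨hxi, fun j => ?_, fun j hj => ?_⟩
        · by_cases hji : j = i
          · rw [hji, hxi]; exact Nat.le_add_right _ _
          · simpa [hji] using h.1 j
        · have hji : j ≠ i := fun hji => hj (by simp [hji])
          simpa [hji] using h.2 j fun hjJ => hj (Finset.mem_insert_of_mem hjJ)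
      · rintro ⟨hxi, h⟩
        refine ⟨fun j => ?_, fun j hj => ?_⟩
        · by_cases hji : j = i
          · subst hji; simp [hxi]
          · simpa [hji] using h.1 j
        · by_cases hji : j = i
          · subst hji; simp [hxi]
          · simpa [hji] using h.2 j (by simp [hji, hj])
    have hbi : ∀ k : κ n₀, b n₀ k i = b₀ i + n₀ := fun k => ((hslice n₀ _).1 (hbJ n₀ k).1).1
    have hiJ : ∀ n (k : κ n), i ∉ J n k := fun n k h => hi ((hbJ n k).2 h)
    refine ⟨(Σ n : Fin n₀, κ n) ⊕ κ n₀, inferInstance,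
      Sum.elim (fun p => b p.1 p.2) (b n₀),
      Sum.elim (fun p => J p.1 p.2) (fun k => insert i (J n₀ k)), ?_, fun x => ?_⟩
    · rintro (⟨n, k⟩ | k)
      · exact ⟨((hslice n _).1 (hbJ n k).1).2, (hbJ n k).2.trans (Finset.subset_insert _ _)⟩
      · exact ⟨((hslice n₀ _).1 (hbJ n₀ k).1).2, Finset.insert_subset_insert _ (hbJ n₀ k).2⟩
    · rw [Fintype.sum_sum_type, Fintype.sum_sigma]
      simp only [Sum.elim_inl, Sum.elim_inr]
      simp_rw [fun n : Fin n₀ => hsum n x]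
      have hlast : ∑ k, (orthantPiece (b n₀ k) (insert i (J n₀ k))).indicator
          (1 : (ι → ℕ) → ENNReal) x = if b₀ i + n₀ ≤ x i then
            (D ∩ orthantPiece (Function.update b₀ i (b₀ i + n₀)) J₀).indicator 1
              (Function.update x i (b₀ i + n₀)) else 0 := by
        rw [← hsum n₀]
        split_ifs with hx
        · refine Finset.sum_congr rfl fun k _ => ?_
          refine Set.indicator_eq_indicator ?_ rfl
          rw [mem_orthantPiece_insert (hiJ n₀ k), hbi k]
          exact and_iff_right hx
        · refine Finset.sum_eq_zero fun k _ => Set.indicator_of_notMem ?_ _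
          rw [mem_orthantPiece_insert (hiJ n₀ k), hbi k]
          exact fun h => hx h.1
      rw [hlast]
      have hupd : ∀ n, Function.update x i (b₀ i + n) ∈ orthantPiece b₀ (insert i J₀) ↔
          Function.update x i (b₀ i) ∈ orthantPiece b₀ J₀ := fun n => by
        rw [mem_orthantPiece_insert hi]
        simp
      by_cases hx : x ∈ orthantPiece b₀ (insert i J₀)
      · obtain ⟨n, hn⟩ := Nat.exists_eq_add_of_le (hx.1 i)
        by_cases hnn : n < n₀
        · rw [if_neg (by omega), add_zero, Finset.sum_eq_single (⟨n, hnn⟩ : Fin n₀)]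
          · refine Set.indicator_eq_indicator ?_ rfl
            simp [hslice, hn]
          · intro n' _ hne
            refine Set.indicator_of_notMem (fun h => hne (Fin.ext ?_)) _
            have := ((hslice n' x).1 h.2).1
            simp only
            omega
          · simp
        · have h1 : ∀ n' : Fin n₀,
              (D ∩ orthantPiece (Function.update b₀ i (b₀ i + n')) J₀).indicator
                (1 : (ι → ℕ) → ENNReal) x = 0 := fun n' => Set.indicator_of_notMem (fun h => by
            have := ((hslice n' x).1 h.2).1
            have := n'.2
            omega) _
          have h2 := (mem_orthantPiece_insert hi).1 hx
          have h3 : Function.update x i (b₀ i + n₀) ∈ D ↔ x ∈ D := by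
            rw [← hstable n (by omega) x, ← hn, Function.update_eq_self]
          simp only [h1, Finset.sum_const_zero, zero_add]
          rw [if_pos (by omega)]
          refine Set.indicator_eq_indicator ?_ rfl
          simp [hslice, hupd, h2.2, h3, hx]
      · have h1 : ∀ n, x ∉ orthantPiece (Function.update b₀ i (b₀ i + n)) J₀ := fun n h =>
          hx ((hslice n x).1 h).2
        have h2 : (if b₀ i + n₀ ≤ x i then
            (D ∩ orthantPiece (Function.update b₀ i (b₀ i + n₀)) J₀).indicator 1
              (Function.update x i (b₀ i + n₀)) else 0) = (0 : ENNReal) := by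
          split_ifs with hle
          · refine Set.indicator_of_notMem (fun h => hx ?_) _
            rw [mem_orthantPiece_insert hi]
            exact ⟨by omega, (hupd n₀).1 ((hslice n₀ _).1 h.2).2⟩
          · rfl
        rw [h2]
        simp [Set.indicator, h1, hx]

end Stanley

/-! ### Lattice points of a pointed rational cone -/

section LexMin

variable {A : Type*} [AddCommMonoid A] {N : ℕ}

/-- The lexicographically smallest representations of elements of a commutative monoid as
combinations of the elements `g i` with natural number coefficients. -/
def lexMinReps (g : Fin N → A) : Set (Fin N → ℕ) :=
  {n | ∀ m : Fin N → ℕ, ∑ i, m i • g i = ∑ i, n i • g i → toLex n ≤ toLex m}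

theorem isLowerSet_lexMinReps (g : Fin N → A) : IsLowerSet (lexMinReps g) := by
  intro n m hmn hn k hk
  obtain ⟨d, rfl⟩ : ∃ d, n = m + d := ⟨n - m, (add_tsub_cancel_of_le hmn).symm⟩
  have h := hn (k + d) (by simp [add_smul, Finset.sum_add_distrib, hk])
  rw [toLex_add, toLex_add] at h
  exact le_of_add_le_add_right h

theorem injOn_lexMinReps (g : Fin N → A) :
    Set.InjOn (fun n : Fin N → ℕ => ∑ i, n i • g i) (lexMinReps g) := fun n hn m hm h =>
  toLex.injective (le_antisymm (hn m h.symm) (hm n h))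

theorem exists_lexMinReps (g : Fin N → A) (n : Fin N → ℕ) :
    ∃ m ∈ lexMinReps g, ∑ i, m i • g i = ∑ i, n i • g i := by
  let T : Set (Lex (Fin N → ℕ)) := {m | ∑ i, ofLex m i • g i = ∑ i, n i • g i}
  have hT : T.Nonempty := ⟨toLex n, rfl⟩
  have hwf : WellFounded ((· < ·) : Lex (Fin N → ℕ) → Lex (Fin N → ℕ) → Prop) := wellFounded_lt
  refine ⟨ofLex (hwf.min T hT), fun k hk => ?_, hwf.min_mem T hT⟩
  refine not_lt.1 (hwf.not_lt_min T (x := toLex k) ?_)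
  exact hk.trans (hwf.min_mem T hT)

end LexMin

section Gordan

variable {V : Type*} [NormedAddCommGroup V] [NormedSpace ℝ V] {Λ : Submodule ℤ V}
  {c : PointedCone ℝ V}

/-- A linear form which is positive on the nonzero elements of the cone, and at least `1` on its
nonzero lattice points: the sum of the forms which define the cone. -/
theorem exists_positive_form (hc : IsRationalCone Λ c) (hp : HasTrivialLineality c) :
    ∃ u : V →L[ℝ] ℝ, (∀ x ∈ c, 0 ≤ u x) ∧ ∀ x ∈ latticePoints Λ c, x ≠ 0 → 1 ≤ u x := by
  obtain ⟨s, hs, hcs⟩ := hc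
  have h0 : ∀ x ∈ c, 0 ≤ (∑ f ∈ s, f) x := fun x hx => by
    rw [sum_apply]
    exact Finset.sum_nonneg fun f hf => (hcs x).1 hx f hf
  refine ⟨∑ f ∈ s, f, h0, fun x hx hx0 => ?_⟩
  have hpos : (∑ f ∈ s, f) x ≠ 0 := fun h => hx0 <| hp x hx.1 <| (hcs _).2 fun f hf => by
    rw [sum_apply,
      Finset.sum_eq_zero_iff_of_nonneg fun f hf => (hcs x).1 hx.1 f hf] at h
    rw [map_neg, h f hf, neg_zero]
  choose! n hn using fun f hf => hs f hf x hx.2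
  have hint : (∑ f ∈ s, f) x = ((∑ f ∈ s, n f : ℤ) : ℝ) := by
    rw [sum_apply, Finset.sum_congr rfl hn]
    push_cast
    rfl
  have hlt := lt_of_le_of_ne (h0 x hx.1) hpos.symm
  rw [hint] at hlt ⊢
  have : 0 < ∑ f ∈ s, n f := by exact_mod_cast hlt
  exact_mod_cast this

theorem IsRationalCone.isClosed (hc : IsRationalCone Λ c) : IsClosed (c : Set V) := by
  obtain ⟨s, -, hcs⟩ := hc
  have : (c : Set V) = ⋂ f ∈ s, {x | 0 ≤ f x} := by
    ext x
    simp [hcs]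
  rw [this]
  exact isClosed_biInter fun f _ => isClosed_le continuous_const f.continuous

/-- Gordan's lemma. The values of the defining forms embed the lattice points of a pointed rational
cone into some `ℕ^s`, with differences of comparable elements staying in the cone; hence the minimal
nonzero elements, finite in number by Dickson's lemma, are generators. -/
theorem exists_generators (hc : IsRationalCone Λ c) (hp : HasTrivialLineality c) :
    ∃ v : Finset V, (∀ x ∈ v, x ∈ latticePoints Λ c ∧ x ≠ 0) ∧
      ∀ x ∈ latticePoints Λ c, x ∈ AddSubmonoid.closure (v : Set V) := by
  obtain ⟨u, hu, hu1⟩ := exists_positive_form hc hp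
  obtain ⟨s, hs, hcs⟩ := hc
  choose! n hn using hs
  set θ : V → (s → ℕ) := fun x f => (n f x).toNat with hθ_def
  have hθ : ∀ x ∈ latticePoints Λ c, ∀ f : s, (f : V →L[ℝ] ℝ) x = θ x f := fun x hx f => by
    have h1 := hn f f.2 x hx.2
    have h2 : (0 : ℝ) ≤ n f x := h1 ▸ (hcs x).1 hx.1 f f.2
    have h3 : 0 ≤ n f x := by exact_mod_cast h2
    rw [h1, hθ_def]
    exact_mod_cast (Int.toNat_of_nonneg h3).symm
  have hsub : ∀ x ∈ latticePoints Λ c, ∀ y ∈ latticePoints Λ c, θ x ≤ θ y →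
      y - x ∈ latticePoints Λ c := fun x hx y hy hxy => by
    refine ⟨(hcs _).2 fun f hf => ?_, Λ.sub_mem hy.2 hx.2⟩
    have h1 := hθ x hx ⟨f, hf⟩
    have h2 := hθ y hy ⟨f, hf⟩
    simp only at h1 h2
    rw [map_sub, h1, h2, sub_nonneg]
    exact_mod_cast hxy ⟨f, hf⟩
  have hinj : Set.InjOn θ (latticePoints Λ c) := fun x hx y hy hxy => by
    have h1 := (hsub x hx y hy hxy.le).1
    have h2 := (hsub y hy x hx hxy.ge).1
    exact (sub_eq_zero.1 (hp _ h1 (by rwa [neg_sub]))).symm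
  set X : Set V := {x | x ∈ latticePoints Λ c ∧ x ≠ 0}
  set W : Set V := {x ∈ X | ∀ y ∈ X, θ y ≤ θ x → θ x ≤ θ y}
  have hWX : W ⊆ latticePoints Λ c := fun x hx => hx.1.1
  have hWfin : W.Finite := by
    refine Set.Finite.of_finite_image (f := θ) ?_ (hinj.mono hWX)
    refine WellQuasiOrderedLE.finite_of_isAntichain ?_
    rintro _ ⟨x, hx, rfl⟩ _ ⟨y, hy, rfl⟩ hne hle
    exact hne (le_antisymm hle (hy.2 x hx.1 hle))
  refine ⟨hWfin.toFinset, fun x hx => ((hWfin.mem_toFinset).1 hx).1, ?_⟩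
  rw [hWfin.coe_toFinset]
  -- Induction on the value of the positive form, which drops by at least `1` at each step.
  have key : ∀ k : ℕ, ∀ x ∈ latticePoints Λ c, u x < k → x ∈ AddSubmonoid.closure W := by
    intro k
    induction k with
    | zero =>
      intro x hx hk
      exact absurd (hu x hx.1) (by simpa using hk)
    | succ k ih =>
      intro x hx hk
      by_cases hx0 : x = 0
      · rw [hx0]
        exact zero_mem _
      have hne : (θ '' {y ∈ X | θ y ≤ θ x}).Nonempty := ⟨θ x, x, ⟨⟨hx, hx0⟩, le_rfl⟩, rfl⟩
      obtain ⟨_, ⟨y, ⟨hyX, hyx⟩, rfl⟩, hmin⟩ :=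
        WellFounded.has_min (wellFounded_lt (α := s → ℕ)) _ hne
      have hyW : y ∈ W := by
        refine ⟨hyX, fun z hz hzy => ?_⟩
        by_contra hcon
        exact hmin (θ z) ⟨z, ⟨hz, hzy.trans hyx⟩, rfl⟩ (lt_of_le_not_ge hzy hcon)
      have h1 := hsub y hyX.1 x hx hyx
      have h2 : u (x - y) < k := by
        have := hu1 y hyX.1 hyX.2
        rw [map_sub]
        push_cast at hk
        linarith
      have h3 := add_mem (ih _ h1 h2) (AddSubmonoid.subset_closure hyW)
      rwa [sub_add_cancel] at h3
  intro x hx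
  obtain ⟨k, hk⟩ := exists_nat_gt (u x)
  exact key k x hx hk

/-- A nonzero rational cone contains a nonzero lattice point. A large multiple `q x` of a nonzero
element `x` is very close to some lattice point `p` (by the pigeonhole principle in the torus); the
defining forms which vanish at `x` are smaller than `1` at `p`, hence vanish there by
integrality. -/
theorem exists_latticePoint_ne_zero [FiniteDimensional ℝ V] [DiscreteTopology Λ] [IsZLattice ℝ Λ]
    (hc : IsRationalCone Λ c) {x : V} (hx : x ∈ c) (hx0 : x ≠ 0) :
    ∃ p ∈ latticePoints Λ c, p ≠ 0 := by
  obtain ⟨s, hs, hcs⟩ := hc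
  obtain ⟨δ, hδ, hδx, hδ1, hδf⟩ : ∃ δ : ℝ, 0 < δ ∧ δ < ‖x‖ ∧ (∀ f ∈ s, ‖f‖ * δ < 1) ∧
      ∀ f ∈ s, 0 < f x → ‖f‖ * δ < f x := by
    have h1 : ∀ (f : V →L[ℝ] ℝ) {r : ℝ}, 0 < r → ∀ᶠ δ : ℝ in 𝓝[>] 0, ‖f‖ * δ < r := fun f r hr => by
      have : Tendsto (fun δ : ℝ => ‖f‖ * δ) (𝓝 0) (𝓝 (‖f‖ * 0)) :=
        (continuous_const.mul continuous_id).tendsto 0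
      rw [mul_zero] at this
      exact (this.mono_left nhdsWithin_le_nhds).eventually (gt_mem_nhds hr)
    have h2 : ∀ᶠ δ : ℝ in 𝓝[>] 0, 0 < δ ∧ δ < ‖x‖ :=
      Ioo_mem_nhdsGT (norm_pos_iff.2 hx0)
    have h3 : ∀ᶠ δ : ℝ in 𝓝[>] 0, ∀ f ∈ s, ‖f‖ * δ < 1 :=
      (Finset.eventually_all s).2 fun f _ => h1 f one_pos
    have h4 : ∀ᶠ δ : ℝ in 𝓝[>] 0, ∀ f ∈ s, 0 < f x → ‖f‖ * δ < f x :=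
      (Finset.eventually_all s).2 fun f _ => by
        by_cases hf : 0 < f x
        · exact (h1 f hf).mono fun δ h _ => h
        · exact Eventually.of_forall fun δ h => absurd h hf
    obtain ⟨δ, h⟩ := (h2.and (h3.and h4)).exists
    exact ⟨δ, h.1.1, h.1.2, h.2.1, h.2.2⟩
  -- Simultaneous approximation of multiples of `x` by lattice points.
  obtain ⟨q, hq, p, hpΛ, hqp⟩ : ∃ q : ℕ, 1 ≤ q ∧ ∃ p ∈ Λ, ‖p - (q : ℝ) • x‖ < δ := by
    let b := (Module.Free.chooseBasis ℤ Λ).ofZLatticeBasis ℝ Λ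
    have hb : Submodule.span ℤ (Set.range b) = Λ := Module.Basis.ofZLatticeBasis_span ℝ Λ _
    obtain ⟨a, θ, hθ, hlim⟩ : ∃ (a : V) (θ : ℕ → ℕ), StrictMono θ ∧
        Tendsto (fun k => ZSpan.fract b ((θ k : ℝ) • x)) atTop (𝓝 a) := by
      obtain ⟨a, -, θ, hθ, h⟩ := tendsto_subseq_of_bounded (ZSpan.fundamentalDomain_isBounded b)
        fun k : ℕ => ZSpan.fract_mem_fundamentalDomain b ((k : ℝ) • x)
      exact ⟨a, θ, hθ, h⟩
    obtain ⟨K, hK⟩ := Metric.cauchySeq_iff.1 hlim.cauchySeq δ hδ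
    have hdist := hK (K + 1) (Nat.le_succ K) K le_rfl
    have hlt : θ K < θ (K + 1) := hθ (Nat.lt_succ_self K)
    have hfl : ∀ m : V, ((ZSpan.floor b m : Submodule.span ℤ (Set.range b)) : V) ∈ Λ := fun m =>
      hb.le (ZSpan.floor b m).2
    refine ⟨θ (K + 1) - θ K, by omega, ZSpan.floor b ((θ (K + 1) : ℝ) • x) -
      ZSpan.floor b ((θ K : ℝ) • x), Λ.sub_mem (hfl _) (hfl _), ?_⟩
    rw [dist_comm, dist_eq_norm, ZSpan.fract_apply, ZSpan.fract_apply] at hdist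
    refine lt_of_eq_of_lt (congrArg _ ?_) hdist
    rw [Nat.cast_sub hlt.le, sub_smul]
    abel
  have hq1 : (1 : ℝ) ≤ q := by exact_mod_cast hq
  have hf : ∀ f ∈ s, |f p - q * f x| ≤ ‖f‖ * δ := fun f _ => by
    have h1 := f.le_opNorm (p - (q : ℝ) • x)
    rw [map_sub, map_smul, smul_eq_mul, Real.norm_eq_abs] at h1
    exact h1.trans (mul_le_mul_of_nonneg_left hqp.le (norm_nonneg f))
  refine ⟨p, ⟨(hcs p).2 fun f hfs => ?_, hpΛ⟩, ?_⟩
  · have h1 := abs_le.1 (hf f hfs)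
    rcases ((hcs x).1 hx f hfs).eq_or_lt with h0 | hpos
    · rw [← h0, mul_zero, sub_zero] at h1
      obtain ⟨k, hk⟩ := hs f hfs p hpΛ
      have h2 := hδ1 f hfs
      rw [hk] at h1 ⊢
      have h3 : (-1 : ℝ) < k := by linarith [h1.1]
      have h4 : -1 < k := by exact_mod_cast h3
      exact_mod_cast (by omega : 0 ≤ k)
    · have h2 := hδf f hfs hpos
      nlinarith [h1.1]
  · rintro rfl
    rw [zero_sub, norm_neg, norm_smul, Real.norm_of_nonneg (by linarith)] at hqp
    nlinarith [norm_nonneg x]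

end Gordan

/-! ### The lattice points of a cone as a disjoint union of simplicial cones -/

section Decomposition

variable {V : Type*} [NormedAddCommGroup V] [NormedSpace ℝ V] [FiniteDimensional ℝ V]
  {ι : Type*} [Fintype ι] [DecidableEq ι]

/-- The points of `ℕ^(J ∪ {i})` are obtained from those of `ℕ^J` by choosing the coordinate `i`. -/
noncomputable def orthantPieceInsertEquiv {i : ι} {J : Finset ι} (hi : i ∉ J) :
    ℕ × orthantPiece (0 : ι → ℕ) J ≃ orthantPiece (0 : ι → ℕ) (insert i J) where
  toFun p := ⟨Pi.single i p.1 + p.2.1, fun _ => Nat.zero_le _, fun j hj => by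
    rw [Finset.mem_insert, not_or] at hj
    simp [Pi.single_eq_of_ne hj.1, p.2.2.2 j hj.2]⟩
  invFun x := ⟨x.1 i, Function.update x.1 i 0, fun _ => Nat.zero_le _, fun j hj => by
    by_cases hji : j = i
    · simp [hji]
    · simpa [hji] using x.2.2 j (by simp [hji, hj])⟩
  left_inv p := by
    obtain ⟨m, n, hn⟩ := p
    have hni : n i = 0 := hn.2 i hi
    ext j
    · simp [hni]
    · by_cases hji : j = i
      · subst hji; simp [hni]
      · simp [hji]
  right_inv x := by
    ext j
    by_cases hji : j = i
    · subst hji; simp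
    · simp [hji]

/-- Translation from `ℕ^J` to `b + ℕ^J`. -/
noncomputable def orthantPieceAddEquiv (b : ι → ℕ) (J : Finset ι) :
    orthantPiece (0 : ι → ℕ) J ≃ orthantPiece b J where
  toFun n := ⟨b + n, le_self_add, fun j hj => by simp [n.2.2 j hj]⟩
  invFun n := ⟨n - b, fun _ => Nat.zero_le _, fun j hj => by simp [n.2.2 j hj]⟩
  left_inv n := by
    ext j
    simp
  right_inv n := by
    ext j
    exact add_tsub_cancel_of_le (n.2.1 j)

variable [MeasurableSpace V] [BorelSpace V]

theorem lintegral_latticeCone (g : ι → V) {l : List ι} (hl : l.Nodup) (t : ℝ) {G : V → ENNReal}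
    (hG : Measurable G) :
    ∫⁻ x, G x ∂latticeCone (l.map g) t = ENNReal.ofReal t⁻¹ ^ l.length *
      ∑' n : orthantPiece (0 : ι → ℕ) l.toFinset, G (t⁻¹ • ∑ i, n.1 i • g i) := by
  induction l generalizing G with
  | nil =>
    have hx : ∀ x : ι → ℕ, x ∈ orthantPiece (0 : ι → ℕ) ∅ ↔ x = 0 := fun x =>
      ⟨fun h => funext fun i => h.2 i (by simp), fun h => h ▸ mem_orthantPiece_self _ _⟩
    have h0 : ∀ n : orthantPiece (0 : ι → ℕ) ∅, G (t⁻¹ • ∑ i, n.1 i • g i) = G 0 := fun n => by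
      simp [(hx n).1 n.2]
    have : Unique (orthantPiece (0 : ι → ℕ) ∅) :=
      ⟨⟨⟨0, (hx 0).2 rfl⟩⟩, fun n => Subtype.ext ((hx n).1 n.2)⟩
    simp only [List.map_nil, List.length_nil, pow_zero, one_mul, List.toFinset_nil, h0]
    rw [tsum_fintype, Fintype.sum_unique]
    exact lintegral_dirac' 0 hG
  | cons i l ih =>
    obtain ⟨hi, hl⟩ := List.nodup_cons.1 hl
    have hi' : i ∉ l.toFinset := by simpa using hi
    change ∫⁻ x, G x ∂(latticeRay (g i) t ∗ latticeCone (l.map g) t) = _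
    rw [Measure.lintegral_conv hG, latticeRay, lintegral_smul_measure, lintegral_sum_measure]
    have h1 : ∀ m : ℕ, ∫⁻ x, ∫⁻ y, G (x + y) ∂latticeCone (l.map g) t
        ∂Measure.dirac (((m : ℝ) * t⁻¹) • g i) = ENNReal.ofReal t⁻¹ ^ l.length *
          ∑' n : orthantPiece (0 : ι → ℕ) l.toFinset,
            G (t⁻¹ • ∑ j, (Pi.single i m + n.1 : ι → ℕ) j • g j) := fun m => by
      rw [lintegral_dirac' _ (by fun_prop), ih hl (by fun_prop)]
      congr! 4 with n
      rw [mul_comm, mul_smul, ← smul_add]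
      congr 1
      simp [add_smul, Finset.sum_add_distrib, Pi.single_apply, ite_smul, Nat.cast_smul_eq_nsmul]
    simp_rw [h1]
    rw [ENNReal.tsum_mul_left, smul_eq_mul, ← mul_assoc, ← pow_succ', List.length_cons,
      List.toFinset_cons, ← (orthantPieceInsertEquiv hi').tsum_eq, ENNReal.tsum_prod']
    rfl

theorem lintegral_pieceMeasure (g : ι → V) {l : List ι} (hl : l.Nodup) (e : ℕ) (b : ι → ℕ)
    {t : ℝ} (ht : 0 < t) {G : V → ENNReal} (hG : Measurable G) :
    ∫⁻ x, G x ∂pieceMeasure e (∑ i, b i • g i) (l.map g) t =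
      ENNReal.ofReal (t ^ (e + l.length))⁻¹ *
        ∑' n : orthantPiece b l.toFinset, G (t⁻¹ • ∑ i, n.1 i • g i) := by
  rw [pieceMeasure, lintegral_smul_measure, Measure.lintegral_conv hG,
    lintegral_dirac' _ (by fun_prop), lintegral_latticeCone g hl t (by fun_prop), smul_eq_mul,
    ← mul_assoc, ← ENNReal.ofReal_pow (by positivity), ← ENNReal.ofReal_mul (by positivity),
    pow_add, mul_inv, inv_pow t l.length, ← (orthantPieceAddEquiv b l.toFinset).tsum_eq]
  congr! 4 with n
  simp [orthantPieceAddEquiv, add_smul, Finset.sum_add_distrib]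

omit [MeasurableSpace V] [BorelSpace V]

/-- The number of directions of a translated orthant on which `n ↦ ∑ nᵢ gᵢ` is injective, for
lattice vectors `gᵢ` in a cone, is at most the dimension of the cone: the `gᵢ` in these directions
are linearly independent over `ℤ`, hence over `ℝ` because the lattice is discrete. -/
theorem card_le_coneDim {Λ : Submodule ℤ V} [DiscreteTopology Λ] {c : PointedCone ℝ V}
    {g : ι → V} (hg : ∀ i, g i ∈ latticePoints Λ c) {b : ι → ℕ} {J : Finset ι}
    (hinj : Set.InjOn (fun n : ι → ℕ => ∑ i, n i • g i) (orthantPiece b J)) :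
    J.card ≤ coneDim c := by
  have hli : LinearIndependent ℤ fun i : J => g i := by
    rw [Fintype.linearIndependent_iff]
    intro a ha i
    have hmem : ∀ f : J → ℕ, (fun j => b j + if h : j ∈ J then f ⟨j, h⟩ else 0) ∈
        orthantPiece b J := fun f => ⟨fun j => Nat.le_add_right _ _, fun j hj => by simp [hj]⟩
    have hsum : ∀ f : J → ℕ, ∑ j, (b j + if h : j ∈ J then f ⟨j, h⟩ else 0) • g j =
        ∑ j, b j • g j + ∑ j : J, f j • g j := fun f => by
      simp_rw [add_smul, Finset.sum_add_distrib]
      congr 1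
      rw [← Finset.sum_subset (Finset.subset_univ J) (fun j _ hj => by simp [hj]),
        ← Finset.sum_attach]
      exact Finset.sum_congr rfl fun j _ => by simp
    have h := hinj (hmem fun j => (a j).toNat) (hmem fun j => (-a j).toNat) (by
      beta_reduce
      refine (hsum fun j => (a j).toNat).trans (Eq.trans ?_ (hsum fun j => (-a j).toNat).symm)
      congr 1
      rw [← sub_eq_zero, ← Finset.sum_sub_distrib, ← ha]
      refine Finset.sum_congr rfl fun j _ => ?_
      rw [← natCast_zsmul, ← natCast_zsmul, ← sub_smul]
      congr 1
      omega)
    have hi : (a i).toNat = (-a i).toNat := by simpa using congrFun h i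
    omega
  have hdisc : DiscreteTopology (Submodule.span ℤ (Set.range fun i : J => g i)) := by
    have hle : Submodule.span ℤ (Set.range fun i : J => g i) ≤ Λ :=
      Submodule.span_le.2 (by rintro _ ⟨i, rfl⟩; exact (hg i).2)
    exact DiscreteTopology.of_subset (s := (Λ : Set V)) ‹_› hle
  have h1 := Real.finrank_eq_int_finrank_of_discrete hdisc
  have h2 : Set.finrank ℤ (Set.range fun i : J => g i) = Fintype.card J := finrank_span_eq_card hli
  rw [h2, Fintype.card_coe] at h1
  rw [← h1]
  exact Submodule.finrank_mono (Submodule.span_mono (by rintro _ ⟨i, rfl⟩; exact (hg i).1))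

/-- There are at least `dim c` nonzero lattice points in a pointed rational cone `c`. -/
theorem exists_finset_latticePoints {Λ : Submodule ℤ V} [DiscreteTopology Λ] [IsZLattice ℝ Λ]
    {c : PointedCone ℝ V} (hc : IsRationalCone Λ c) :
    ∃ w : Finset V, (∀ x ∈ w, x ∈ latticePoints Λ c ∧ x ≠ 0) ∧ coneDim c ≤ w.card := by
  classical
  by_cases h : ∃ x ∈ c, x ≠ 0
  · obtain ⟨x, hx, hx0⟩ := h
    obtain ⟨p, hp, hp0⟩ := exists_latticePoint_ne_zero hc hx hx0
    refine ⟨(Finset.range (coneDim c)).image fun k => (k + 1) • p, fun y hy => ?_, ?_⟩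
    · obtain ⟨k, -, rfl⟩ := Finset.mem_image.1 hy
      refine ⟨⟨nsmul_mem hp.1 _, nsmul_mem hp.2 _⟩, ?_⟩
      rw [← Nat.cast_smul_eq_nsmul ℝ]
      exact smul_ne_zero (Nat.cast_ne_zero.2 k.succ_ne_zero) hp0
    · rw [Finset.card_image_of_injective, Finset.card_range]
      intro k k' hk
      simp only [← Nat.cast_smul_eq_nsmul ℝ] at hk
      exact Nat.succ_injective (Nat.cast_injective (smul_left_injective ℝ hp0 hk))
  · push Not at h
    have : Submodule.span ℝ (c : Set V) = ⊥ := Submodule.span_eq_bot.2 h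
    exact ⟨∅, by simp, by simp [coneDim, this]⟩

variable [MeasurableSpace V] [BorelSpace V]

/-- The lattice points of a pointed rational cone are the disjoint union of finitely many translates
of simplicial lattice cones: every lattice point has a unique lexicographically minimal expression
in terms of generators, and the set of minimal expressions is a lower set in `ℕ^N`, hence a disjoint
union of translated orthants. -/
theorem exists_piece_decomposition {Λ : Submodule ℤ V} [DiscreteTopology Λ] [IsZLattice ℝ Λ]
    {c : PointedCone ℝ V} (hc : IsRationalCone Λ c) (hp : HasTrivialLineality c) :
    ∃ (v : Finset V) (κ : Type) (_ : Fintype κ) (b : κ → V) (L : κ → List V),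
      (∀ x ∈ v, x ∈ latticePoints Λ c ∧ x ≠ 0) ∧ coneDim c ≤ v.card ∧ (∀ k, b k ∈ c) ∧
      (∀ k, (L k).Nodup ∧ (∀ x ∈ L k, x ∈ v) ∧ (L k).length ≤ coneDim c) ∧
      ∀ t : ℝ, 0 < t → ENNReal.ofReal (t ^ coneDim c)⁻¹ •
          Measure.sum (fun x : latticePoints Λ c => Measure.dirac (t⁻¹ • (x : V))) =
        ∑ k, pieceMeasure (coneDim c - (L k).length) (b k) (L k) t := by
  classical
  obtain ⟨v₀, hv₀, hgen⟩ := exists_generators hc hp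
  obtain ⟨w, hw, hwcard⟩ := exists_finset_latticePoints hc
  let g : Fin v₀.card → V := fun i => v₀.equivFin.symm i
  have hgv : ∀ i, g i ∈ v₀ := fun i => (v₀.equivFin.symm i).2
  have hginj : Function.Injective g := Subtype.val_injective.comp v₀.equivFin.symm.injective
  have hg : ∀ i, g i ∈ latticePoints Λ c := fun i => (hv₀ _ (hgv i)).1
  have hmem : ∀ n : Fin v₀.card → ℕ, ∑ i, n i • g i ∈ latticePoints Λ c := fun n =>
    ⟨sum_mem fun i _ => nsmul_mem (hg i).1 _, sum_mem fun i _ => nsmul_mem (hg i).2 _⟩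
  have hsurj : ∀ x ∈ latticePoints Λ c, ∃ n : Fin v₀.card → ℕ, ∑ i, n i • g i = x := fun x hx => by
    refine AddSubmonoid.closure_induction (fun y hy => ?_) ⟨0, by simp⟩ ?_ (hgen x hx)
    · refine ⟨Pi.single (v₀.equivFin ⟨y, hy⟩) 1, ?_⟩
      simp [Pi.single_apply, ite_smul, g]
    · rintro _ _ - - ⟨m, rfl⟩ ⟨n, rfl⟩
      exact ⟨m + n, by simp [add_smul, Finset.sum_add_distrib]⟩
  obtain ⟨κ, hκ, b, J, -, hsum⟩ :=
    exists_orthant_decomposition (isLowerSet_lexMinReps g) Finset.univ 0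
  have huniv : orthantPiece (0 : Fin v₀.card → ℕ) Finset.univ = Set.univ :=
    Set.eq_univ_of_forall fun x =>
      ⟨fun _ => Nat.zero_le _, fun i hi => absurd (Finset.mem_univ i) hi⟩
  rw [huniv, Set.inter_univ] at hsum
  have hsub : ∀ k, orthantPiece (b k) (J k) ⊆ lexMinReps g := fun k n hn => by
    by_contra hnD
    have h := hsum n
    rw [Set.indicator_of_notMem hnD, Finset.sum_eq_zero_iff] at h
    simpa [hn] using h k (Finset.mem_univ k)
  let E : lexMinReps g ≃ latticePoints Λ c :=
    Equiv.ofBijective (fun n => ⟨∑ i, n.1 i • g i, hmem n.1⟩)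
      ⟨fun n m h => Subtype.ext (injOn_lexMinReps g n.2 m.2 (congrArg Subtype.val h)), fun x => by
        obtain ⟨n, hn⟩ := hsurj x x.2
        obtain ⟨m, hm, hmn⟩ := exists_lexMinReps g n
        exact ⟨⟨m, hm⟩, Subtype.ext (hmn.trans hn)⟩⟩
  have hcard : ∀ k, ((J k).toList.map g).length ≤ coneDim c := fun k => by
    rw [List.length_map, Finset.length_toList]
    exact card_le_coneDim hg ((injOn_lexMinReps g).mono (hsub k))
  refine ⟨v₀ ∪ w, κ, hκ, fun k => ∑ i, b k i • g i, fun k => (J k).toList.map g, fun x hx => ?_,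
    hwcard.trans (Finset.card_le_card Finset.subset_union_right), fun k => (hmem _).1,
    fun k => ⟨(J k).nodup_toList.map hginj, fun x hx => ?_, hcard k⟩, fun t ht => ?_⟩
  · exact (Finset.mem_union.1 hx).elim (hv₀ x) (hw x)
  · obtain ⟨i, -, rfl⟩ := List.mem_map.1 hx
    exact Finset.mem_union_left _ (hgv i)
  · refine Measure.ext_of_lintegral _ fun G hG => ?_
    rw [lintegral_smul_measure, lintegral_sum_measure, lintegral_finsetSum_measure]
    have hpiece : ∀ k, ∫⁻ x, G x ∂pieceMeasure (coneDim c - ((J k).toList.map g).length)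
        (∑ i, b k i • g i) ((J k).toList.map g) t = ENNReal.ofReal (t ^ coneDim c)⁻¹ *
          ∑' n, (orthantPiece (b k) (J k)).indicator 1 n * G (t⁻¹ • ∑ i, n i • g i) := fun k => by
      rw [lintegral_pieceMeasure g (J k).nodup_toList _ _ ht hG,
        ← List.length_map (as := (J k).toList) (f := g), Nat.sub_add_cancel (hcard k),
        Finset.toList_toFinset,
        tsum_subtype (orthantPiece (b k) (J k)) fun n => G (t⁻¹ • ∑ i, n i • g i)]
      congr! 3 with n
      by_cases hn : n ∈ orthantPiece (b k) (J k) <;> simp [hn]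
    simp_rw [hpiece, lintegral_dirac' _ hG, smul_eq_mul]
    rw [← Finset.mul_sum, ← E.tsum_eq, ← Summable.tsum_finsetSum fun _ _ => ENNReal.summable]
    congr 1
    simp_rw [← Finset.sum_mul, hsum]
    refine (tsum_subtype (lexMinReps g) fun n => G (t⁻¹ • ∑ i, n i • g i)).trans ?_
    refine tsum_congr fun n => ?_
    by_cases hn : n ∈ lexMinReps g <;> simp [hn]

end Decomposition

/-! ### The generating function and its homogeneous components -/

section GeneratingFunction

theorem prod_map_inv_eq_div {α : Type*} [DecidableEq α] {l : List α} (hl : l.Nodup) {v : Finset α}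
    (hlv : ∀ x ∈ l, x ∈ v) {f : α → ℂ} (hf : ∀ x ∈ v, f x ≠ 0) :
    (l.map fun x => (f x)⁻¹).prod = (∏ x ∈ v \ l.toFinset, f x) / ∏ x ∈ v, f x := by
  have hsub : l.toFinset ⊆ v := fun x hx => hlv x (List.mem_toFinset.1 hx)
  have h1 : ∏ x ∈ l.toFinset, f x ≠ 0 := Finset.prod_ne_zero_iff.2 fun x hx => hf x (hsub hx)
  have h2 : ∏ x ∈ v, f x ≠ 0 := Finset.prod_ne_zero_iff.2 hf
  rw [← List.prod_toFinset _ hl, Finset.prod_inv_distrib, eq_div_iff h2,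
    ← Finset.prod_sdiff hsub, mul_comm, mul_assoc, mul_inv_cancel₀ h1, mul_one]

theorem prod_map_todd_mul_prod_map_neg_inv {α : Type*} (l : List α) {f : α → ℂ} {z : ℂ}
    (hf : ∀ x ∈ l, f x ≠ 0) :
    (l.map fun x => z * f x * (Complex.exp (z * f x) - 1)⁻¹).prod * (l.map fun x => -(f x)⁻¹).prod =
      z ^ l.length * (l.map fun x => (1 - Complex.exp (z * f x))⁻¹).prod := by
  induction l with
  | nil => simp
  | cons a l ih =>
    have h := ih fun x hx => hf x (List.mem_cons_of_mem a hx)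
    have ha := hf a List.mem_cons_self
    have h1 : (1 - Complex.exp (z * f a))⁻¹ = -(Complex.exp (z * f a) - 1)⁻¹ := by
      rw [← inv_neg, neg_sub]
    simp only [List.map_cons, List.prod_cons, List.length_cons, pow_succ, h1]
    linear_combination (-z * (Complex.exp (z * f a) - 1)⁻¹) * h +
      (-z * (Complex.exp (z * f a) - 1)⁻¹ *
        (l.map fun x => z * f x * (Complex.exp (z * f x) - 1)⁻¹).prod *
        (l.map fun x => -(f x)⁻¹).prod) * mul_inv_cancel₀ ha

variable {V : Type*} [NormedAddCommGroup V] [NormedSpace ℝ V] {κ : Type*} [Fintype κ]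

theorem analyticAt_eval (x : V) (ζ₀ : V →L[ℝ] ℂ) :
    AnalyticAt ℂ (fun ζ : V →L[ℝ] ℂ => ζ x) ζ₀ :=
  (LinearMap.mkContinuous (σ := RingHom.id ℂ)
    { toFun := fun ζ : V →L[ℝ] ℂ => ζ x
      map_add' := fun _ _ => rfl
      map_smul' := fun _ _ => rfl } ‖x‖
    fun ζ => (ζ.le_opNorm x).trans_eq (mul_comm _ _)).analyticAt ζ₀

/-- The sum of the generating functions of the translates by `b k` of the simplicial cones spanned
by the lists of vectors `L k`. -/
noncomputable def coneGenFun (b : κ → V) (L : κ → List V) (ζ : V →L[ℝ] ℂ) : ℂ :=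
  ∑ k, Complex.exp (ζ (b k)) * ((L k).map fun x => (1 - Complex.exp (ζ x))⁻¹).prod

/-- The numerator, over the common denominator `∏ x ∈ v, ζ x`, of the homogeneous component of
degree `j - ℓ` of `coneGenFun b L`. -/
noncomputable def componentNumerator [DecidableEq V] (ℓ : ℕ) (v : Finset V) (b : κ → V)
    (L : κ → List V) (j : ℕ) : MvPolynomial V ℂ :=
  ∑ k, PowerSeries.coeff j (pieceSymbol (ℓ - (L k).length) (b k) (L k)) *
    (MvPolynomial.C ((-1) ^ (L k).length) * ∏ x ∈ v \ (L k).toFinset, MvPolynomial.X x)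

/-- The homogeneous component of degree `m` of `coneGenFun b L`, for vectors `L k` in `v` and lists
of length at most `ℓ`. -/
noncomputable def coneComponent [DecidableEq V] (ℓ : ℕ) (v : Finset V) (b : κ → V)
    (L : κ → List V) (m : ℤ) (ζ : V →L[ℝ] ℂ) : ℂ :=
  if -(ℓ : ℤ) ≤ m then
    MvPolynomial.eval (fun x => ζ x) (componentNumerator ℓ v b L (m + ℓ).toNat) / ∏ x ∈ v, ζ x
  else 0

variable {ℓ : ℕ} {v : Finset V} {b : κ → V} {L : κ → List V}

/-- A real direction on which all the relevant vectors take positive values moves any point off the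
polar locus. -/
theorem isMeromorphicOnDual_coneGenFun {u : V →L[ℝ] ℝ} (huv : ∀ x ∈ v, 0 < u x)
    (hL : ∀ k, (L k).Nodup ∧ ∀ x ∈ L k, x ∈ v) : IsMeromorphicOnDual (coneGenFun b L) := by
  classical
  intro ζ₀
  refine ⟨fun ζ => ∑ k, Complex.exp (ζ (b k)) *
    ∏ x ∈ v \ (L k).toFinset, (1 - Complex.exp (ζ x)),
    fun ζ => ∏ x ∈ v, (1 - Complex.exp (ζ x)), ?_, ?_, fun hq => ?_,
    Eventually.of_forall fun ζ hq => ?_⟩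
  · exact Finset.analyticAt_fun_sum _ fun k _ => (analyticAt_eval _ _).cexp.mul <|
      Finset.analyticAt_fun_prod _ fun x _ => analyticAt_const.sub (analyticAt_eval _ _).cexp
  · exact Finset.analyticAt_fun_prod _ fun x _ => analyticAt_const.sub (analyticAt_eval _ _).cexp
  · have hcont : Tendsto (fun s : ℝ => ζ₀ + (s : ℂ) • Complex.ofRealCLM.comp u) (𝓝 0) (𝓝 ζ₀) := by
      have : Continuous fun s : ℝ => ζ₀ + (s : ℂ) • Complex.ofRealCLM.comp u := by fun_prop
      convert this.tendsto 0 using 2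
      ext x
      simp
    have h1 : ∀ᶠ s : ℝ in 𝓝[≠] 0,
        ∏ x ∈ v, (1 - Complex.exp ((ζ₀ + (s : ℂ) • Complex.ofRealCLM.comp u) x)) = 0 :=
      (hcont.eventually hq).filter_mono nhdsWithin_le_nhds
    have h2 : ∀ᶠ s : ℝ in 𝓝[≠] 0, ∀ x ∈ v, s ≠ -(ζ₀ x).re / u x :=
      (Finset.eventually_all v).2 fun x _ =>
        nhdsNE_le_cofinite 0 (Set.finite_singleton (-(ζ₀ x).re / u x)).compl_mem_cofinite
    obtain ⟨s, hs1, hs2⟩ := (h1.and h2).exists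
    obtain ⟨x, hx, hx0⟩ := Finset.prod_eq_zero_iff.1 hs1
    refine hs2 x hx ?_
    have h3 := congrArg norm (sub_eq_zero.1 hx0)
    rw [norm_one, Complex.norm_exp, eq_comm, Real.exp_eq_one_iff] at h3
    have h4 : (ζ₀ x).re + s * u x = 0 := by simpa using h3
    rw [eq_div_iff (huv x hx).ne']
    linarith
  · rw [coneGenFun, Finset.sum_div]
    refine Finset.sum_congr rfl fun k _ => ?_
    rw [prod_map_inv_eq_div (hL k).1 (hL k).2 (Finset.prod_ne_zero_iff.1 hq), mul_div_assoc]

variable [DecidableEq V]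

theorem isHomogeneous_componentNumerator (hL : ∀ k, (L k).Nodup ∧ (∀ x ∈ L k, x ∈ v) ∧
    (L k).length ≤ ℓ) {n j : ℕ} (hn : n + ℓ = j + v.card) :
    (componentNumerator ℓ v b L j).IsHomogeneous n := by
  refine MvPolynomial.IsHomogeneous.sum _ _ _ fun k _ => ?_
  obtain ⟨hnd, hv, hlen⟩ := hL k
  have hsub : (L k).toFinset ⊆ v := fun x hx => hv x (List.mem_toFinset.1 hx)
  have hcard : (v \ (L k).toFinset).card + (L k).length = v.card := by
    rw [← List.toFinset_card_of_nodup hnd]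
    exact Finset.card_sdiff_add_card_eq_card hsub
  rw [pieceSymbol, PowerSeries.coeff_X_pow_mul']
  split_ifs with hj
  · have h1 := ((isGradedSymbol_raySymbol (PowerSeries.exp ℂ) (b k)).mul
      (isGradedSymbol_toddSymbol (L k))) (j - (ℓ - (L k).length))
    have h2 : (∏ x ∈ v \ (L k).toFinset, (MvPolynomial.X x : MvPolynomial V ℂ)).IsHomogeneous
        (v \ (L k).toFinset).card := by
      have := MvPolynomial.IsHomogeneous.prod (v \ (L k).toFinset)
        (fun x => (MvPolynomial.X x : MvPolynomial V ℂ)) (fun _ => 1)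
        fun x _ => MvPolynomial.isHomogeneous_X ℂ x
      simpa using this
    have h3 := h1.mul ((MvPolynomial.isHomogeneous_C V ((-1 : ℂ) ^ (L k).length)).mul h2)
    convert h3 using 1
    omega
  · rw [zero_mul]
    exact MvPolynomial.isHomogeneous_zero V ℂ n

theorem coneComponent_eq_sum (hL : ∀ k, (L k).Nodup ∧ (∀ x ∈ L k, x ∈ v) ∧ (L k).length ≤ ℓ)
    {ζ : V →L[ℝ] ℂ} (hζ : ∀ x ∈ v, ζ x ≠ 0) (j : ℕ) :
    coneComponent ℓ v b L ((j : ℤ) - ℓ) ζ =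
      ∑ k, ((L k).map fun x => -(ζ x)⁻¹).prod * MvPolynomial.eval (fun x => ζ x)
        (PowerSeries.coeff j (pieceSymbol (ℓ - (L k).length) (b k) (L k))) := by
  rw [coneComponent, if_pos (by omega), sub_add_cancel, Int.toNat_natCast, componentNumerator,
    map_sum, Finset.sum_div]
  refine Finset.sum_congr rfl fun k _ => ?_
  have h : ((L k).map fun x => -(ζ x)⁻¹).prod =
      (-1) ^ (L k).length * ((L k).map fun x => (ζ x)⁻¹).prod := by
    rw [← List.length_map (as := L k) (f := fun x => (ζ x)⁻¹), ← List.prod_map_neg, List.map_map]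
    rfl
  rw [h, prod_map_inv_eq_div (hL k).1 (hL k).2.1 hζ]
  simp only [map_mul, map_prod, MvPolynomial.eval_C, MvPolynomial.eval_X]
  ring

/-- The Laurent expansion of the generating function on a complex line. It is obtained by evaluating
the symbols of the pieces: a piece contributes `z^(ℓ - |L|) exp (z ⟨ζ, b⟩)` times the product of the
`z ⟨ζ, x⟩ / (exp (z ⟨ζ, x⟩) - 1)`, and dividing by `z^ℓ` and by the linear forms `-⟨ζ, x⟩` yields
its generating function at `z ζ`. -/
theorem hasSum_coneComponent (hL : ∀ k, (L k).Nodup ∧ (∀ x ∈ L k, x ∈ v) ∧ (L k).length ≤ ℓ)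
    {ζ : V →L[ℝ] ℂ} (hζ : ∀ x ∈ v, ζ x ≠ 0) :
    ∀ᶠ z in 𝓝[≠] (0 : ℂ), HasSum (fun j : ℕ => coneComponent ℓ v b L ((j : ℤ) - ℓ) ζ *
      z ^ ((j : ℤ) - ℓ)) (coneGenFun b L (z • ζ)) := by
  have hsmall : ∀ᶠ z : ℂ in 𝓝[≠] 0, ∀ x ∈ v, ‖z * ζ x‖ < 1 := by
    refine (Finset.eventually_all v).2 fun x _ => ?_
    have : Tendsto (fun z : ℂ => ‖z * ζ x‖) (𝓝 0) (𝓝 ‖0 * ζ x‖) :=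
      (by fun_prop : Continuous fun z : ℂ => ‖z * ζ x‖).tendsto 0
    rw [zero_mul, norm_zero] at this
    exact (this.eventually (gt_mem_nhds one_pos)).filter_mono nhdsWithin_le_nhds
  filter_upwards [hsmall, self_mem_nhdsWithin] with z hz hz0
  have hz0 : z ≠ 0 := hz0
  have hk : ∀ k, HasSum (fun j : ℕ => ((L k).map fun x => -(ζ x)⁻¹).prod *
      MvPolynomial.eval (fun x => ζ x)
        (PowerSeries.coeff j (pieceSymbol (ℓ - (L k).length) (b k) (L k))) * z ^ ((j : ℤ) - ℓ))
      (Complex.exp ((z • ζ) (b k)) *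
        ((L k).map fun x => (1 - Complex.exp ((z • ζ) x))⁻¹).prod) := fun k => by
    obtain ⟨-, hv, hlen⟩ := hL k
    have h1 : HasSum _ _ := (hasSymbolSum_X_pow (ℓ - (L k).length)).mul
      ((hasSymbolSum_exp (b k)).mul (hasSymbolSum_toddSymbol (L := L k) (ζ := ζ) (z := z)
        fun x hx => ⟨hz x (hv x hx), mul_ne_zero hz0 (hζ x (hv x hx))⟩))
    have h2 := h1.mul_left (((L k).map fun x => -(ζ x)⁻¹).prod * z ^ (-(ℓ : ℤ)))
    have h3 := prod_map_todd_mul_prod_map_neg_inv (L k) (f := fun x => ζ x) (z := z)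
      fun x hx => hζ x (hv x hx)
    have h4 : z ^ (-(ℓ : ℤ)) * z ^ (ℓ - (L k).length) * z ^ (L k).length = 1 := by
      rw [mul_assoc, ← pow_add, Nat.sub_add_cancel hlen, zpow_neg, zpow_natCast,
        inv_mul_cancel₀ (pow_ne_zero _ hz0)]
    have h5 : Complex.exp ((z • ζ) (b k)) *
        ((L k).map fun x => (1 - Complex.exp ((z • ζ) x))⁻¹).prod =
        ((L k).map fun x => -(ζ x)⁻¹).prod * z ^ (-(ℓ : ℤ)) * (z ^ (ℓ - (L k).length) *
          (Complex.exp (z * ζ (b k)) *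
            ((L k).map fun x => z * ζ x * (Complex.exp (z * ζ x) - 1)⁻¹).prod)) := by
      change Complex.exp (z * ζ (b k)) *
        ((L k).map fun x => (1 - Complex.exp (z * ζ x))⁻¹).prod = _
      linear_combination
        (-z ^ (-(ℓ : ℤ)) * z ^ (ℓ - (L k).length) * Complex.exp (z * ζ (b k))) * h3 -
        (Complex.exp (z * ζ (b k)) *
          ((L k).map fun x => (1 - Complex.exp (z * ζ x))⁻¹).prod) * h4
    rw [h5]
    refine h2.congr_fun fun j => ?_
    rw [sub_eq_add_neg, zpow_add₀ hz0, zpow_natCast]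
    simp only [pieceSymbol]
    ring
  refine (hasSum_sum fun k _ => hk k).congr_fun fun j => ?_
  rw [coneComponent_eq_sum hL hζ, Finset.sum_mul]

end GeneratingFunction

/-! ### Riemann sums over a cone -/

section RiemannSum

variable {V : Type*} [NormedAddCommGroup V] [NormedSpace ℝ V] [FiniteDimensional ℝ V]
  [MeasurableSpace V] [BorelSpace V] {c : PointedCone ℝ V} {u : V →L[ℝ] ℝ}

theorem exists_temperateOn_sum (hu : ∀ x ∈ c, 0 ≤ u x) {κ : Type*} {μ : κ → Measure V}
    {s : Finset κ} (h : ∀ k ∈ s, ∃ M K, TemperateOn c u M K (μ k)) :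
    ∃ M K, TemperateOn c u M K (∑ k ∈ s, μ k) := by
  classical
  induction s using Finset.induction_on with
  | empty =>
    rw [Finset.sum_empty]
    refine ⟨0, 0, inferInstance, ?_, ?_, ?_⟩ <;> simp
  | insert k s hk ih =>
    obtain ⟨M, K, hμ⟩ := h k (Finset.mem_insert_self k s)
    obtain ⟨M', K', hμ'⟩ := ih fun j hj => h j (Finset.mem_insert_of_mem hj)
    rw [Finset.sum_insert hk]
    exact ⟨max M M', K + K', (hμ.mono hu (le_max_left _ _) le_rfl).add
      (hμ'.mono hu (le_max_right _ _) le_rfl)⟩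

theorem exists_distribution (hu : ∀ x ∈ c, 0 ≤ u x) {M : ℕ} {K : ℝ} {μ : Measure V}
    (hμ : TemperateOn c u M K μ) : ∃ T : 𝓢'(V, ℂ), ∀ h, T h = ∫ x, h x ∂μ :=
  have := hμ.hasTemperateGrowth hu
  ⟨μ.toTemperedDistribution, fun h => μ.toTemperedDistribution_apply h⟩

theorem isBoundaryValue_sum {ν : Measure (V →L[ℝ] ℝ)} {lam : V →L[ℝ] ℝ} {κ : Type*} (s : Finset κ)
    {G : κ → (V →L[ℝ] ℂ) → ℂ} {B : κ → 𝓢'(V →L[ℝ] ℝ, ℂ)}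
    (h : ∀ k ∈ s, IsBoundaryValue ν lam (G k) (B k)) :
    IsBoundaryValue ν lam (fun ζ => ∑ k ∈ s, G k ζ) (∑ k ∈ s, B k) := by
  classical
  induction s using Finset.induction_on with
  | empty => simpa using isBoundaryValue_zero ν lam
  | insert k s hk ih =>
    simp_rw [Finset.sum_insert hk]
    exact (h k (Finset.mem_insert_self k s)).add (ih fun j hj => h j (Finset.mem_insert_of_mem hj))

/-- A boundary value depends only on the values of the function at the points `ξ + i ε lam` with
`ε > 0`. -/
theorem IsBoundaryValue.congr {ν : Measure (V →L[ℝ] ℝ)} {lam : V →L[ℝ] ℝ}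
    {G G' : (V →L[ℝ] ℂ) → ℂ} {B : 𝓢'(V →L[ℝ] ℝ, ℂ)} (h : IsBoundaryValue ν lam G B)
    (hG : ∀ ξ, ∀ ε : ℝ, 0 < ε → G (complexPoint ξ lam ε) = G' (complexPoint ξ lam ε)) :
    IsBoundaryValue ν lam G' B := by
  intro ψ
  have h1 : ∀ ε : ℝ, 0 < ε → (fun ξ => G (complexPoint ξ lam ε) * ψ ξ) =
      fun ξ => G' (complexPoint ξ lam ε) * ψ ξ := fun ε hε => funext fun ξ => by rw [hG ξ ε hε]
  refine ⟨fun ε hε => h1 ε hε ▸ (h ψ).1 ε hε, (h ψ).2.congr' ?_⟩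
  filter_upwards [self_mem_nhdsWithin] with ε hε
  rw [h1 ε hε]

variable {Λ : Submodule ℤ V}

/-- A measure which is the normalised sum of the point masses at the rescaled lattice points
integrates functions to their Riemann sums. -/
theorem hasSum_of_riemannMeasure {ℓ : ℕ} {t : ℝ} (ht : 0 < t) {μ : Measure V}
    (hμ : ENNReal.ofReal (t ^ ℓ)⁻¹ •
      Measure.sum (fun x : latticePoints Λ c => Measure.dirac (t⁻¹ • (x : V))) = μ)
    {f : V → ℂ} (hf : Integrable f μ) :
    HasSum (fun x : latticePoints Λ c => ((t : ℂ) ^ ℓ)⁻¹ * f (t⁻¹ • (x : V))) (∫ x, f x ∂μ) := by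
  have hpos : 0 < (t ^ ℓ)⁻¹ := by positivity
  rw [← hμ, integrable_smul_measure (by simpa using hpos) ENNReal.ofReal_ne_top] at hf
  have h := (hasSum_integral_measure hf).mul_left (((t ^ ℓ)⁻¹ : ℝ) : ℂ)
  rw [← hμ, integral_smul_measure, ENNReal.toReal_ofReal hpos.le, Complex.real_smul]
  refine h.congr_fun fun x => ?_
  rw [integral_dirac]
  push_cast
  rfl

/-- Expansions of finitely many families of measures, read off at the origin, add up to an expansion
of tempered distributions. -/
theorem hasAsymptoticExpansion_sum {κ : Type*} [Fintype κ] (hu : ∀ x ∈ c, 0 ≤ u x)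
    {α : κ → ℝ → Measure V} {ρ : κ → Measure V} {Q : κ → PowerSeries (MvPolynomial V ℂ)}
    (hE : ∀ k, HasEulerMaclaurin c u (α k) (ρ k) (Q k))
    (hα : ∀ k t, 0 < t → ∃ M K, TemperateOn c u M K (α k t))
    {R : ℝ → 𝓢'(V, ℂ)} (hR : ∀ t, 0 < t → ∀ h, R t h = ∫ x, h x ∂(∑ k, α k t))
    {T : κ → 𝓢'(V, ℂ)} (hT : ∀ k h, T k h = ∫ x, h x ∂(ρ k)) :
    HasAsymptoticExpansion R fun j =>
      ∑ k, PointwiseConvergenceCLM.precomp ℂ (diffOp (PowerSeries.coeff j (Q k))) (T k) := by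
  intro h n
  have hsum : ∀ j, (∑ k, PointwiseConvergenceCLM.precomp ℂ
      (diffOp (PowerSeries.coeff j (Q k))) (T k)) h =
      ∑ k, ∫ x, diffOp (PowerSeries.coeff j (Q k)) h x ∂(ρ k) := fun j => by
    simp_rw [← hT]
    exact map_sum (⟨⟨fun T => T h, rfl⟩, fun _ _ => rfl⟩ : 𝓢'(V, ℂ) →+ ℂ) _ _
  have hk : ∀ k, (fun t : ℝ => ∫ x, h x ∂(α k t) - ∑ j ∈ Finset.range (n + 1),
      ((t : ℂ) ^ j)⁻¹ * ∫ x, diffOp (PowerSeries.coeff j (Q k)) h x ∂(ρ k))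
      =O[atTop] fun t : ℝ => (t ^ (n + 1))⁻¹ := fun k => by
    obtain ⟨C, -, hC⟩ := hE k h (n + 1) 0
    refine Asymptotics.IsBigO.of_bound C ?_
    filter_upwards [eventually_ge_atTop 1] with t ht
    have h1 := hC t ht 0 c.zero_mem
    simp only [zero_add] at h1
    rw [Real.norm_of_nonneg (by positivity)]
    simpa [coneWeight] using h1
  refine (Asymptotics.IsBigO.fun_sum (s := Finset.univ) fun k _ => hk k).congr' ?_ EventuallyEq.rfl
  filter_upwards [eventually_gt_atTop 0] with t ht
  simp_rw [hsum]
  rw [hR t ht, integral_finsetSum_measure fun k _ => ?_, Finset.sum_sub_distrib, Finset.sum_comm]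
  · simp_rw [Finset.mul_sum]
  · obtain ⟨M, K, hM⟩ := hα k t ht
    simpa using hM.integrable_schwartz hu h c.zero_mem

end RiemannSum

theorem mainTheorem4 {V : Type*} [NormedAddCommGroup V] [NormedSpace ℝ V] [FiniteDimensional ℝ V]
    (Λ : Submodule ℤ V) [DiscreteTopology Λ] [IsZLattice ℝ Λ]
    (c : PointedCone ℝ V) (hc : IsRationalCone Λ c) (hpointed : HasTrivialLineality c) :
    ∃ (S : (V →L[ℝ] ℂ) → ℂ) (σ : ℤ → (V →L[ℝ] ℂ) → ℂ) (R : ℝ → 𝓢'(V, ℂ)) (F : ℕ → 𝓢'(V, ℂ)),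
      IsGeneratingFunction Λ c S ∧
      IsHomogeneousExpansion Λ c S σ ∧
      (∀ t : ℝ, 0 < t → IsRiemannSum Λ c t (R t)) ∧
      HasAsymptoticExpansion R F ∧
      ∀ (lam : V →L[ℝ] ℝ), (∀ x ∈ c, x ≠ 0 → lam x < 0) →
      ∀ (ν : Measure (V →L[ℝ] ℝ)) [ν.IsAddHaarMeasure],
        (∀ t : ℝ, 0 < t →
          IsBoundaryValue ν lam
            (fun ζ => ((t : ℂ) ^ coneDim c)⁻¹ * S ((-Complex.I / (t : ℂ)) • ζ))
            (fourierDistribution ν (R t))) ∧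
        (∀ k : ℕ,
          IsBoundaryValue ν lam (fun ζ => σ ((k : ℤ) - coneDim c) (-Complex.I • ζ))
            (fourierDistribution ν (F k))) ∧
        HasAsymptoticExpansion (fun t => fourierDistribution ν (R t))
          (fun k => fourierDistribution ν (F k)) := by
  classical
  let _ : MeasurableSpace V := borel V
  have : BorelSpace V := ⟨rfl⟩
  obtain ⟨u, hu, hu1⟩ := exists_positive_form hc hpointed
  have hcl := hc.isClosed
  obtain ⟨v, κ, _, b, L, hv, hvcard, hb, hL, hμ⟩ := exists_piece_decomposition hc hpointed
  have hLu : ∀ k, ∀ x ∈ L k, x ∈ c ∧ 1 ≤ u x := fun k x hx =>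
    have h := hv x ((hL k).2.1 x hx)
    ⟨h.1.1, hu1 x h.1 h.2⟩
  have hpiece : ∀ k (t : ℝ), 0 < t → ∃ M K, TemperateOn c u M K
      (pieceMeasure (coneDim c - (L k).length) (b k) (L k) t) := fun k t ht => by
    obtain ⟨M, K, h⟩ := exists_temperateOn_pieceMeasure hcl hu (hLu k)
      (coneDim c - (L k).length) (hb k) ht
    exact ⟨M, K, h t le_rfl⟩
  have htotal := fun (t : ℝ) (ht : 0 < t) =>
    exists_temperateOn_sum hu (s := Finset.univ) fun k _ => hpiece k t ht
  choose! M K hM using htotal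
  -- The Riemann sum is a temperate measure for `t > 0` only; `R t` is `0` for the other `t`.
  have hdist : ∀ t : ℝ, ∃ T : 𝓢'(V, ℂ), 0 < t → ∀ h, T h =
      ∫ x, h x ∂(∑ k, pieceMeasure (coneDim c - (L k).length) (b k) (L k) t) := fun t => by
    by_cases ht : 0 < t
    · obtain ⟨T, hT⟩ := exists_distribution hu (hM t ht)
      exact ⟨T, fun _ => hT⟩
    · exact ⟨0, fun h => absurd h ht⟩
  choose R hR using hdist
  choose M' K' hM' using fun k => exists_temperateOn_lebesgueCone hcl hu (hLu k)
  choose T hT using fun k => exists_distribution hu (hM' k)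
  have hR_sum : ∀ t : ℝ, 0 < t → IsRiemannSum Λ c t (R t) := fun t ht h => by
    rw [hR t ht]
    refine hasSum_of_riemannMeasure ht (hμ t ht) ?_
    simpa using (hM t ht).integrable_schwartz hu h c.zero_mem
  have hS_sum : ∀ ζ ∈ tubeDomain c,
      HasSum (fun x : latticePoints Λ c => Complex.exp (ζ (x : V))) (coneGenFun b L ζ) :=
    fun ζ hζ => by
      have h := hasSum_of_riemannMeasure one_pos (hμ 1 one_pos)
        ((hM 1 one_pos).integrable_cexp hcl hu hζ)
      rw [integral_finsetSum_measure fun k _ => ?_] at h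
      · rw [Finset.sum_congr rfl fun k _ => hasLaplace_pieceMeasure hcl hu (hLu k)
          (coneDim c - (L k).length) (hb k) ζ hζ] at h
        simpa [coneGenFun] using h
      · obtain ⟨M, K, hk⟩ := hpiece k 1 one_pos
        exact hk.integrable_cexp hcl hu hζ
  have hRF := hasAsymptoticExpansion_sum hu
    (fun k => hasEulerMaclaurin_pieceMeasure hcl hu (hLu k) (coneDim c - (L k).length) (hb k))
    hpiece hR hT
  refine ⟨coneGenFun b L, coneComponent (coneDim c) v b L, R, _, ⟨hS_sum,
    isMeromorphicOnDual_coneGenFun (fun x hx => one_pos.trans_le (hu1 x (hv x hx).1 (hv x hx).2))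
      fun k => ⟨(hL k).1, (hL k).2.1⟩⟩,
    ⟨v, hv, fun m hm => ?_, fun m hm ζ => if_neg (by omega),
      fun ζ hζ => hasSum_coneComponent hL hζ⟩,
    hR_sum, hRF, fun lam hlam ν _ => ⟨fun t ht => ?_, fun j => ?_, fun ψ n => hRF _ n⟩⟩
  -- The degree `m + |v|` of the numerator is nonnegative because `v` has at least `ℓ` elements.
  · obtain ⟨n, hn⟩ : ∃ n : ℕ, (n : ℤ) = m + v.card := ⟨(m + v.card).toNat, by omega⟩
    exact ⟨n, componentNumerator (coneDim c) v b L (m + coneDim c).toNat, hn,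
      isHomogeneous_componentNumerator hL (by omega), fun ζ => if_pos hm⟩
  -- The Laplace transform of the Riemann sum, from the series on the tube domain.
  · have hlap : HasLaplace c (∑ k, pieceMeasure (coneDim c - (L k).length) (b k) (L k) t)
        fun ζ => ((t : ℂ) ^ coneDim c)⁻¹ * coneGenFun b L ((t : ℂ)⁻¹ • ζ) := fun ζ hζ => by
      have happ : ∀ x, ((t : ℂ)⁻¹ • ζ) x = ζ (t⁻¹ • x) := fun x => by
        rw [map_smul, Complex.real_smul, Complex.ofReal_inv]
        rfl
      have h1 := hasSum_of_riemannMeasure ht (hμ t ht) ((hM t ht).integrable_cexp hcl hu hζ)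
      have h2 := (hS_sum ((t : ℂ)⁻¹ • ζ) fun x hx hx0 => by
        rw [happ]
        exact hζ _ (c.smul_mem (inv_nonneg.2 ht.le) hx)
          (smul_ne_zero (inv_ne_zero ht.ne') hx0)).mul_left ((t : ℂ) ^ coneDim c)⁻¹
      simp_rw [happ] at h2
      exact h1.unique h2
    refine (isBoundaryValue_of_hasLaplace hcl hu (hM t ht) hlap (hR t ht) hlam ν).congr
      fun ξ ε _ => ?_
    rw [smul_smul, div_eq_inv_mul]
  · have h := isBoundaryValue_sum (ν := ν) (lam := lam) Finset.univ fun k _ =>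
      IsBoundaryValue.mul_eval (G := fun ζ => ((L k).map fun x => -(ζ x)⁻¹).prod)
        (isBoundaryValue_of_hasLaplace hcl hu (hM' k) (hasLaplace_lebesgueCone hcl hu (hLu k))
          (hT k) hlam ν)
        (PowerSeries.coeff j (pieceSymbol (coneDim c - (L k).length) (b k) (L k)))
    have hF : fourierDistribution ν (∑ k, PointwiseConvergenceCLM.precomp ℂ
        (diffOp (PowerSeries.coeff j (pieceSymbol (coneDim c - (L k).length) (b k) (L k))))
        (T k)) = ∑ k, fourierDistribution ν (PointwiseConvergenceCLM.precomp ℂ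
        (diffOp (PowerSeries.coeff j (pieceSymbol (coneDim c - (L k).length) (b k) (L k))))
        (T k)) := map_sum (PointwiseConvergenceCLM.precomp ℂ (fourierTest ν)) _ _
    rw [hF]
    -- The formula for the component holds off the hyperplanes `⟨ζ, x⟩ = 0`, which do not meet the
    -- tube domain.
    refine h.congr fun ξ ε hε => (coneComponent_eq_sum hL (fun x hx h0 => ?_) j).symm
    have h1 := neg_I_smul_complexPoint_mem hlam ξ hε x (hv x hx).1.1 (hv x hx).2
    rw [h0] at h1
    exact lt_irrefl _ h1
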